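/- **Theorem 2.3.** **Part I (derivative of a minimax).** Let $X,Y$ be real vector spaces, $\tau>0$ and $G:[0,\tau]\times X\times Y\to\mathbb R$ such that $y\mapsto G(s,x,y)$ is affine for all $s,x$. Put $$g(s)=\inf_{x\in X}\sup_{y\in Y}G(s,x,y)\in[-\infty,+\infty],\qquad X(s)=\{x\in X:\ g(s)=\sup_{y\in Y}G(s,x,y)\},$$ $$d_xG(s,x,y;\varphi)=\lim_{t\searrow0}\frac{G(s,x+t\varphi,y)-G(s,x,y)}{t},\qquad d_sG(0,x,y)=\lim_{s\searrow0}\frac{G(s,x,y)-G(0,x,y)}{s},$$ $$Y(0,x)=\{p\in Y:\ d_xG(0,x,p;\varphi)\text{ exists and is }0\text{ for all }\varphi\in X\}.$$ Assume: * (H0) for all $s\in[0,\tau]$, $x^0\in X(0)$, $x^s\in X(s)$, $y\in Y$: (i) $\theta\mapsto G(s,x^0+\theta(x^s-x^0),y)$ is absolutely continuous on $[0,1]$; (ii) for every $\varphi\in X$, $d_xG(s,x^0+\theta(x^s-x^0),y;\varphi)$ exists for a.e. $\theta\in[0,1]$ and is integrable in $\theta$ over $[0,1]$; * (H1) for all $s\in[0,\tau]$,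 $g(s)$ is finite and $X(s)=\{x^s\}$ is a singleton; and $Y(0,x^0)=\{p^0\}$ is a singleton; * (H2) $d_sG(0,x^0,p^0)$ exists; * (H3) the limit $\displaystyle R(x^0,p^0)=\lim_{s\searrow0}\int_0^1d_xG\Big(s,x^0+\theta(x^s-x^0),p^0;\frac{x^s-x^0}{s}\Big)\,d\theta$ exists. Then $dg(0)=\lim_{s\searrow0}(g(s)-g(0))/s$ exists and $dg(0)=d_sG(0,x^0,p^0)+R(x^0,p^0)$. **Part II (shape derivative for the Helmholtz problem).** Let $N\ge2$, let $\Omega\subset\mathbb R^N$ be bounded and open, and let $k\in\mathbb R$ be such that $k^2$ is not an eigenvalue of $-\Delta$ on $H^1_0(\Omega)$. Let $f,\eta_d\in H^1(\mathbb R^N)$ and $\tilde\eta\in H^2(\mathbb R^N)$. Let $\tau>0$, $V\in C^0([0,\tau];C^1_0(\mathbb R^N,\mathbb R^N))$, where $C^1_0$ is the space of $C^1$ fields which tend to $0$ at infinity together with their first derivatives (with the $C^1$ sup norm), and let $T_s$ be its flow: $\frac{d}{ds}T_s(x)=V(s,T_s(x))$, $T_0(x)=x$. Write $\Omega_s=T_s(\Omega)$,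 $J_s=\det DT_s$, $B(s)=J_s\,DT_s^{-1}(DT_s^{-1})^*$, $\tilde\eta^s=\tilde\eta\circ T_s$, and $$J(\Omega_s)=\int_{\Omega_s}|\nabla\eta_s-\nabla\tilde\eta|^2dx+\int_{\Omega_s}|\eta_s-\eta_d|^2dx,$$ where $\eta_s\in H^1_0(\Omega_s)$ is the weak solution of $-\Delta\eta_s-k^2\eta_s=f$ in $\Omega_s$, $\eta_s=0$ on $\partial\Omega_s$. For $\varphi,\phi\in H_0^1(\Omega)$ let $$L(s,\varphi,\phi)=\int_\Omega B(s)(\nabla\varphi-\nabla\tilde\eta^s)\cdot(\nabla\varphi-\nabla\tilde\eta^s)+|\varphi-\eta_d\circ T_s|^2J_s\,dx+\int_\Omega B(s)\nabla\varphi\cdot\nabla\phi-k^2\varphi\phi J_s-(f\circ T_s)\,\phi J_s\,dx .$$ Then there is $\tau'\in(0,\tau]$ such that the following hold. * For all $s\in[0,\tau']$ the state $\eta_s$ exists and is unique; put $\eta^s=\eta_s\circ T_s$ on $\Omega$. There is a unique adjoint state $p^0\in H^1_0(\Omega)$, i.e. $\int_\Omega 2(\nabla\eta^0-\nabla\tilde\eta)\cdot\nabla\varphi'+2(\eta^0-\eta_d)\varphi'+\nabla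 p^0\cdot\nabla\varphi'-k^2p^0\varphi'\,dx=0$ for all $\varphi'\in H_0^1(\Omega)$. Moreover $\tilde\eta^s\in H^1(\mathbb R^N)$ for $s\in[0,\tau']$, and $\nabla\tilde\eta\cdot V(0)\in H^1(\mathbb R^N)$. * $G=L$, with $X=Y=H^1_0(\Omega)$, is affine in $\phi$ and satisfies (H0)–(H3) on $[0,\tau']$, with $X(s)=\{\eta^s\}$, $Y(0,\eta^0)=\{p^0\}$ and $R(\eta^0,p^0)=0$. Also, for each $s\in[0,\tau']$, exactly one $y^s\in H^1_0(\Omega)$ satisfies the averaged adjoint equation $\int_0^1d_xL(s,\eta^0+\theta(\eta^s-\eta^0),y^s;\varphi)\,d\theta=0$ for all $\varphi\in H^1_0(\Omega)$. * $J(\Omega_s)=g(s)=\inf_\varphi\sup_\phi L(s,\varphi,\phi)$ for all $s\in[0,\tau']$, and the shape derivative $dJ(\Omega;V)=\lim_{s\searrow0}(J(\Omega_s)-J(\Omega))/s$ exists and equals $$\begin{aligned}d_sL(0,\eta^0,p^0)={}&\int_\Omega B'(0)(\nabla\eta^0-\nabla\tilde\eta)\cdot(\nabla\eta^0-\nabla\tilde\eta)-2(\nabla\eta^0-\nabla\tilde\eta)\cdot\nabla\big(\nabla\tilde\eta\cdot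 V(0)\big)\,dx\\&+\int_\Omega|\eta^0-\eta_d|^2\operatorname{div}V(0)-2(\eta^0-\eta_d)\nabla\eta_d\cdot V(0)\,dx\\&+\int_\Omega B'(0)\nabla\eta^0\cdot\nabla p^0-k^2\eta^0p^0\operatorname{div}V(0)-\big(f\operatorname{div}V(0)+\nabla f\cdot V(0)\big)p^0\,dx,\end{aligned}$$ where $B'(0)=\operatorname{div}V(0)\,I-DV(0)-DV(0)^*$. -/

import Mathlib

open MeasureTheory Set Filter Topology
open scoped ContDiff InnerProductSpace

universe u v

noncomputable section

namespace MinimaxShape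

/-! ### Parametrized Lagrangians `G(s, x, y)` and their minimax -/

section Abstract

variable {X Y : Type*} [AddCommGroup X] [Module ℝ X] [AddCommGroup Y] [Module ℝ Y]

/-- The minimax `g(s) = inf_x sup_y G(s, x, y)`, with values in the extended reals. -/
def minimax (G : ℝ → X → Y → ℝ) (s : ℝ) : EReal :=
  ⨅ x : X, ⨆ y : Y, (G s x y : EReal)

/-- The set `X(s)` of minimisers: `g(s) = sup_y G(s, x, y)`. -/
def minimizers (G : ℝ → X → Y → ℝ) (s : ℝ) : Set X :=
  {x | minimax G s = ⨆ y : Y, (G s x y : EReal)}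

/-- The directional derivative `d_x G(s, x, y; φ) = lim_{t ↘ 0} (G(s, x + tφ, y) - G(s, x, y)) / t`
exists and equals `d`. -/
def HasDx (G : ℝ → X → Y → ℝ) (s : ℝ) (x : X) (y : Y) (φ : X) (d : ℝ) : Prop :=
  HasDerivWithinAt (fun t : ℝ => G s (x + t • φ) y) d (Ici 0) 0

/-- The value of `d_x G(s, x, y; φ)` (meaningful where the derivative exists). -/
def dx (G : ℝ → X → Y → ℝ) (s : ℝ) (x : X) (y : Y) (φ : X) : ℝ :=
  derivWithin (fun t : ℝ => G s (x + t • φ) y) (Ici 0) 0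

/-- The derivative `d_s G(0, x, y) = lim_{s ↘ 0} (G(s, x, y) - G(0, x, y)) / s` exists and
equals `d`. -/
def HasDs (G : ℝ → X → Y → ℝ) (x : X) (y : Y) (d : ℝ) : Prop :=
  HasDerivWithinAt (fun s : ℝ => G s x y) d (Ici 0) 0

/-- The set `Y(s, x)` of adjoint states: `d_x G(s, x, p; φ)` exists and vanishes for all `φ`. -/
def adjointStates (G : ℝ → X → Y → ℝ) (s : ℝ) (x : X) : Set Y :=
  {p | ∀ φ : X, HasDx G s x p φ 0}

/-- The set `Y(s, x⁰, xˢ)` of averaged adjoint states: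
`∫₀¹ d_x G(s, x⁰ + θ(xˢ - x⁰), y; φ) dθ = 0` for all `φ` (for `s = 0` and `xˢ = x⁰` this is the
equation of `Y(0, x⁰)`). -/
def averagedAdjointStates (G : ℝ → X → Y → ℝ) (s : ℝ) (x₀ xs : X) : Set Y :=
  {y | ∀ φ : X, ∫ θ in (0 : ℝ)..1, dx G s (x₀ + θ • (xs - x₀)) y φ = 0}

/-- `y ↦ G(s, x, y)` is affine for all `s ∈ [0, τ]` and all `x`. -/
def AffineInY (G : ℝ → X → Y → ℝ) (τ : ℝ) : Prop :=
  ∀ s ∈ Icc 0 τ, ∀ x : X, ∃ a : Y →ᵃ[ℝ] ℝ, ∀ y : Y, G s x y = a y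

/-- Hypothesis (H0). -/
structure H0 (G : ℝ → X → Y → ℝ) (τ : ℝ) : Prop where
  absCont : ∀ s ∈ Icc 0 τ, ∀ x₀ ∈ minimizers G 0, ∀ xs ∈ minimizers G s, ∀ y : Y,
    AbsolutelyContinuousOnInterval (fun θ : ℝ => G s (x₀ + θ • (xs - x₀)) y) 0 1
  exists_dx : ∀ s ∈ Icc 0 τ, ∀ x₀ ∈ minimizers G 0, ∀ xs ∈ minimizers G s, ∀ (y : Y) (φ : X),
    ∀ᵐ θ ∂(volume.restrict (Icc (0 : ℝ) 1)), ∃ d : ℝ, HasDx G s (x₀ + θ • (xs - x₀)) y φ d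
  integrable_dx : ∀ s ∈ Icc 0 τ, ∀ x₀ ∈ minimizers G 0, ∀ xs ∈ minimizers G s, ∀ (y : Y) (φ : X),
    IntegrableOn (fun θ : ℝ => dx G s (x₀ + θ • (xs - x₀)) y φ) (Icc 0 1)

/-- Hypothesis (H1): for `s ∈ [0, τ]`, `g(s)` is finite and `X(s) = {x s}`; moreover the set of
adjoint states at `s = 0` is `Y(0, x 0) = {p}`. -/
structure H1 (G : ℝ → X → Y → ℝ) (τ : ℝ) (x : ℝ → X) (p : Y) : Prop where
  finite : ∀ s ∈ Icc 0 τ, minimax G s ≠ ⊤ ∧ minimax G s ≠ ⊥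
  minimizers_eq : ∀ s ∈ Icc 0 τ, minimizers G s = {x s}
  adjoint_eq : adjointStates G 0 (x 0) = {p}

/-- The quantity `R(s) = ∫₀¹ d_x G(s, x⁰ + θ(xˢ - x⁰), p; (xˢ - x⁰)/s) dθ`. -/
def remainder (G : ℝ → X → Y → ℝ) (x : ℝ → X) (p : Y) (s : ℝ) : ℝ :=
  ∫ θ in (0 : ℝ)..1, dx G s (x 0 + θ • (x s - x 0)) p (s⁻¹ • (x s - x 0))

/-- Hypothesis (H3), with the value of the limit: `R(x⁰, p) = lim_{s ↘ 0} R(s)` exists and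
equals `R`. -/
def HasRemainderLimit (G : ℝ → X → Y → ℝ) (x : ℝ → X) (p : Y) (R : ℝ) : Prop :=
  Tendsto (remainder G x p) (𝓝[>] 0) (𝓝 R)

end Abstract

/-! ### Sobolev spaces on `ℝ^N` -/

/-- `ℝ^N` with its Euclidean norm. -/
abbrev Eucl (N : ℕ) : Type := EuclideanSpace ℝ (Fin N)

/-- `g` is the weak (distributional) gradient of `u` on `ℝ^N`. -/
def IsWeakGradient {N : ℕ} (u : Eucl N → ℝ) (g : Eucl N → Eucl N) : Prop :=
  LocallyIntegrable u volume ∧ LocallyIntegrable g volume ∧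
    ∀ φ : Eucl N → ℝ, ContDiff ℝ ∞ φ → HasCompactSupport φ →
      ∫ x, u x • gradient φ x = -∫ x, φ x • g x

open Classical in
/-- The weak gradient of `u` (unique up to null sets; `0` if there is none). -/
def weakGrad {N : ℕ} (u : Eucl N → ℝ) : Eucl N → Eucl N :=
  if h : ∃ g, IsWeakGradient u g then h.choose else 0

/-- `u ∈ H¹(ℝ^N)`. -/
def MemH1 {N : ℕ} (u : Eucl N → ℝ) : Prop :=
  MemLp u 2 volume ∧ ∃ g : Eucl N → Eucl N, MemLp g 2 volume ∧ IsWeakGradient u g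

/-- `u ∈ H²(ℝ^N)`: `u` and all components of its weak gradient are in `H¹(ℝ^N)`. -/
def MemH2 {N : ℕ} (u : Eucl N → ℝ) : Prop :=
  MemH1 u ∧ ∀ v : Eucl N, MemH1 (fun x => ⟪weakGrad u x, v⟫_ℝ)

/-- The Hilbert space `L²(ℝ^N) × L²(ℝ^N)^N`, containing the pairs `(u, ∇u)` with `u ∈ H¹(ℝ^N)`;
its norm restricts to the `H¹` norm on such pairs. -/
abbrev L2Pair (N : ℕ) : Type :=
  WithLp 2 (Lp ℝ 2 (volume : Measure (Eucl N)) × Lp (Eucl N) 2 (volume : Measure (Eucl N)))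

/-- The pairs `(φ, ∇φ)` with `φ ∈ C_c^∞(Ω)`. -/
def testPairs {N : ℕ} (Ω : Set (Eucl N)) : Set (L2Pair N) :=
  {w | ∃ φ : Eucl N → ℝ, ContDiff ℝ ∞ φ ∧ HasCompactSupport φ ∧ tsupport φ ⊆ Ω ∧
    w.fst =ᵐ[volume] φ ∧ w.snd =ᵐ[volume] gradient φ}

/-- `H¹₀(Ω)`, the closure of `C_c^∞(Ω)` in the `H¹` norm. Its elements are represented as pairs
`(u, ∇u)`, with both components extended by zero outside `Ω`. -/
def H10 {N : ℕ} (Ω : Set (Eucl N)) : Submodule ℝ (L2Pair N) :=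
  (Submodule.span ℝ (testPairs Ω)).topologicalClosure

/-- The function underlying an element of `H¹₀(Ω)`. -/
def fn {N : ℕ} {Ω : Set (Eucl N)} (u : H10 Ω) : Eucl N → ℝ := (u : L2Pair N).fst

/-- The gradient of an element of `H¹₀(Ω)`. -/
def grad {N : ℕ} {Ω : Set (Eucl N)} (u : H10 Ω) : Eucl N → Eucl N := (u : L2Pair N).snd

/-! ### The Helmholtz problem and the shape functional -/

/-- `u ∈ H¹₀(Ω)` is the weak solution of `-Δu - k²u = f` in `Ω`, `u = 0` on `∂Ω`. -/
def IsState {N : ℕ} (k : ℝ) (f : Eucl N → ℝ) (Ω : Set (Eucl N)) (u : H10 Ω) : Prop :=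
  ∀ v : H10 Ω, ∫ x in Ω, (⟪grad u x, grad v x⟫_ℝ - k ^ 2 * fn u x * fn v x)
    = ∫ x in Ω, f x * fn v x

/-- `k²` is not an eigenvalue of the Dirichlet Laplacian `-Δ` on `Ω`. -/
def NotDirichletEigenvalue {N : ℕ} (k : ℝ) (Ω : Set (Eucl N)) : Prop :=
  ∀ u : H10 Ω, IsState k 0 Ω u → u = 0

/-- `∫_Ω |∇u - ∇η̃|² + ∫_Ω |u - η_d|²`. -/
def cost {N : ℕ} (ηt ηd : Eucl N → ℝ) (Ω : Set (Eucl N)) (u : H10 Ω) : ℝ :=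
  (∫ x in Ω, ‖grad u x - weakGrad ηt x‖ ^ 2) + ∫ x in Ω, |fn u x - ηd x| ^ 2

open Classical in
/-- The shape functional `J(Ω) = ∫_Ω |∇η - ∇η̃|² + ∫_Ω |η - η_d|²`, where `η` is the solution of
the Helmholtz problem in `Ω` (meaningful when that problem is uniquely solvable). -/
def shapeJ {N : ℕ} (k : ℝ) (f ηt ηd : Eucl N → ℝ) (Ω : Set (Eucl N)) : ℝ :=
  if h : ∃ u : H10 Ω, IsState k f Ω u then cost ηt ηd Ω h.choose else 0

/-! ### Velocity fields, flows and the transported Lagrangian -/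

/-- `W ∈ C¹₀(ℝ^N, ℝ^N)`: `W` is `C¹`, and `W` and `DW` tend to zero at infinity. -/
def MemC10 {N : ℕ} (W : Eucl N → Eucl N) : Prop :=
  ContDiff ℝ 1 W ∧ Tendsto W (cocompact (Eucl N)) (𝓝 0) ∧
    Tendsto (fderiv ℝ W) (cocompact (Eucl N)) (𝓝 0)

/-- `V ∈ C⁰([0, τ]; C¹₀(ℝ^N, ℝ^N))`, for the norm `sup |W| + sup |DW|` of `C¹₀`. -/
structure IsVelocity {N : ℕ} (τ : ℝ) (V : ℝ → Eucl N → Eucl N) : Prop where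
  mem : ∀ s ∈ Icc 0 τ, MemC10 (V s)
  cont : ∀ s₀ ∈ Icc 0 τ, TendstoUniformly V (V s₀) (𝓝[Icc 0 τ] s₀)
  cont_deriv : ∀ s₀ ∈ Icc 0 τ,
    TendstoUniformly (fun s => fderiv ℝ (V s)) (fderiv ℝ (V s₀)) (𝓝[Icc 0 τ] s₀)

/-- `T` is the flow of `V`: `T_0(x) = x` and `d/ds T_s(x) = V(s, T_s(x))` for `s ∈ [0, τ]`. -/
def IsFlow {N : ℕ} (τ : ℝ) (V T : ℝ → Eucl N → Eucl N) : Prop :=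
  ∀ x, T 0 x = x ∧
    ∀ s ∈ Icc 0 τ, HasDerivWithinAt (fun r => T r x) (V s (T s x)) (Icc 0 τ) s

/-- The Jacobian determinant `J_s(x) = det DT_s(x)`. -/
def jac {N : ℕ} (T : ℝ → Eucl N → Eucl N) (s : ℝ) (x : Eucl N) : ℝ :=
  (fderiv ℝ (T s) x).det

/-- `B(s)(x) = J_s(x) DT_s(x)⁻¹ (DT_s(x)⁻¹)*`. -/
def matB {N : ℕ} (T : ℝ → Eucl N → Eucl N) (s : ℝ) (x : Eucl N) : Eucl N →L[ℝ] Eucl N :=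
  jac T s x • ((fderiv ℝ (T s) x).inverse ∘L
    ContinuousLinearMap.adjoint (fderiv ℝ (T s) x).inverse)

/-- The divergence of a vector field. -/
def divergence {N : ℕ} (W : Eucl N → Eucl N) (x : Eucl N) : ℝ :=
  LinearMap.trace ℝ (Eucl N) (fderiv ℝ W x : Eucl N →ₗ[ℝ] Eucl N)

/-- `B'(0) = (div W) I - DW - DW*`, where `W = V(0)`. -/
def matB' {N : ℕ} (W : Eucl N → Eucl N) (x : Eucl N) : Eucl N →L[ℝ] Eucl N :=
  divergence W x • ContinuousLinearMap.id ℝ (Eucl N) - fderiv ℝ W x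
    - ContinuousLinearMap.adjoint (fderiv ℝ W x)

/-- The Lagrangian on the fixed space `H¹₀(Ω)`, with `η̃ˢ = η̃ ∘ T_s`:
`L(s, φ, ψ) = ∫_Ω B(s)(∇φ - ∇η̃ˢ)·(∇φ - ∇η̃ˢ) + |φ - η_d ∘ T_s|² J_s`
`+ ∫_Ω B(s)∇φ·∇ψ - k² φ ψ J_s - (f ∘ T_s) ψ J_s`. -/
def lagrangian {N : ℕ} (k : ℝ) (f ηt ηd : Eucl N → ℝ) (T : ℝ → Eucl N → Eucl N)
    (Ω : Set (Eucl N)) (s : ℝ) (φ ψ : H10 Ω) : ℝ :=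
  (∫ x in Ω, (⟪matB T s x (grad φ x - weakGrad (fun z => ηt (T s z)) x),
        grad φ x - weakGrad (fun z => ηt (T s z)) x⟫_ℝ
      + |fn φ x - ηd (T s x)| ^ 2 * jac T s x))
  + ∫ x in Ω, (⟪matB T s x (grad φ x), grad ψ x⟫_ℝ - k ^ 2 * fn φ x * fn ψ x * jac T s x
      - f (T s x) * fn ψ x * jac T s x)

/-- The adjoint equation at `s = 0` for `p ∈ H¹₀(Ω)`, associated with the state `η`. -/
def IsAdjoint {N : ℕ} (k : ℝ) (ηt ηd : Eucl N → ℝ) (Ω : Set (Eucl N)) (η p : H10 Ω) : Prop :=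
  ∀ v : H10 Ω, ∫ x in Ω, (2 * ⟪grad η x - weakGrad ηt x, grad v x⟫_ℝ
    + 2 * (fn η x - ηd x) * fn v x + ⟪grad p x, grad v x⟫_ℝ - k ^ 2 * fn p x * fn v x) = 0

/-- The explicit expression of `d_s L(0, η, p)`, where `W = V(0)`. -/
def shapeDerivative {N : ℕ} (k : ℝ) (f ηt ηd : Eucl N → ℝ) (W : Eucl N → Eucl N)
    (Ω : Set (Eucl N)) (η p : H10 Ω) : ℝ :=
  (∫ x in Ω, (⟪matB' W x (grad η x - weakGrad ηt x), grad η x - weakGrad ηt x⟫_ℝ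
      - 2 * ⟪grad η x - weakGrad ηt x, weakGrad (fun z => ⟪weakGrad ηt z, W z⟫_ℝ) x⟫_ℝ))
  + (∫ x in Ω, (|fn η x - ηd x| ^ 2 * divergence W x
      - 2 * (fn η x - ηd x) * ⟪weakGrad ηd x, W x⟫_ℝ))
  + ∫ x in Ω, (⟪matB' W x (grad η x), grad p x⟫_ℝ
      - k ^ 2 * fn η x * fn p x * divergence W x
      - (f x * divergence W x + ⟪weakGrad f x, W x⟫_ℝ) * fn p x)

end MinimaxShape

end

open MinimaxShape

noncomputable section

namespace MinimaxShape

/-! ### The derivative of a minimax -/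

section AbstractMinimax

set_option linter.unusedSectionVars false

variable {X : Type u} {Y : Type v} [AddCommGroup X] [Module ℝ X] [AddCommGroup Y] [Module ℝ Y]

/-! Part I. An affine function that is bounded above is constant. Since `g(s)` is finite, `G(s, xˢ,
·)` is bounded above at the minimiser, so `g(s) = G(s, xˢ, y)` for every `y`, in particular for the
fixed adjoint state `p`. The difference quotient of `g` then splits into `(G(s, x⁰, p) - G(0, x⁰,
p))/s`, which tends to `d_s G`, and `(G(s, xˢ, p) - G(s, x⁰, p))/s`, which the fundamental theorem
of calculus along the segment from `x⁰` to `xˢ` identifies with the remainder `R(s)`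
(`remainder_eq`).

Part II, abstract level. With `H¹₀(Ω)` seen as a closed subspace `K` of `L² × L²`, the Lagrangian is
`⟪N(φ - D), φ - D⟫ + ⟪Mφ, ψ⟫ - ⟪F, ψ⟫` with `N, M, D, F` depending on `s`. The supremum over `ψ` is
infinite unless `φ` solves the state equation, so the minimax is the cost of the state.
Invertibility of the state operator at `s = 0` persists for small `s`, and `ηˢ = A(s)⁻¹F(s)` is
differentiable at `0`. Since `d_x L` is affine in the base point, its average over the segment is
its value at the midpoint; as `s → 0` the remainder tends to the adjoint equation tested with the
derivative of `ηˢ`, which is zero. All this is `quadLagrangian_minimax_hypotheses`.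

Part II, analytic level. It remains to supply the data. Differentiability: `T_s = id + sV(0) + o(s)`
and `DT_s = I + sDV(0) + o(s)` uniformly in space, so `J_s` and `B(s)` are differentiable in `L^∞`.
For `u ∈ H¹`, the difference quotients of `u ∘ T_s` are bounded in `L²` by the gradient norm, so
their limit `∇u · V(0)` need only be checked on test functions. For `u ∈ H²` the gradients `DT_s*
(∇u ∘ T_s)` are differentiable too, and the limit is a gradient because the pairs `(u, ∇u)` form a
closed space. Invertibility at `s = 0`: a Gårding inequality, Rellich's theorem and the assumption
on `k²` give the Fredholm alternative `isUnit_of_garding`. Perturbed domains: `T_s` is a `C¹`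
diffeomorphism close to the identity, composition with it is an isomorphism from `H¹₀(Ω_s)` to
`H¹₀(Ω)`, and a change of variables turns the forms on `Ω_s` into those with coefficients `J_s` and
`B(s)`. -/

lemma affineMap_const_of_bddAbove (a : Y →ᵃ[ℝ] ℝ) {M : ℝ} (hM : ∀ y, a y ≤ M) (y z : Y) :
    a y = a z := by
  have key : ∀ t : ℝ, t * (a y - a z) + a z ≤ M := fun t => by
    have h := hM (AffineMap.lineMap z y t)
    rw [AffineMap.apply_lineMap, AffineMap.lineMap_apply] at h
    simpa using h
  by_contra hne
  have hd : a y - a z ≠ 0 := sub_ne_zero.mpr hne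
  -- On the line through `z` and `y` this parameter gives the value `M + 1`.
  have h := key ((M - a z + 1) / (a y - a z))
  rw [div_mul_cancel₀ _ hd] at h
  linarith

/-- At a minimiser of a Lagrangian which is affine in `y`, the Lagrangian does not depend on
`y`. -/
lemma eq_minimax_of_mem_minimizers {G : ℝ → X → Y → ℝ} {τ : ℝ} (ha : AffineInY G τ) {s : ℝ}
    (hs : s ∈ Icc 0 τ) (hfin : minimax G s ≠ ⊤ ∧ minimax G s ≠ ⊥) {x : X}
    (hx : x ∈ minimizers G s) (y : Y) : G s x y = (minimax G s).toReal := by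
  obtain ⟨a, hGa⟩ := ha s hs x
  have hx' : minimax G s = ⨆ y : Y, (G s x y : EReal) := hx
  have hle : ∀ z, G s x z ≤ (minimax G s).toReal := fun z => by
    rw [← EReal.coe_le_coe_iff, EReal.coe_toReal hfin.1 hfin.2, hx']
    exact le_iSup (fun y : Y => (G s x y : EReal)) z
  have hconst : ∀ z, G s x z = G s x y := fun z => by
    rw [hGa, hGa]
    exact affineMap_const_of_bddAbove a (fun w => by rw [← hGa]; exact hle w) z y
  refine le_antisymm (hle y) ?_
  rw [← EReal.coe_le_coe_iff, EReal.coe_toReal hfin.1 hfin.2, hx']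
  exact iSup_le fun z => by rw [hconst z]

lemma HasDx.dx_eq {G : ℝ → X → Y → ℝ} {s : ℝ} {x : X} {y : Y} {φ : X} {d : ℝ}
    (h : HasDx G s x y φ d) : dx G s x y φ = d :=
  HasDerivWithinAt.derivWithin h (uniqueDiffWithinAt_Ici 0)

/-- A one-sided derivative is only positively homogeneous, hence `0 ≤ c`. It is used to take the
factor `1/s` out of the direction `(xˢ - x⁰)/s`. -/
lemma HasDx.smul {G : ℝ → X → Y → ℝ} {s : ℝ} {x : X} {y : Y} {φ : X} {d : ℝ}
    (h : HasDx G s x y φ d) {c : ℝ} (hc : 0 ≤ c) : HasDx G s x y (c • φ) (c * d) := by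
  unfold HasDx at h ⊢
  have h1 : HasDerivWithinAt (fun t : ℝ => c * t) c (Ici 0) 0 := by
    simpa using ((hasDerivAt_id (0 : ℝ)).const_mul c).hasDerivWithinAt
  have h2 : MapsTo (fun t : ℝ => c * t) (Ici 0) (Ici 0) := fun t ht =>
    mul_nonneg hc ht
  have h3 : HasDerivWithinAt (fun t : ℝ => G s (x + t • φ) y) d (Ici 0) (c * 0) := by
    simpa using h
  have := h3.scomp (0 : ℝ) h1 h2
  simpa [Function.comp_def, smul_smul, mul_comm] using this

/-- Moving the base point along the segment is the same as moving `θ`, so the one-sided directional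
derivative is the ordinary derivative in `θ` at each `θ` where the latter exists, which for an
absolutely continuous function is almost everywhere. -/
lemma deriv_segment_eq_of_hasDx {G : ℝ → X → Y → ℝ} {s : ℝ} {x φ : X} {y : Y} {θ d : ℝ}
    (hd : DifferentiableAt ℝ (fun θ : ℝ => G s (x + θ • φ) y) θ)
    (h : HasDx G s (x + θ • φ) y φ d) : deriv (fun θ : ℝ => G s (x + θ • φ) y) θ = d := by
  have h1 : HasDerivWithinAt (fun t : ℝ => G s (x + θ • φ + t • φ) y)
      (deriv (fun θ : ℝ => G s (x + θ • φ) y) θ) (Ici 0) 0 := by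
    have h2 : HasDerivAt (fun θ : ℝ => G s (x + θ • φ) y)
      (deriv (fun θ : ℝ => G s (x + θ • φ) y) θ) (θ + 0) := by simpa using hd.hasDerivAt
    have := (h2.comp_const_add θ 0).hasDerivWithinAt (s := Ici 0)
    simpa [add_smul, add_assoc] using this
  exact (uniqueDiffWithinAt_Ici (0 : ℝ)).eq_deriv _ h1 h

/-- The fundamental theorem of calculus for absolutely continuous functions, applied in `θ`; this is
the only use of (H0). -/
lemma remainder_eq {G : ℝ → X → Y → ℝ} {τ : ℝ} (h0 : H0 G τ) {x : ℝ → X} {p : Y} {s : ℝ}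
    (hs : s ∈ Ioc 0 τ) (hx0 : x 0 ∈ minimizers G 0) (hxs : x s ∈ minimizers G s) :
    remainder G x p s = (G s (x s) p - G s (x 0) p) / s := by
  have hs' : s ∈ Icc 0 τ := ⟨hs.1.le, hs.2⟩
  have hac := h0.absCont s hs' _ hx0 _ hxs p
  have hFTC := hac.integral_deriv_eq_sub
  have hae : ∀ᵐ θ : ℝ, θ ∈ uIoc (0 : ℝ) 1 →
      dx G s (x 0 + θ • (x s - x 0)) p (s⁻¹ • (x s - x 0))
        = s⁻¹ * deriv (fun θ : ℝ => G s (x 0 + θ • (x s - x 0)) p) θ := by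
    have h1 := (ae_restrict_iff' measurableSet_Icc).mp
      (h0.exists_dx s hs' _ hx0 _ hxs p (x s - x 0))
    filter_upwards [h1, hac.ae_differentiableAt] with θ hθ1 hθ2 hθ
    rw [uIoc_of_le zero_le_one] at hθ
    obtain ⟨d, hd⟩ := hθ1 ⟨hθ.1.le, hθ.2⟩
    rw [(hd.smul (inv_nonneg.mpr hs.1.le)).dx_eq,
      deriv_segment_eq_of_hasDx (hθ2 (by rw [uIcc_of_le zero_le_one]; exact ⟨hθ.1.le, hθ.2⟩)) hd]
  rw [remainder, intervalIntegral.integral_congr_ae hae, intervalIntegral.integral_const_mul, hFTC]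
  simp only [one_smul, zero_smul, add_zero, add_sub_cancel]
  field_simp

theorem hasDerivWithinAt_minimax {τ : ℝ} {G : ℝ → X → Y → ℝ} {x : ℝ → X} {p : Y} {d R : ℝ}
    (hτ : 0 < τ) (ha : AffineInY G τ) (h0 : H0 G τ) (h1 : H1 G τ x p)
    (h2 : HasDs G (x 0) p d) (h3 : HasRemainderLimit G x p R) :
    HasDerivWithinAt (fun s => (minimax G s).toReal) (d + R) (Ici 0) 0 := by
  have hmem : ∀ s ∈ Icc 0 τ, x s ∈ minimizers G s := fun s hs => by
    rw [h1.minimizers_eq s hs]; rfl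
  have hval : ∀ s ∈ Icc 0 τ, (minimax G s).toReal = G s (x s) p := fun s hs =>
    (eq_minimax_of_mem_minimizers ha hs (h1.finite s hs) (hmem s hs) p).symm
  have h00 : (0 : ℝ) ∈ Icc 0 τ := ⟨le_rfl, hτ.le⟩
  rw [hasDerivWithinAt_iff_tendsto_slope, Ici_sdiff_left]
  have h2' := h2
  unfold HasDs at h2'
  rw [hasDerivWithinAt_iff_tendsto_slope, Ici_sdiff_left] at h2'
  refine (h2'.add h3).congr' ?_
  filter_upwards [Ioc_mem_nhdsGT hτ] with s hs
  have hs' : s ∈ Icc 0 τ := ⟨hs.1.le, hs.2⟩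
  rw [remainder_eq h0 hs (hmem 0 h00) (hmem s hs'), slope_def_field, slope_def_field,
    hval s hs', hval 0 h00]
  ring

end AbstractMinimax

/-! ### Quadratic Lagrangians on a Hilbert space -/

section QuadraticLagrangian

set_option linter.unusedSectionVars false

variable {H : Type*} [NormedAddCommGroup H] [InnerProductSpace ℝ H] [CompleteSpace H]
  {K : Submodule ℝ H} [CompleteSpace K]

variable (K) in
/-- The operator on `K` representing the bilinear form `⟪M φ, ψ⟫` restricted to `K`. -/
def formOp (M : H →L[ℝ] H) : K →L[ℝ] K :=
  ContinuousLinearMap.adjoint K.subtypeL ∘L M ∘L K.subtypeL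

lemma inner_formOp (M : H →L[ℝ] H) (φ ψ : K) :
    ⟪formOp K M φ, ψ⟫_ℝ = ⟪M (φ : H), (ψ : H)⟫_ℝ := by
  simp [formOp, ContinuousLinearMap.adjoint_inner_left]

lemma inner_adjoint_subtypeL (F : H) (ψ : K) :
    ⟪ContinuousLinearMap.adjoint K.subtypeL F, ψ⟫_ℝ = ⟪F, (ψ : H)⟫_ℝ := by
  simp [ContinuousLinearMap.adjoint_inner_left]

/-- The Lagrangian `⟪N (φ - D), φ - D⟫ + ⟪M φ, ψ⟫ - ⟪F, ψ⟫` on `K`. -/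
def quadLagrangian (N M : H →L[ℝ] H) (D F : H) (φ ψ : K) : ℝ :=
  ⟪N ((φ : H) - D), (φ : H) - D⟫_ℝ + ⟪M (φ : H), (ψ : H)⟫_ℝ - ⟪F, (ψ : H)⟫_ℝ

variable {G : ℝ → K → K → ℝ} {N M : ℝ → H →L[ℝ] H} {D F : ℝ → H}

/-- The Lagrangian is a quadratic polynomial along lines: the linear coefficient gives `d_x`, and
polynomials are absolutely continuous. Symmetry of `N` merges the two cross terms. -/
lemma quadLagrangian_add_smul {N M : H →L[ℝ] H} (hN : ∀ u v, ⟪N u, v⟫_ℝ = ⟪u, N v⟫_ℝ) (D F : H)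
    (x φ y : K) (t : ℝ) :
    quadLagrangian N M D F (x + t • φ) y = quadLagrangian N M D F x y
      + t * (2 * ⟪N ((x : H) - D), (φ : H)⟫_ℝ + ⟪M (φ : H), (y : H)⟫_ℝ)
      + t ^ 2 * ⟪N (φ : H), (φ : H)⟫_ℝ := by
  have e : ((x + t • φ : K) : H) - D = ((x : H) - D) + t • (φ : H) := by
    push_cast; abel
  have hs : ⟪N (φ : H), (x : H) - D⟫_ℝ = ⟪N ((x : H) - D), (φ : H)⟫_ℝ := by
    rw [hN, real_inner_comm]
  simp only [quadLagrangian, e]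
  have e2 : ((x + t • φ : K) : H) = (x : H) + t • (φ : H) := by push_cast; rfl
  rw [e2]
  simp only [map_add, map_smul, inner_add_left, inner_add_right, real_inner_smul_left,
    real_inner_smul_right, hs]
  ring

lemma quadLagrangian_hasDx {τ : ℝ}
    (hG : ∀ s ∈ Icc 0 τ, ∀ φ ψ, G s φ ψ = quadLagrangian (N s) (M s) (D s) (F s) φ ψ)
    (hN : ∀ s ∈ Icc 0 τ, ∀ u v, ⟪N s u, v⟫_ℝ = ⟪u, N s v⟫_ℝ) {s : ℝ} (hs : s ∈ Icc 0 τ)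
    (x y φ : K) :
    HasDx G s x y φ (2 * ⟪N s ((x : H) - D s), (φ : H)⟫_ℝ + ⟪M s (φ : H), (y : H)⟫_ℝ) := by
  unfold HasDx
  have e : (fun t : ℝ => G s (x + t • φ) y) = fun t : ℝ =>
      quadLagrangian (N s) (M s) (D s) (F s) x y
      + t * (2 * ⟪N s ((x : H) - D s), (φ : H)⟫_ℝ + ⟪M s (φ : H), (y : H)⟫_ℝ)
      + t ^ 2 * ⟪N s (φ : H), (φ : H)⟫_ℝ := by
    funext t
    rw [hG s hs, quadLagrangian_add_smul (hN s hs)]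
  rw [e]
  have h1 := ((hasDerivAt_id (0 : ℝ)).mul_const
    (2 * ⟪N s ((x : H) - D s), (φ : H)⟫_ℝ + ⟪M s (φ : H), (y : H)⟫_ℝ)).const_add
      (quadLagrangian (N s) (M s) (D s) (F s) x y)
  have h2 := (hasDerivAt_pow 2 (0 : ℝ)).mul_const ⟪N s (φ : H), (φ : H)⟫_ℝ
  refine ((h1.add h2).hasDerivWithinAt (s := Ici 0)).congr_deriv ?_
  simp

/-- The derivative is affine in the base point, so averaging over the segment evaluates it at the
midpoint. -/
lemma quadLagrangian_integral_dx {τ : ℝ}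
    (hG : ∀ s ∈ Icc 0 τ, ∀ φ ψ, G s φ ψ = quadLagrangian (N s) (M s) (D s) (F s) φ ψ)
    (hN : ∀ s ∈ Icc 0 τ, ∀ u v, ⟪N s u, v⟫_ℝ = ⟪u, N s v⟫_ℝ) {s : ℝ} (hs : s ∈ Icc 0 τ)
    (x₀ xs y φ : K) :
    ∫ θ in (0 : ℝ)..1, dx G s (x₀ + θ • (xs - x₀)) y φ
      = 2 * ⟪N s ((2⁻¹ : ℝ) • ((x₀ : H) + xs) - D s), (φ : H)⟫_ℝ + ⟪M s (φ : H), (y : H)⟫_ℝ := by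
  have e : ∀ θ : ℝ, dx G s (x₀ + θ • (xs - x₀)) y φ
      = (2 * ⟪N s ((x₀ : H) - D s), (φ : H)⟫_ℝ + ⟪M s (φ : H), (y : H)⟫_ℝ)
        + θ * (2 * ⟪N s ((xs : H) - x₀), (φ : H)⟫_ℝ) := fun θ => by
    rw [(quadLagrangian_hasDx hG hN hs _ y φ).dx_eq]
    have : ((x₀ + θ • (xs - x₀) : K) : H) - D s = ((x₀ : H) - D s) + θ • ((xs : H) - x₀) := by
      push_cast; abel
    rw [this, map_add, map_smul, inner_add_left, real_inner_smul_left]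
    ring
  simp_rw [e]
  rw [intervalIntegral.integral_add (by simp) (by
      exact (continuous_id.mul continuous_const).intervalIntegrable _ _),
    intervalIntegral.integral_mul_const, integral_id]
  have : (2⁻¹ : ℝ) • ((x₀ : H) + xs) - D s
      = ((x₀ : H) - D s) + (2⁻¹ : ℝ) • ((xs : H) - x₀) := by
    rw [smul_sub, smul_add]
    nth_rewrite 2 [show (x₀ : H) = (2⁻¹ : ℝ) • (x₀ : H) + (2⁻¹ : ℝ) • (x₀ : H) by
      rw [← add_smul]; norm_num]
    abel
  rw [this, map_add, map_smul, inner_add_left, real_inner_smul_left]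
  simp
  ring

lemma differentiableAt_ringInverse_clm {E : Type*} [NormedAddCommGroup E] [NormedSpace ℝ E]
    [CompleteSpace E] {A : E →L[ℝ] E} (hA : IsUnit A) : DifferentiableAt ℝ Ring.inverse A := by
  obtain ⟨U, rfl⟩ := hA
  exact (contDiffAt_ringInverse (R := E →L[ℝ] E) ℝ (n := 1) U).differentiableAt one_ne_zero

lemma exists_hasDerivWithinAt_ringInverse {E : Type*} [NormedAddCommGroup E] [NormedSpace ℝ E]
    [CompleteSpace E] {A : ℝ → E →L[ℝ] E} {A' : E →L[ℝ] E} {S : Set ℝ} {t : ℝ}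
    (hA' : HasDerivWithinAt A A' S t) (hA : IsUnit (A t)) :
    ∃ B' : E →L[ℝ] E, HasDerivWithinAt (fun s => Ring.inverse (A s)) B' S t :=
  ⟨_, DifferentiableWithinAt.hasDerivWithinAt (DifferentiableAt.comp_differentiableWithinAt
    (F := E →L[ℝ] E) (G := E →L[ℝ] E) t (differentiableAt_ringInverse_clm hA)
    (HasDerivWithinAt.differentiableWithinAt hA'))⟩

lemma isUnit_formOp_solve {A : K →L[ℝ] K} (hA : IsUnit A) (b u : K) :
    A u = b ↔ u = Ring.inverse A b := by
  constructor
  · rintro rfl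
    change u = (Ring.inverse A * A) u
    rw [Ring.inverse_mul_cancel A hA]; rfl
  · rintro rfl
    change (A * Ring.inverse A) b = b
    rw [Ring.mul_inverse_cancel A hA]; rfl

/-- A variational equation tested on `K` is an operator equation in `K`; an invertible operator
gives existence, uniqueness and a formula that can be differentiated in `s`. -/
lemma formOp_solve {M : H →L[ℝ] H} (hA : IsUnit (formOp K M)) (F : H) (u : K) :
    (∀ v : K, ⟪M (u : H), (v : H)⟫_ℝ = ⟪F, (v : H)⟫_ℝ)
      ↔ u = Ring.inverse (formOp K M) (ContinuousLinearMap.adjoint K.subtypeL F) := by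
  rw [← isUnit_formOp_solve hA]
  constructor
  · intro h
    exact ext_inner_right ℝ fun v => by rw [inner_formOp, inner_adjoint_subtypeL, h]
  · intro h v
    rw [← inner_formOp, h, inner_adjoint_subtypeL]

lemma iSup_quadLagrangian_of_state {N M : H →L[ℝ] H} {D F : H} {x : K}
    (hx : ∀ v : K, ⟪M (x : H), (v : H)⟫_ℝ = ⟪F, (v : H)⟫_ℝ) :
    ⨆ y : K, (quadLagrangian N M D F x y : EReal)
      = (⟪N ((x : H) - D), (x : H) - D⟫_ℝ : ℝ) := by
  have : ∀ y : K, quadLagrangian N M D F x y = ⟪N ((x : H) - D), (x : H) - D⟫_ℝ := fun y => by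
    rw [quadLagrangian, hx]; ring
  simp only [this]
  exact iSup_const

lemma iSup_quadLagrangian_of_not_state {N M : H →L[ℝ] H} {D F : H} {x v : K}
    (hx : ⟪M (x : H), (v : H)⟫_ℝ ≠ ⟪F, (v : H)⟫_ℝ) :
    ⨆ y : K, (quadLagrangian N M D F x y : EReal) = ⊤ := by
  rw [EReal.eq_top_iff_forall_lt]
  intro c
  set a := ⟪M (x : H), (v : H)⟫_ℝ - ⟪F, (v : H)⟫_ℝ with ha
  have ha0 : a ≠ 0 := sub_ne_zero.mpr hx
  set b := ⟪N ((x : H) - D), (x : H) - D⟫_ℝ with hb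
  -- On the ray spanned by `v` the Lagrangian is `b + t a` with `a ≠ 0`; this `t` gives the value `c
  -- + 1`.
  refine lt_of_lt_of_le ?_ (le_iSup (fun y : K => (quadLagrangian N M D F x y : EReal))
    (((c + 1 - b) / a) • v))
  rw [EReal.coe_lt_coe_iff]
  have : quadLagrangian N M D F x (((c + 1 - b) / a) • v) = b + ((c + 1 - b) / a) * a := by
    rw [quadLagrangian]
    push_cast
    rw [real_inner_smul_right, real_inner_smul_right, ha]
    ring
  rw [this, div_mul_cancel₀ _ ha0]
  linarith

/-- The second variable acts as a Lagrange multiplier: violating the state equation costs `⊤`, so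
only the state competes in the infimum. -/
lemma minimax_quadLagrangian {N M : H →L[ℝ] H} {D F : H} {s : ℝ} {η : K}
    (hG : ∀ φ ψ, G s φ ψ = quadLagrangian N M D F φ ψ)
    (hη : ∀ u : K, (∀ v : K, ⟪M (u : H), (v : H)⟫_ℝ = ⟪F, (v : H)⟫_ℝ) ↔ u = η) :
    minimax G s = (⟪N ((η : H) - D), (η : H) - D⟫_ℝ : ℝ) ∧ minimizers G s = {η} := by
  have hval : minimax G s = (⟪N ((η : H) - D), (η : H) - D⟫_ℝ : ℝ) := by
    simp only [minimax, hG]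
    refine le_antisymm ?_ (le_iInf fun x => ?_)
    · refine (iInf_le _ η).trans ?_
      rw [iSup_quadLagrangian_of_state ((hη η).mpr rfl)]
    · by_cases hx : x = η
      · rw [hx, iSup_quadLagrangian_of_state ((hη η).mpr rfl)]
      · have := mt (hη x).mp hx
        push Not at this
        obtain ⟨v, hv⟩ := this
        rw [iSup_quadLagrangian_of_not_state hv]
        exact le_top
  refine ⟨hval, ?_⟩
  ext x
  simp only [minimizers, mem_ofPred_eq, mem_singleton_iff, hval, hG]
  constructor
  · intro h
    by_contra hx
    have := mt (hη x).mp hx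
    push Not at this
    obtain ⟨v, hv⟩ := this
    rw [iSup_quadLagrangian_of_not_state hv] at h
    exact EReal.coe_ne_top _ h
  · rintro rfl
    rw [iSup_quadLagrangian_of_state ((hη x).mpr rfl)]

lemma hasDerivWithinAt_formOp {M' : H →L[ℝ] H} (hM' : HasDerivWithinAt M M' (Ici 0) 0) :
    HasDerivWithinAt (fun s => formOp K (M s)) (formOp K M') (Ici 0) 0 := by
  have h1 : HasDerivWithinAt (fun s => M s ∘L K.subtypeL) (M' ∘L K.subtypeL) (Ici 0) 0 := by
    simpa using hM'.clm_comp (hasDerivWithinAt_const (0 : ℝ) (Ici 0) K.subtypeL)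
  exact ((hasDerivWithinAt_const (0 : ℝ) (Ici 0)
    (ContinuousLinearMap.adjoint K.subtypeL)).clm_comp h1).congr_deriv (by simp [formOp])

/-- Inversion is differentiable at units. The value of the derivative is never needed: any limit of
`(ηˢ - η⁰)/s` is cancelled by the adjoint equation. -/
lemma exists_hasDerivWithinAt_solve {M' : H →L[ℝ] H} {F' : H}
    (hM' : HasDerivWithinAt M M' (Ici 0) 0) (hF' : HasDerivWithinAt F F' (Ici 0) 0)
    (hA : IsUnit (formOp K (M 0))) :
    ∃ η' : K, HasDerivWithinAt (fun s => Ring.inverse (formOp K (M s))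
      (ContinuousLinearMap.adjoint K.subtypeL (F s))) η' (Ici 0) 0 := by
  obtain ⟨_, h2⟩ := exists_hasDerivWithinAt_ringInverse (hasDerivWithinAt_formOp (K := K) hM') hA
  have h3 : HasDerivWithinAt (fun s => ContinuousLinearMap.adjoint K.subtypeL (F s))
      (ContinuousLinearMap.adjoint K.subtypeL F') (Ici 0) 0 :=
    (ContinuousLinearMap.adjoint K.subtypeL).hasFDerivAt.comp_hasDerivWithinAt (0 : ℝ) hF'
  exact ⟨_, h2.clm_apply h3⟩

lemma hasDerivWithinAt_quadLagrangian {N' M' : H →L[ℝ] H} {D' F' : H}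
    (hN' : HasDerivWithinAt N N' (Ici 0) 0) (hM' : HasDerivWithinAt M M' (Ici 0) 0)
    (hD' : HasDerivWithinAt D D' (Ici 0) 0) (hF' : HasDerivWithinAt F F' (Ici 0) 0)
    (hN : ∀ u v, ⟪N 0 u, v⟫_ℝ = ⟪u, N 0 v⟫_ℝ) (x p : K) :
    HasDerivWithinAt (fun s => quadLagrangian (N s) (M s) (D s) (F s) x p)
      (⟪N' ((x : H) - D 0), (x : H) - D 0⟫_ℝ
        - 2 * ⟪N 0 ((x : H) - D 0), D'⟫_ℝ + ⟪M' (x : H), (p : H)⟫_ℝ - ⟪F', (p : H)⟫_ℝ)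
      (Ici 0) 0 := by
  have h1 : HasDerivWithinAt (fun s => (x : H) - D s) (-D') (Ici 0) 0 := by
    simpa using hD'.const_sub (x : H)
  have h2 := (hN'.clm_apply h1).inner ℝ h1
  have h3 := (hM'.clm_apply (hasDerivWithinAt_const (0 : ℝ) (Ici 0) (x : H))).inner ℝ
    (hasDerivWithinAt_const (0 : ℝ) (Ici 0) (p : H))
  have h4 := hF'.inner ℝ (hasDerivWithinAt_const (0 : ℝ) (Ici 0) (p : H))
  refine ((h2.add h3).sub h4).congr_deriv ?_
  simp only [map_neg, inner_add_left, inner_neg_left, inner_neg_right, map_zero, add_zero,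
    inner_zero_right, zero_add]
  rw [hN D', real_inner_comm (N 0 ((x : H) - D 0)) D']
  ring

lemma tendsto_averaged_dx_slope {N' M' : H →L[ℝ] H} {D' : H} {η : ℝ → K} {η' : K}
    (hN' : HasDerivWithinAt N N' (Ici 0) 0) (hM' : HasDerivWithinAt M M' (Ici 0) 0)
    (hD' : HasDerivWithinAt D D' (Ici 0) 0) (hη' : HasDerivWithinAt η η' (Ici 0) 0) (p : K) :
    Tendsto (fun s => 2 * ⟪N s ((2⁻¹ : ℝ) • ((η 0 : H) + η s) - D s),
          ((slope η 0 s : K) : H)⟫_ℝ + ⟪M s ((slope η 0 s : K) : H), (p : H)⟫_ℝ) (𝓝[>] 0)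
        (𝓝 (2 * ⟪N 0 ((2⁻¹ : ℝ) • ((η 0 : H) + η 0) - D 0), (η' : H)⟫_ℝ
          + ⟪M 0 (η' : H), (p : H)⟫_ℝ)) := by
  have hs0 : 𝓝[>] (0 : ℝ) ≤ 𝓝[≥] 0 := nhdsWithin_mono _ Ioi_subset_Ici_self
  have tN : Tendsto N (𝓝[>] 0) (𝓝 (N 0)) := hN'.continuousWithinAt.tendsto.mono_left hs0
  have tM : Tendsto M (𝓝[>] 0) (𝓝 (M 0)) := hM'.continuousWithinAt.tendsto.mono_left hs0
  have tD : Tendsto D (𝓝[>] 0) (𝓝 (D 0)) := hD'.continuousWithinAt.tendsto.mono_left hs0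
  have tη : Tendsto (fun s => (η s : H)) (𝓝[>] 0) (𝓝 (η 0 : H)) :=
    (continuous_subtype_val.tendsto _).comp (hη'.continuousWithinAt.tendsto.mono_left hs0)
  have tsl : Tendsto (fun s => ((slope η 0 s : K) : H)) (𝓝[>] 0) (𝓝 (η' : H)) := by
    have := hη'
    rw [hasDerivWithinAt_iff_tendsto_slope, Ici_sdiff_left] at this
    exact (continuous_subtype_val.tendsto _).comp this
  have happ : Continuous fun q : (H →L[ℝ] H) × H => q.1 q.2 :=
    isBoundedBilinearMap_apply.continuous
  have tNx : Tendsto (fun s => N s ((2⁻¹ : ℝ) • ((η 0 : H) + η s) - D s)) (𝓝[>] 0)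
      (𝓝 (N 0 ((2⁻¹ : ℝ) • ((η 0 : H) + η 0) - D 0))) :=
    (happ.tendsto (N 0, _)).comp (tN.prodMk_nhds
      (((tendsto_const_nhds.add tη).const_smul (2⁻¹ : ℝ)).sub tD))
  have tMx : Tendsto (fun s => M s ((slope η 0 s : K) : H)) (𝓝[>] 0) (𝓝 (M 0 (η' : H))) :=
    (happ.tendsto (M 0, _)).comp (tM.prodMk_nhds tsl)
  exact ((tNx.inner tsl).const_mul 2).add (tMx.inner tendsto_const_nhds)

/-- Everything follows from invertibility of the state operator at `s = 0` and differentiability of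
the four data at `0`; the new horizon is chosen so that the operator stays invertible. -/
theorem quadLagrangian_minimax_hypotheses {τ : ℝ} (hτ : 0 < τ)
    (hG : ∀ s ∈ Icc 0 τ, ∀ φ ψ, G s φ ψ = quadLagrangian (N s) (M s) (D s) (F s) φ ψ)
    (hN : ∀ s ∈ Icc 0 τ, ∀ u v, ⟪N s u, v⟫_ℝ = ⟪u, N s v⟫_ℝ)
    (hM : ∀ s ∈ Icc 0 τ, ∀ u v, ⟪M s u, v⟫_ℝ = ⟪u, M s v⟫_ℝ)
    {N' M' : H →L[ℝ] H} {D' F' : H}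
    (hN' : HasDerivWithinAt N N' (Ici 0) 0) (hM' : HasDerivWithinAt M M' (Ici 0) 0)
    (hD' : HasDerivWithinAt D D' (Ici 0) 0) (hF' : HasDerivWithinAt F F' (Ici 0) 0)
    (hA : IsUnit (formOp K (M 0))) :
    ∃ τ' ∈ Ioc 0 τ, ∃ (η : ℝ → K) (p : K),
      (∀ s ∈ Icc 0 τ', ∀ u : K,
        (∀ v : K, ⟪M s (u : H), (v : H)⟫_ℝ = ⟪F s, (v : H)⟫_ℝ) ↔ u = η s) ∧
      (∀ q : K, (∀ v : K, 2 * ⟪N 0 ((η 0 : H) - D 0), (v : H)⟫_ℝ + ⟪M 0 (q : H), (v : H)⟫_ℝ = 0)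
        ↔ q = p) ∧
      AffineInY G τ' ∧ H0 G τ' ∧ H1 G τ' η p ∧
      (∀ s ∈ Icc 0 τ', ∃ y : K, averagedAdjointStates G s (η 0) (η s) = {y}) ∧
      HasDs G (η 0) p (⟪N' ((η 0 : H) - D 0), (η 0 : H) - D 0⟫_ℝ
        - 2 * ⟪N 0 ((η 0 : H) - D 0), D'⟫_ℝ + ⟪M' (η 0 : H), (p : H)⟫_ℝ - ⟪F', (p : H)⟫_ℝ) ∧
      HasRemainderLimit G η p 0 ∧
      ∀ s ∈ Icc 0 τ', minimax G s = (⟪N s ((η s : H) - D s), (η s : H) - D s⟫_ℝ : ℝ) := by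
  set A : ℝ → K →L[ℝ] K := fun s => formOp K (M s) with hAdef
  set P : H →L[ℝ] K := ContinuousLinearMap.adjoint K.subtypeL with hP
  have hA' : HasDerivWithinAt A (formOp K M') (Ici 0) 0 := hasDerivWithinAt_formOp hM'
  -- The invertible operators form an open set, and `A` is continuous at `0`.
  have hopen : ∀ᶠ B in 𝓝 (A 0), IsUnit B := by
    have h := (Units.isOpen (R := K →L[ℝ] K)).eventually_mem (x := A 0) (by simpa using hA)
    simpa using h
  have hunit : ∀ᶠ s in 𝓝[Ici 0] (0 : ℝ), IsUnit (A s) := hA'.continuousWithinAt.eventually hopen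
  obtain ⟨τ₂, hτ₂, hτ₂'⟩ := mem_nhdsGE_iff_exists_Icc_subset.mp hunit
  have hτ₂0 : (0 : ℝ) < τ₂ := hτ₂
  set τ' := min τ τ₂ with hτ'
  have hτ'0 : 0 < τ' := lt_min hτ hτ₂0
  have hsub : ∀ s ∈ Icc 0 τ', s ∈ Icc 0 τ := fun s hs => ⟨hs.1, hs.2.trans (min_le_left _ _)⟩
  have hu : ∀ s ∈ Icc 0 τ', IsUnit (formOp K (M s)) := fun s hs =>
    hτ₂' ⟨hs.1, hs.2.trans (min_le_right _ _)⟩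
  have h00 : (0 : ℝ) ∈ Icc 0 τ' := ⟨le_rfl, hτ'0.le⟩
  set η : ℝ → K := fun s => Ring.inverse (A s) (P (F s)) with hη
  -- The adjoint equation moved to the form `⟪M p, v⟫ = ⟪-2 N(η⁰ - D), v⟫`; `M` being symmetric, the
  -- adjoint problem has the same operator as the state problem.
  set p : K := Ring.inverse (A 0) (P ((-2 : ℝ) • N 0 ((η 0 : H) - D 0))) with hp
  have hstate : ∀ s ∈ Icc 0 τ', ∀ u : K,
      (∀ v : K, ⟪M s (u : H), (v : H)⟫_ℝ = ⟪F s, (v : H)⟫_ℝ) ↔ u = η s := fun s hs u =>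
    formOp_solve (hu s hs) (F s) u
  have hadj : ∀ q : K, (∀ v : K, 2 * ⟪N 0 ((η 0 : H) - D 0), (v : H)⟫_ℝ
      + ⟪M 0 (q : H), (v : H)⟫_ℝ = 0) ↔ q = p := fun q => by
    rw [hp, ← formOp_solve (hu 0 h00)]
    refine forall_congr' fun v => ?_
    rw [real_inner_smul_left]
    constructor <;> intro h <;> linarith
  have hmm := fun s (hs : s ∈ Icc 0 τ') => minimax_quadLagrangian (hG s (hsub s hs)) (hstate s hs)
  obtain ⟨η', hη'⟩ := exists_hasDerivWithinAt_solve (K := K) hM' hF' hA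
  have hint := fun s (hs : s ∈ Icc 0 τ') => quadLagrangian_integral_dx hG hN (hsub s hs)
  refine ⟨τ', ⟨hτ'0, min_le_left _ _⟩, η, p, hstate, hadj, ?_, ⟨?_, ?_, ?_⟩, ⟨?_, ?_, ?_⟩,
    ?_, ?_, ?_, fun s hs => (hmm s hs).1⟩
  · intro s hs x
    refine ⟨((innerSL ℝ (M s (x : H)) - innerSL ℝ (F s)) ∘L K.subtypeL).toLinearMap.toAffineMap
      + AffineMap.const ℝ K ⟪N s ((x : H) - D s), (x : H) - D s⟫_ℝ, fun y => ?_⟩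
    rw [hG s (hsub s hs), quadLagrangian]
    simp
    ring
  · intro s hs x₀ _ xs _ y
    have e : (fun θ : ℝ => G s (x₀ + θ • (xs - x₀)) y) = fun t : ℝ =>
        quadLagrangian (N s) (M s) (D s) (F s) x₀ y
        + t * (2 * ⟪N s ((x₀ : H) - D s), ((xs - x₀ : K) : H)⟫_ℝ
            + ⟪M s ((xs - x₀ : K) : H), (y : H)⟫_ℝ)
        + t ^ 2 * ⟪N s ((xs - x₀ : K) : H), ((xs - x₀ : K) : H)⟫_ℝ := by
      funext t
      rw [hG s (hsub s hs), quadLagrangian_add_smul (hN s (hsub s hs))]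
    rw [e]
    apply ContDiffOn.absolutelyContinuousOnInterval
    fun_prop
  · intro s hs x₀ _ xs _ y φ
    exact ae_of_all _ fun θ => ⟨_, quadLagrangian_hasDx hG hN (hsub s hs) _ y φ⟩
  · intro s hs x₀ _ xs _ y φ
    have e : (fun θ : ℝ => dx G s (x₀ + θ • (xs - x₀)) y φ) = fun θ : ℝ =>
        2 * ⟪N s (((x₀ + θ • (xs - x₀) : K) : H) - D s), (φ : H)⟫_ℝ
          + ⟪M s (φ : H), (y : H)⟫_ℝ := by
      funext θ
      exact (quadLagrangian_hasDx hG hN (hsub s hs) _ y φ).dx_eq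
    rw [e]
    refine ContinuousOn.integrableOn_compact isCompact_Icc (Continuous.continuousOn ?_)
    push_cast
    fun_prop
  · intro s hs
    rw [(hmm s hs).1]
    exact ⟨EReal.coe_ne_top _, EReal.coe_ne_bot _⟩
  · exact fun s hs => (hmm s hs).2
  · ext q
    rw [mem_singleton_iff, ← hadj]
    refine forall_congr' fun v => ?_
    have h := quadLagrangian_hasDx hG hN (hsub 0 h00) (η 0) q v
    -- The derivative produces `⟪M v, q⟫` while the adjoint equation contains `⟪M q, v⟫`.
    rw [hM 0 (hsub 0 h00), real_inner_comm (M 0 (q : H)) (v : H)] at h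
    constructor
    · intro h'
      rw [← h.dx_eq, h'.dx_eq]
    · intro h'
      rwa [h'] at h
  · intro s hs
    -- The averaged adjoint equation is the adjoint equation at `s` with the state replaced by the
    -- midpoint of `η⁰` and `ηˢ`.
    refine ⟨Ring.inverse (A s) (P ((-2 : ℝ) • N s ((2⁻¹ : ℝ) • ((η 0 : H) + η s) - D s))), ?_⟩
    ext y
    rw [mem_singleton_iff, ← formOp_solve (hu s hs)]
    refine forall_congr' fun v => ?_
    rw [hint s hs, real_inner_smul_left, hM s (hsub s hs), real_inner_comm (M s (y : H)) (v : H)]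
    constructor <;> intro h <;> linarith
  · have h5 := hasDerivWithinAt_quadLagrangian hN' hM' hD' hF' (hN 0 (hsub 0 h00)) (η 0) p
    unfold HasDs
    refine h5.congr_of_eventuallyEq ?_ ?_
    · filter_upwards [Icc_mem_nhdsGE hτ'0] with s hs
      exact hG s (hsub s hs) _ _
    · exact hG 0 (hsub 0 h00) _ _
  · unfold HasRemainderLimit
    change HasDerivWithinAt η η' (Ici 0) 0 at hη'
    have hlim := tendsto_averaged_dx_slope hN' hM' hD' hη' p
    -- In the limit the midpoint is `η⁰`, and the expression is the adjoint equation tested with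
    -- `η'`.
    have hzero : 2 * ⟪N 0 ((2⁻¹ : ℝ) • ((η 0 : H) + η 0) - D 0), (η' : H)⟫_ℝ
          + ⟪M 0 (η' : H), (p : H)⟫_ℝ = 0 := by
      have := (hadj p).mpr rfl η'
      rw [hM 0 (hsub 0 h00), real_inner_comm (M 0 (p : H)) (η' : H)]
      rw [← two_smul ℝ, smul_smul]
      rwa [show (2⁻¹ * 2 : ℝ) = 1 by norm_num, one_smul]
    rw [hzero] at hlim
    refine hlim.congr' ?_
    filter_upwards [Ioc_mem_nhdsGT hτ'0] with s hs
    have hs' : s ∈ Icc 0 τ' := ⟨hs.1.le, hs.2⟩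
    rw [remainder, hint s hs']
    simp [slope]

end QuadraticLagrangian

/-! ### The flow of a velocity field for short times -/

section Flow

variable {N : ℕ} {τ M : ℝ} {V T : ℝ → Eucl N → Eucl N}

/-- A velocity field which is bounded together with its derivative on a short time interval, and
its flow there. -/
structure ShortFlow (τ M : ℝ) (V T : ℝ → Eucl N → Eucl N) : Prop where
  pos : 0 < τ
  one_le : 1 ≤ M
  small : 8 * M * τ ≤ 1
  contDiff : ∀ s ∈ Icc 0 τ, ContDiff ℝ 1 (V s)
  bound : ∀ s ∈ Icc 0 τ, ∀ x, ‖V s x‖ ≤ M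
  bound_deriv : ∀ s ∈ Icc 0 τ, ∀ x, ‖fderiv ℝ (V s) x‖ ≤ M
  cont_deriv : ContinuousOn (fun q : ℝ × Eucl N => fderiv ℝ (V q.1) q.2) (Icc 0 τ ×ˢ univ)
  near_zero : ∀ ε > 0, ∃ δ > 0, ∀ s ∈ Icc 0 τ, s ≤ δ → ∀ x, ‖V s x - V 0 x‖ ≤ ε
  near_zero_deriv : ∀ ε > 0, ∃ δ > 0, ∀ s ∈ Icc 0 τ, s ≤ δ →
    ∀ x, ‖fderiv ℝ (V s) x - fderiv ℝ (V 0) x‖ ≤ ε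
  unifCont_deriv : UniformContinuous (fderiv ℝ (V 0))
  initial : ∀ x, T 0 x = x
  hasDeriv : ∀ s ∈ Icc 0 τ, ∀ x, HasDerivWithinAt (fun r => T r x) (V s (T s x)) (Icc 0 τ) s

lemma MemC10.exists_bound {W : Eucl N → Eucl N} (h : MemC10 W) :
    ∃ C, ∀ x, ‖W x‖ ≤ C ∧ ‖fderiv ℝ W x‖ ≤ C := by
  obtain ⟨h1, h2, h3⟩ := h
  let w : ZeroAtInftyContinuousMap (Eucl N) (Eucl N) := ⟨⟨W, h1.continuous⟩, h2⟩
  let w' : ZeroAtInftyContinuousMap (Eucl N) (Eucl N →L[ℝ] Eucl N) :=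
    ⟨⟨fderiv ℝ W, h1.continuous_fderiv one_ne_zero⟩, h3⟩
  obtain ⟨C1, hC1⟩ := w.isBounded_range.exists_norm_le
  obtain ⟨C2, hC2⟩ := w'.isBounded_range.exists_norm_le
  exact ⟨max C1 C2, fun x => ⟨(hC1 _ ⟨x, rfl⟩).trans (le_max_left _ _),
    (hC2 _ ⟨x, rfl⟩).trans (le_max_right _ _)⟩⟩

lemma MemC10.uniformContinuous_fderiv {W : Eucl N → Eucl N} (h : MemC10 W) :
    UniformContinuous (fderiv ℝ W) := by
  let w' : ZeroAtInftyContinuousMap (Eucl N) (Eucl N →L[ℝ] Eucl N) :=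
    ⟨⟨fderiv ℝ W, h.1.continuous_fderiv one_ne_zero⟩, h.2.2⟩
  exact ZeroAtInftyContinuousMap.uniformContinuous w'

lemma exists_forall_of_eventually_Icc {τ : ℝ} (hτ : 0 < τ) {P : ℝ → Prop}
    (h : ∀ᶠ s in 𝓝[Icc 0 τ] (0 : ℝ), P s) : ∃ δ > 0, ∀ s ∈ Icc 0 τ, s ≤ δ → P s := by
  rw [nhdsWithin_Icc_eq_nhdsGE hτ] at h
  obtain ⟨δ, hδ, hsub⟩ := mem_nhdsGE_iff_exists_Icc_subset.mp h
  exact ⟨δ, hδ, fun s hs hsδ => hsub ⟨hs.1, hsδ⟩⟩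

lemma exists_shortFlow (hτ : 0 < τ) (hV : IsVelocity τ V) (hT : IsFlow τ V T) :
    ∃ τ₁ ∈ Ioc 0 τ, ∃ M, ShortFlow τ₁ M V T := by
  have h00 : (0 : ℝ) ∈ Icc 0 τ := ⟨le_rfl, hτ.le⟩
  obtain ⟨C, hC⟩ := (hV.mem 0 h00).exists_bound
  have near : ∀ ε > 0, ∃ δ > 0, ∀ s ∈ Icc 0 τ, s ≤ δ → ∀ x, ‖V s x - V 0 x‖ ≤ ε := by
    intro ε hε
    refine exists_forall_of_eventually_Icc hτ ?_
    filter_upwards [Metric.tendstoUniformly_iff.mp (hV.cont 0 h00) ε hε] with s hs x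
    rw [← dist_eq_norm, dist_comm]
    exact (hs x).le
  have near' : ∀ ε > 0, ∃ δ > 0, ∀ s ∈ Icc 0 τ, s ≤ δ →
      ∀ x, ‖fderiv ℝ (V s) x - fderiv ℝ (V 0) x‖ ≤ ε := by
    intro ε hε
    refine exists_forall_of_eventually_Icc hτ ?_
    filter_upwards [Metric.tendstoUniformly_iff.mp (hV.cont_deriv 0 h00) ε hε] with s hs x
    rw [← dist_eq_norm, dist_comm]
    exact (hs x).le
  obtain ⟨δ₁, hδ₁, h1⟩ := near 1 one_pos
  obtain ⟨δ₂, hδ₂, h2⟩ := near' 1 one_pos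
  -- `C` bounds `V(0)` and `DV(0)`; the extra `1` absorbs their variation over `[0, τ₁]` and makes
  -- `M ≥ 1`.
  set M := max C 0 + 1 with hM
  have hM1 : 1 ≤ M := by have := le_max_right C 0; linarith
  have hCM : C + 1 ≤ M := by have := le_max_left C 0; linarith
  -- The bound `1/(8M)` gives `exp(Ms) ≤ 2` and `2Ms ≤ 1/4`, which keeps `T_s` close to the
  -- identity.
  set τ₁ := min (min τ (8 * M)⁻¹) (min δ₁ δ₂) with hτ₁
  have hpos : 0 < τ₁ := by positivity
  have hle : τ₁ ≤ τ := (min_le_left _ _).trans (min_le_left _ _)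
  have hsub : Icc 0 τ₁ ⊆ Icc 0 τ := Icc_subset_Icc_right hle
  refine ⟨τ₁, ⟨hpos, hle⟩, M, hpos, hM1, ?_, fun s hs => (hV.mem s (hsub hs)).1, ?_, ?_, ?_, ?_,
    ?_, (hV.mem 0 h00).uniformContinuous_fderiv, fun x => (hT x).1,
    fun s hs x => ((hT x).2 s (hsub hs)).mono hsub⟩
  · have : τ₁ ≤ (8 * M)⁻¹ := (min_le_left _ _).trans (min_le_right _ _)
    calc 8 * M * τ₁ ≤ 8 * M * (8 * M)⁻¹ := by gcongr
      _ = 1 := mul_inv_cancel₀ (by positivity)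
  · intro s hs x
    have := h1 s (hsub hs) (hs.2.trans ((min_le_right _ _).trans (min_le_left _ _))) x
    calc ‖V s x‖ = ‖(V s x - V 0 x) + V 0 x‖ := by rw [sub_add_cancel]
      _ ≤ ‖V s x - V 0 x‖ + ‖V 0 x‖ := norm_add_le _ _
      _ ≤ M := by linarith [(hC x).1]
  · intro s hs x
    have := h2 s (hsub hs) (hs.2.trans ((min_le_right _ _).trans (min_le_right _ _))) x
    calc ‖fderiv ℝ (V s) x‖ = ‖(fderiv ℝ (V s) x - fderiv ℝ (V 0) x) + fderiv ℝ (V 0) x‖ := by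
          rw [sub_add_cancel]
      _ ≤ ‖fderiv ℝ (V s) x - fderiv ℝ (V 0) x‖ + ‖fderiv ℝ (V 0) x‖ := norm_add_le _ _
      _ ≤ M := by linarith [(hC x).2]
  · rintro ⟨s, x⟩ ⟨hs, -⟩
    have hu := hV.cont_deriv s (hsub hs)
    have hl : Tendsto (fun q : ℝ × Eucl N => q.1) (𝓝[Icc 0 τ₁ ×ˢ univ] (s, x)) (𝓝[Icc 0 τ] s) :=
      tendsto_nhdsWithin_iff.mpr ⟨(continuous_fst.tendsto (s, x)).mono_left nhdsWithin_le_nhds,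
        eventually_nhdsWithin_of_forall fun q hq => hsub hq.1⟩
    have hu' : TendstoUniformly (fun q : ℝ × Eucl N => fderiv ℝ (V q.1)) (fderiv ℝ (V s))
        (𝓝[Icc 0 τ₁ ×ˢ univ] (s, x)) := fun U hU => hl.eventually (hu U hU)
    exact hu'.tendsto_comp
      (((hV.mem s (hsub hs)).1.continuous_fderiv one_ne_zero).continuousAt (x := x))
      ((continuous_snd.tendsto (s, x)).mono_left nhdsWithin_le_nhds)
  · intro ε hε
    obtain ⟨δ, hδ, h⟩ := near ε hε
    exact ⟨δ, hδ, fun s hs => h s (hsub hs)⟩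
  · intro ε hε
    obtain ⟨δ, hδ, h⟩ := near' ε hε
    exact ⟨δ, hδ, fun s hs => h s (hsub hs)⟩

namespace ShortFlow

variable (hF : ShortFlow τ M V T)
include hF

lemma zero_mem : (0 : ℝ) ∈ Icc 0 τ := ⟨le_rfl, hF.pos.le⟩

lemma M_pos : 0 < M := one_pos.trans_le hF.one_le

lemma exp_le {s : ℝ} (hs : s ∈ Icc 0 τ) : Real.exp (M * s) ≤ 2 := by
  have h1 : M * s ≤ 1 / 8 := by
    have := mul_le_mul_of_nonneg_left hs.2 hF.M_pos.le
    linarith [hF.small]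
  have h2 : (1 : ℝ) / 8 ≤ Real.log 2 := by linarith [Real.log_two_gt_d9]
  calc Real.exp (M * s) ≤ Real.exp (Real.log 2) := Real.exp_le_exp.mpr (h1.trans h2)
    _ = 2 := Real.exp_log two_pos

lemma lipschitz {s : ℝ} (hs : s ∈ Icc 0 τ) (x y : Eucl N) : ‖V s x - V s y‖ ≤ M * ‖x - y‖ :=
  Convex.norm_image_sub_le_of_norm_fderiv_le (𝕜 := ℝ)
    (fun z _ => (hF.contDiff s hs).differentiable one_ne_zero z)
    (fun z _ => hF.bound_deriv s hs z) convex_univ (mem_univ y) (mem_univ x)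

lemma hasDeriv_right {s : ℝ} (hs : s ∈ Ico 0 τ) (x : Eucl N) :
    HasDerivWithinAt (fun r => T r x) (V s (T s x)) (Ici s) s :=
  (hF.hasDeriv s ⟨hs.1, hs.2.le⟩ x).mono_of_mem_nhdsWithin (Icc_mem_nhdsGE_of_mem hs)

lemma continuousOn (x : Eucl N) : ContinuousOn (fun r => T r x) (Icc 0 τ) :=
  fun s hs => (hF.hasDeriv s hs x).continuousWithinAt

/-- Gronwall's inequality, with the exponential bounded by `2` on the short interval. -/
lemma norm_flow_sub_le {s : ℝ} (hs : s ∈ Icc 0 τ) (x y : Eucl N) :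
    ‖T s x - T s y‖ ≤ 2 * ‖x - y‖ := by
  have h := norm_le_gronwallBound_of_norm_deriv_right_le (f := fun r => T r x - T r y)
    (f' := fun r => V r (T r x) - V r (T r y)) (δ := ‖x - y‖) (K := M) (ε := 0) (a := 0) (b := τ)
    ((hF.continuousOn x).sub (hF.continuousOn y))
    (fun r hr => (hF.hasDeriv_right hr x).sub (hF.hasDeriv_right hr y))
    (by simp [hF.initial]) (fun r hr => by
      simpa using hF.lipschitz ⟨hr.1, hr.2.le⟩ (T r x) (T r y)) s hs
  rw [gronwallBound_ε0, sub_zero] at h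
  calc ‖T s x - T s y‖ ≤ ‖x - y‖ * Real.exp (M * s) := h
    _ ≤ ‖x - y‖ * 2 := by gcongr; exact hF.exp_le hs
    _ = 2 * ‖x - y‖ := mul_comm _ _

lemma norm_flow_sub_self_le {s : ℝ} (hs : s ∈ Icc 0 τ) (x : Eucl N) : ‖T s x - x‖ ≤ M * s := by
  have := norm_image_sub_le_of_norm_deriv_le_segment' (f := fun r => T r x)
    (fun r hr => hF.hasDeriv r hr x) (fun r hr => hF.bound r ⟨hr.1, hr.2.le⟩ _) s hs
  simpa [hF.initial] using this

/-- In time, the displacement has derivative `V(r, T_r x)`, whose differences in `x` are at most `M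
· 2‖x - y‖`. The resulting contraction property of `T_s - id` yields invertibility of `T_s` and the
bound on `DT_s - I`. -/
lemma norm_displacement_sub_le {s : ℝ} (hs : s ∈ Icc 0 τ) (x y : Eucl N) :
    ‖(T s x - x) - (T s y - y)‖ ≤ 2 * M * s * ‖x - y‖ := by
  have := norm_image_sub_le_of_norm_deriv_le_segment' (f := fun r => (T r x - x) - (T r y - y))
    (C := M * (2 * ‖x - y‖))
    (fun r hr => ((hF.hasDeriv r hr x).sub_const x).sub ((hF.hasDeriv r hr y).sub_const y))
    (fun r hr => (hF.lipschitz ⟨hr.1, hr.2.le⟩ _ _).trans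
      (mul_le_mul_of_nonneg_left (hF.norm_flow_sub_le ⟨hr.1, hr.2.le⟩ x y) hF.M_pos.le)) s hs
  simp only [hF.initial, sub_self, sub_zero] at this
  linarith

/-- The linearised equation along a trajectory has a solution. -/
lemma exists_linearized (x : Eucl N) : ∃ A : ℝ → Eucl N →L[ℝ] Eucl N,
    A 0 = ContinuousLinearMap.id ℝ (Eucl N) ∧ ∀ s ∈ Icc 0 τ,
      HasDerivWithinAt A (fderiv ℝ (V s) (T s x) ∘L A s) (Icc 0 τ) s := by
  have hMnn : 0 ≤ M := hF.M_pos.le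
  have hid : ‖ContinuousLinearMap.id ℝ (Eucl N)‖ ≤ 1 := ContinuousLinearMap.norm_id_le
  -- In the unit ball about the identity the linear field has norm at most `2M`, and `2Mτ ≤ 1`, so a
  -- solution started at the identity stays in the ball on all of `[0, τ]`.
  have hPL : IsPicardLindelof
      (fun (s : ℝ) (A : Eucl N →L[ℝ] Eucl N) => fderiv ℝ (V s) (T s x) ∘L A)
      (tmin := 0) (tmax := τ) ⟨0, hF.zero_mem⟩ (ContinuousLinearMap.id ℝ (Eucl N)) 1 0
      (2 * M.toNNReal) M.toNNReal := by
    refine ⟨fun s hs => ?_, fun A _ => ?_, fun s hs A hA => ?_, ?_⟩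
    · refine (LipschitzWith.of_dist_le_mul fun A B => ?_).lipschitzOnWith
      rw [dist_eq_norm, dist_eq_norm, ← ContinuousLinearMap.comp_sub]
      rw [Real.coe_toNNReal _ hMnn]
      exact (ContinuousLinearMap.opNorm_comp_le _ _).trans
        (mul_le_mul_of_nonneg_right (hF.bound_deriv s hs _) (norm_nonneg _))
    · have h1 : ContinuousOn (fun s => fderiv ℝ (V s) (T s x)) (Icc 0 τ) :=
        hF.cont_deriv.comp (continuousOn_id.prodMk (hF.continuousOn x)) fun s hs => ⟨hs, mem_univ _⟩
      exact h1.clm_comp continuousOn_const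
    · have hA2 : ‖A‖ ≤ 2 := by
        have : ‖A - ContinuousLinearMap.id ℝ (Eucl N)‖ ≤ 1 := by
          simpa [dist_eq_norm] using hA
        calc ‖A‖ = ‖(A - ContinuousLinearMap.id ℝ (Eucl N)) + ContinuousLinearMap.id ℝ (Eucl N)‖ :=
              by rw [sub_add_cancel]
          _ ≤ 1 + 1 := (norm_add_le _ _).trans (add_le_add this hid)
          _ = 2 := by norm_num
      calc ‖fderiv ℝ (V s) (T s x) ∘L A‖ ≤ ‖fderiv ℝ (V s) (T s x)‖ * ‖A‖ :=
            ContinuousLinearMap.opNorm_comp_le _ _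
        _ ≤ M * 2 := mul_le_mul (hF.bound_deriv s hs _) hA2 (norm_nonneg _) hMnn
        _ = ((2 * M.toNNReal : NNReal) : ℝ) := by simp [hMnn, mul_comm]
    · simp only [NNReal.coe_mul, NNReal.coe_ofNat, Real.coe_toNNReal _ hMnn, sub_zero, sub_self,
        NNReal.coe_one, NNReal.coe_zero]
      rw [max_eq_left hF.pos.le]
      nlinarith [hF.small, hF.pos, hF.M_pos, mul_pos hF.M_pos hF.pos]
  exact hPL.exists_eq_forall_mem_Icc_hasDerivWithinAt₀

/-- The trajectory and its unit neighbourhood lie in a fixed compact ball, on which the jointly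
continuous `DV` is uniformly continuous; this makes `δ` independent of `s`. -/
lemma exists_unif_nhds_trajectory (x : Eucl N) {ε : ℝ} (hε : 0 < ε) : ∃ δ > 0, ∀ s ∈ Icc 0 τ,
    ∀ y ∈ Metric.ball (T s x) δ, ‖fderiv ℝ (V s) y - fderiv ℝ (V s) (T s x)‖ ≤ ε := by
  set R := ‖x‖ + M * τ + 1
  have hK : IsCompact (Icc (0 : ℝ) τ ×ˢ Metric.closedBall (0 : Eucl N) R) :=
    isCompact_Icc.prod (isCompact_closedBall _ _)
  have hu := hK.uniformContinuousOn_of_continuous (hF.cont_deriv.mono (prod_mono_right (subset_univ _)))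
  rw [Metric.uniformContinuousOn_iff] at hu
  obtain ⟨δ, hδ, h⟩ := hu ε hε
  refine ⟨min δ 1, by positivity, fun s hs y hy => ?_⟩
  have hT : ‖T s x‖ ≤ ‖x‖ + M * τ := by
    calc ‖T s x‖ = ‖(T s x - x) + x‖ := by rw [sub_add_cancel]
      _ ≤ M * s + ‖x‖ := (norm_add_le _ _).trans (add_le_add_left (hF.norm_flow_sub_self_le hs x) _)
      _ ≤ ‖x‖ + M * τ := by
        have := mul_le_mul_of_nonneg_left hs.2 hF.M_pos.le
        linarith
  have hy' : ‖y - T s x‖ < min δ 1 := by rwa [← dist_eq_norm]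
  have hyR : ‖y‖ ≤ R := by
    calc ‖y‖ = ‖(y - T s x) + T s x‖ := by rw [sub_add_cancel]
      _ ≤ ‖y - T s x‖ + ‖T s x‖ := norm_add_le _ _
      _ ≤ R := by have := min_le_right δ 1; simp only [R]; linarith
  have hTR : ‖T s x‖ ≤ R := by simp only [R]; linarith
  have := h (s, y) ⟨hs, by simpa using hyR⟩ (s, T s x) ⟨hs, by simpa using hTR⟩ (by
    rw [Prod.dist_eq, dist_self, max_eq_right dist_nonneg, dist_eq_norm]
    exact hy'.trans_le (min_le_left _ _))
  rw [dist_eq_norm] at this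
  exact this.le

/-- The error `T_r y - T_r z - A_r(y - z)` starts at zero and solves the linearised equation up to a
forcing of size `c‖y - z‖`, so Gronwall's inequality bounds it by `c‖y - z‖`. Treating pairs `(y,
z)` near `(x, x)` gives the strict derivative, from which continuity of `DT_s` will follow. -/
lemma hasStrictFDerivAt {A : ℝ → Eucl N →L[ℝ] Eucl N} {x : Eucl N}
    (hA0 : A 0 = ContinuousLinearMap.id ℝ (Eucl N))
    (hA : ∀ s ∈ Icc 0 τ, HasDerivWithinAt A (fderiv ℝ (V s) (T s x) ∘L A s) (Icc 0 τ) s)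
    {s : ℝ} (hs : s ∈ Icc 0 τ) : HasStrictFDerivAt (T s) (A s) x := by
  rw [hasStrictFDerivAt_iff_isLittleO, Asymptotics.isLittleO_iff]
  intro c hc
  obtain ⟨δ, hδ, hball⟩ := hF.exists_unif_nhds_trajectory x (ε := c / 2) (by positivity)
  have hnhds : Metric.ball x (δ / 2) ×ˢ Metric.ball x (δ / 2) ∈ 𝓝 (x, x) :=
    prod_mem_nhds (Metric.ball_mem_nhds _ (by positivity)) (Metric.ball_mem_nhds _ (by positivity))
  filter_upwards [hnhds] with q hq
  obtain ⟨y, z⟩ := q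
  simp only [mem_prod, Metric.mem_ball, dist_eq_norm] at hq
  have hmem : ∀ r ∈ Icc 0 τ, ∀ w, ‖w - x‖ < δ / 2 → T r w ∈ Metric.ball (T r x) δ :=
    fun r hr w hw => by
      rw [Metric.mem_ball, dist_eq_norm]
      have := hF.norm_flow_sub_le hr w x
      linarith
  have hrem : ∀ r ∈ Icc 0 τ, ‖V r (T r y) - V r (T r z)
      - fderiv ℝ (V r) (T r x) (T r y - T r z)‖ ≤ c * ‖y - z‖ := fun r hr => by
    have h1 := Convex.norm_image_sub_le_of_norm_fderiv_le' (𝕜 := ℝ) (f := V r)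
      (φ := fderiv ℝ (V r) (T r x)) (s := Metric.ball (T r x) δ) (C := c / 2)
      (fun w _ => (hF.contDiff r hr).differentiable one_ne_zero w)
      (fun w hw => hball r hr w hw) (convex_ball _ _) (hmem r hr z hq.2) (hmem r hr y hq.1)
    calc _ ≤ c / 2 * ‖T r y - T r z‖ := h1
      _ ≤ c / 2 * (2 * ‖y - z‖) := by gcongr; exact hF.norm_flow_sub_le hr y z
      _ = c * ‖y - z‖ := by ring
  have hAd : ∀ r ∈ Icc 0 τ, HasDerivWithinAt (fun r => A r (y - z))
      (fderiv ℝ (V r) (T r x) (A r (y - z))) (Icc 0 τ) r := fun r hr => by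
    simpa using (hA r hr).clm_apply (hasDerivWithinAt_const r (Icc 0 τ) (y - z))
  have hd : ∀ r ∈ Icc 0 τ, HasDerivWithinAt (fun r => T r y - T r z - A r (y - z))
      (V r (T r y) - V r (T r z) - fderiv ℝ (V r) (T r x) (A r (y - z))) (Icc 0 τ) r :=
    fun r hr => ((hF.hasDeriv r hr y).sub (hF.hasDeriv r hr z)).sub (hAd r hr)
  have hg := norm_le_gronwallBound_of_norm_deriv_right_le
    (f := fun r => T r y - T r z - A r (y - z))
    (f' := fun r => V r (T r y) - V r (T r z) - fderiv ℝ (V r) (T r x) (A r (y - z)))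
    (δ := 0) (K := M) (ε := c * ‖y - z‖) (a := 0) (b := τ)
    (fun r hr => (hd r hr).continuousWithinAt)
    (fun r hr => (hd r ⟨hr.1, hr.2.le⟩).mono_of_mem_nhdsWithin (Icc_mem_nhdsGE_of_mem hr))
    (by simp [hF.initial, hA0])
    (fun r hr => by
      have hr' : r ∈ Icc 0 τ := ⟨hr.1, hr.2.le⟩
      have e : V r (T r y) - V r (T r z) - fderiv ℝ (V r) (T r x) (A r (y - z))
          = fderiv ℝ (V r) (T r x) (T r y - T r z - A r (y - z))
            + (V r (T r y) - V r (T r z) - fderiv ℝ (V r) (T r x) (T r y - T r z)) := by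
        simp only [map_sub]; abel
      rw [e]
      refine (norm_add_le _ _).trans (add_le_add ?_ (hrem r hr'))
      exact (ContinuousLinearMap.le_opNorm _ _).trans
        (mul_le_mul_of_nonneg_right (hF.bound_deriv r hr' _) (norm_nonneg _))) s hs
  refine hg.trans ?_
  simp only [gronwallBound_of_K_ne_0 hF.M_pos.ne', sub_zero, zero_mul, zero_add]
  have h1 : Real.exp (M * s) - 1 ≤ 1 := by linarith [hF.exp_le hs]
  have h2 : 0 ≤ c * ‖y - z‖ := by positivity
  calc c * ‖y - z‖ / M * (Real.exp (M * s) - 1) ≤ c * ‖y - z‖ / M * 1 := by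
        have := hF.M_pos
        gcongr
    _ ≤ c * ‖y - z‖ := by rw [mul_one]; exact div_le_self h2 hF.one_le

/-- A map strictly differentiable everywhere is `C¹`: for `y` near `x`, the strict estimate at `x`
holds for all pairs near `(y, y)` and so bounds `DT_s(y) - DT_s(x)`. -/
lemma contDiff_flow {s : ℝ} (hs : s ∈ Icc 0 τ) : ContDiff ℝ 1 (T s) := by
  have hst : ∀ x, HasStrictFDerivAt (T s) (fderiv ℝ (T s) x) x := fun x => by
    obtain ⟨A, hA0, hA⟩ := hF.exists_linearized x
    have := hF.hasStrictFDerivAt hA0 hA hs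
    rwa [this.hasFDerivAt.fderiv]
  have hdiff : Differentiable ℝ (T s) := fun x => (hst x).hasFDerivAt.differentiableAt
  refine contDiff_one_iff_fderiv.mpr ⟨hdiff, continuous_iff_continuousAt.mpr fun x => ?_⟩
  rw [Metric.continuousAt_iff']
  intro ε hε
  have h := (hasStrictFDerivAt_iff_isLittleO.mp (hst x))
  rw [Asymptotics.isLittleO_iff] at h
  have h' := (h (half_pos hε)).eventually_nhds
  have h'' : ∀ᶠ y in 𝓝 x, ∀ᶠ q in 𝓝 (y, y), ‖T s q.1 - T s q.2
      - fderiv ℝ (T s) x (q.1 - q.2)‖ ≤ ε / 2 * ‖q.1 - q.2‖ :=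
    (Continuous.tendsto (by fun_prop : Continuous fun y : Eucl N => (y, y)) x).eventually h'
  filter_upwards [h''] with y hy
  have hy' : ∀ᶠ w in 𝓝 y, ‖T s w - T s y - fderiv ℝ (T s) x (w - y)‖ ≤ ε / 2 * ‖w - y‖ :=
    (Continuous.tendsto (by fun_prop : Continuous fun w : Eucl N => (w, y)) y).eventually hy
  rw [dist_eq_norm]
  refine lt_of_le_of_lt ?_ (half_lt_self hε)
  refine HasFDerivAt.le_of_lip' ((hdiff y).hasFDerivAt.sub (fderiv ℝ (T s) x).hasFDerivAt)
    (half_pos hε).le ?_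
  filter_upwards [hy'] with w hw
  have e : (T s - fderiv ℝ (T s) x) w - (T s - fderiv ℝ (T s) x) y
      = T s w - T s y - fderiv ℝ (T s) x (w - y) := by
    simp only [Pi.sub_apply, map_sub]; abel
  rwa [e]

lemma norm_fderiv_sub_one_le {s : ℝ} (hs : s ∈ Icc 0 τ) (x : Eucl N) :
    ‖fderiv ℝ (T s) x - ContinuousLinearMap.id ℝ (Eucl N)‖ ≤ 2 * M * s := by
  have hnn : 0 ≤ 2 * M * s := by have := hF.M_pos; have := hs.1; positivity
  refine HasFDerivAt.le_of_lip' (((hF.contDiff_flow hs).differentiable one_ne_zero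
    x).hasFDerivAt.sub (ContinuousLinearMap.id ℝ (Eucl N)).hasFDerivAt) hnn ?_
  exact Eventually.of_forall fun y => hF.norm_displacement_sub_le hs y x

/-- Integrate the bound on `V(r, T_r x) - V(0, x)`: half of `ε` comes from the change of the field
in time, half from the displacement of the point. Uniformity in `x` is what matters later. -/
lemma flow_expansion {ε : ℝ} (hε : 0 < ε) : ∃ δ > 0, ∀ s ∈ Icc 0 τ, s ≤ δ → ∀ x,
    ‖T s x - x - s • V 0 x‖ ≤ ε * s := by
  obtain ⟨δ, hδ, h⟩ := hF.near_zero (ε / 2) (half_pos hε)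
  have hM := hF.M_pos
  set δ' := min δ (ε / 2 / (M * M)) with hδ'
  refine ⟨δ', by positivity, fun s hs hsδ x => ?_⟩
  have hsub : Icc 0 s ⊆ Icc 0 τ := Icc_subset_Icc_right hs.2
  have := norm_image_sub_le_of_norm_deriv_le_segment' (f := fun r => T r x - r • V 0 x)
    (f' := fun r => V r (T r x) - V 0 x) (a := 0) (b := s) (C := ε)
    (fun r hr => by
      have h1 := (hasDerivAt_id r).smul_const (V 0 x)
      exact (((hF.hasDeriv r (hsub hr) x).mono hsub).sub h1.hasDerivWithinAt).congr_deriv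
        (by simp))
    (fun r hr => by
      have hr' : r ∈ Icc 0 τ := hsub ⟨hr.1, hr.2.le⟩
      have hrδ : r ≤ δ' := hr.2.le.trans hsδ
      calc ‖V r (T r x) - V 0 x‖ = ‖(V r (T r x) - V 0 (T r x)) + (V 0 (T r x) - V 0 x)‖ := by
            rw [sub_add_sub_cancel]
        _ ≤ ‖V r (T r x) - V 0 (T r x)‖ + ‖V 0 (T r x) - V 0 x‖ := norm_add_le _ _
        _ ≤ ε / 2 + M * (M * r) := by
            refine add_le_add (h r hr' (hrδ.trans (min_le_left _ _)) _)
              ((hF.lipschitz hF.zero_mem _ _).trans ?_)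
            gcongr
            exact hF.norm_flow_sub_self_le hr' x
        _ ≤ ε / 2 + M * M * (ε / 2 / (M * M)) := by
            rw [← mul_assoc]; gcongr; exact hrδ.trans (min_le_right _ _)
        _ = ε := by rw [mul_div_cancel₀ _ (by positivity)]; ring) s ⟨hs.1, le_rfl⟩
  simp only [hF.initial, zero_smul, sub_zero] at this
  rwa [sub_right_comm]

/-- The equation for `DT_s` is avoided: the map `T_s - id - sV(0)` is shown to be Lipschitz with
constant `εs`, which bounds its derivative everywhere. -/
lemma fderiv_expansion {ε : ℝ} (hε : 0 < ε) : ∃ δ > 0, ∀ s ∈ Icc 0 τ, s ≤ δ → ∀ x,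
    ‖fderiv ℝ (T s) x - ContinuousLinearMap.id ℝ (Eucl N) - s • fderiv ℝ (V 0) x‖ ≤ ε * s := by
  have hM := hF.M_pos
  obtain ⟨δ₁, hδ₁, h1⟩ := hF.near_zero_deriv (ε / 3) (by positivity)
  obtain ⟨δ₂, hδ₂, h2⟩ := Metric.uniformContinuous_iff.mp hF.unifCont_deriv (ε / 3) (by positivity)
  set δ' := min δ₁ (min (δ₂ / (2 * M)) (ε / 3 / (2 * M * M))) with hδ'
  -- The three bounds in `δ'` serve the three thirds of `ε` below: `V(r)` against `V(0)`, uniform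
  -- continuity of `DV(0)` over a displacement of at most `Mr`, and `DT_r` against the identity.
  have hδ'0 : 0 < δ' := by positivity
  have key : ∀ r ∈ Icc 0 τ, r ≤ δ' → ∀ x y,
      ‖(V r (T r x) - V 0 x) - (V r (T r y) - V 0 y)‖ ≤ ε * ‖x - y‖ := by
    intro r hr hrδ x y
    have hdT := (hF.contDiff_flow hr).differentiable one_ne_zero
    have hdV := (hF.contDiff r hr).differentiable one_ne_zero
    have hdV0 := (hF.contDiff 0 hF.zero_mem).differentiable one_ne_zero
    refine Convex.norm_image_sub_le_of_norm_hasFDerivWithin_le (𝕜 := ℝ)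
      (f := fun x => V r (T r x) - V 0 x)
      (f' := fun x => fderiv ℝ (V r) (T r x) ∘L fderiv ℝ (T r) x - fderiv ℝ (V 0) x)
      (fun z _ => (((hdV (T r z)).hasFDerivAt.comp z (hdT z).hasFDerivAt).sub
        (hdV0 z).hasFDerivAt).hasFDerivWithinAt)
      (fun z _ => ?_) convex_univ (mem_univ y) (mem_univ x)
    have e : fderiv ℝ (V r) (T r z) ∘L fderiv ℝ (T r) z - fderiv ℝ (V 0) z
        = fderiv ℝ (V r) (T r z) ∘L (fderiv ℝ (T r) z - ContinuousLinearMap.id ℝ (Eucl N))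
          + (fderiv ℝ (V r) (T r z) - fderiv ℝ (V 0) (T r z))
          + (fderiv ℝ (V 0) (T r z) - fderiv ℝ (V 0) z) := by
      rw [ContinuousLinearMap.comp_sub, ContinuousLinearMap.comp_id]; abel
    have b1 : ‖fderiv ℝ (V r) (T r z) ∘L (fderiv ℝ (T r) z
        - ContinuousLinearMap.id ℝ (Eucl N))‖ ≤ ε / 3 := by
      calc _ ≤ ‖fderiv ℝ (V r) (T r z)‖ * ‖fderiv ℝ (T r) z
            - ContinuousLinearMap.id ℝ (Eucl N)‖ := ContinuousLinearMap.opNorm_comp_le _ _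
        _ ≤ M * (2 * M * r) := mul_le_mul (hF.bound_deriv r hr _)
            (hF.norm_fderiv_sub_one_le hr z) (norm_nonneg _) hM.le
        _ = 2 * M * M * r := by ring
        _ ≤ 2 * M * M * (ε / 3 / (2 * M * M)) := by
            gcongr; exact hrδ.trans ((min_le_right _ _).trans (min_le_right _ _))
        _ = ε / 3 := mul_div_cancel₀ _ (by positivity)
    have b2 := h1 r hr (hrδ.trans (min_le_left _ _)) (T r z)
    have b3 : ‖fderiv ℝ (V 0) (T r z) - fderiv ℝ (V 0) z‖ ≤ ε / 3 := by
      rw [← dist_eq_norm]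
      refine (h2 ?_).le
      rw [dist_eq_norm]
      calc ‖T r z - z‖ ≤ M * r := hF.norm_flow_sub_self_le hr z
        _ ≤ M * (δ₂ / (2 * M)) := by
            gcongr; exact hrδ.trans ((min_le_right _ _).trans (min_le_left _ _))
        _ = δ₂ / 2 := by field_simp
        _ < δ₂ := half_lt_self hδ₂
    rw [e]
    calc _ ≤ ε / 3 + ε / 3 + ε / 3 := (norm_add_le _ _).trans
          (add_le_add ((norm_add_le _ _).trans (add_le_add b1 b2)) b3)
      _ = ε := by ring
  refine ⟨δ', hδ'0, fun s hs hsδ x => ?_⟩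
  have hsub : Icc 0 s ⊆ Icc 0 τ := Icc_subset_Icc_right hs.2
  have hlip : ∀ x y, ‖(T s x - x - s • V 0 x) - (T s y - y - s • V 0 y)‖ ≤ ε * s * ‖x - y‖ := by
    intro x y
    have := norm_image_sub_le_of_norm_deriv_le_segment'
      (f := fun r => (T r x - r • V 0 x) - (T r y - r • V 0 y))
      (f' := fun r => (V r (T r x) - V 0 x) - (V r (T r y) - V 0 y)) (a := 0) (b := s)
      (C := ε * ‖x - y‖)
      (fun r hr => by
        have h1 := fun z => (hasDerivAt_id r).smul_const (V 0 z)
        have h2 := fun z => ((hF.hasDeriv r (hsub hr) z).mono hsub).sub (h1 z).hasDerivWithinAt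
        exact ((h2 x).sub (h2 y)).congr_deriv (by simp))
      (fun r hr => key r (hsub ⟨hr.1, hr.2.le⟩) (hr.2.le.trans hsδ) x y) s ⟨hs.1, le_rfl⟩
    simp only [hF.initial, zero_smul, sub_zero] at this
    calc _ = ‖T s x - s • V 0 x - (T s y - s • V 0 y) - (x - y)‖ := by congr 1; abel
      _ ≤ ε * ‖x - y‖ * s := this
      _ = _ := by ring
  refine HasFDerivAt.le_of_lip' ((((hF.contDiff_flow hs).differentiable one_ne_zero
    x).hasFDerivAt.sub (ContinuousLinearMap.id ℝ (Eucl N)).hasFDerivAt).sub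
    (((hF.contDiff 0 hF.zero_mem).differentiable one_ne_zero x).hasFDerivAt.const_smul s))
    (mul_nonneg hε.le hs.1) ?_
  exact Eventually.of_forall fun y => hlip y x

end ShortFlow

end Flow

/-! ### Curves in `Lp` and multiplication operators -/

section LpTools

set_option linter.unusedSectionVars false

open scoped ENNReal

variable {α : Type*} [MeasurableSpace α] {μ : Measure α}
  {A F F' : Type*} [NormedAddCommGroup A] [NormedSpace ℝ A] [NormedAddCommGroup F]
  [NormedSpace ℝ F] [NormedAddCommGroup F'] [NormedSpace ℝ F']

open Classical in
variable (μ) in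
/-- The class of `f` in `Lp`, with the value `0` if `f` is not in `ℒp`. -/
def toLpD (p : ℝ≥0∞) (f : α → A) : Lp A p μ := if h : MemLp f p μ then h.toLp f else 0

lemma toLpD_eq {p : ℝ≥0∞} {f : α → A} (h : MemLp f p μ) : toLpD μ p f = h.toLp f := dif_pos h

lemma coeFn_toLpD {p : ℝ≥0∞} {f : α → A} (h : MemLp f p μ) : toLpD μ p f =ᵐ[μ] f := by
  rw [toLpD_eq h]; exact h.coeFn_toLp

lemma toLpD_congr {p : ℝ≥0∞} {f g : α → A} (hf : MemLp f p μ) (h : f =ᵐ[μ] g) :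
    toLpD μ p f = toLpD μ p g := by
  rw [toLpD_eq hf, toLpD_eq ((memLp_congr_ae h).mp hf)]
  exact MemLp.toLp_congr _ _ h

lemma toLpD_coeFn {p : ℝ≥0∞} (f : Lp A p μ) : toLpD μ p f = f := by
  rw [toLpD_eq (Lp.memLp f)]; exact Lp.toLp_coeFn _ _

lemma norm_toLpD_le_of_eLpNorm_le {p : ℝ≥0∞} {f : α → A} (h : MemLp f p μ) {C : ℝ}
    (hC0 : 0 ≤ C) (hC : eLpNorm f p μ ≤ ENNReal.ofReal C) : ‖toLpD μ p f‖ ≤ C := by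
  rw [toLpD_eq h, Lp.norm_toLp]
  exact ENNReal.toReal_le_of_le_ofReal hC0 hC

lemma hasDerivWithinAt_of_norm_le {τ : ℝ} (hτ : 0 < τ) {u : ℝ → A} {u' : A}
    (h : ∀ ε > 0, ∃ δ > 0, ∀ s ∈ Icc 0 τ, s ≤ δ → ‖u s - u 0 - s • u'‖ ≤ ε * s) :
    HasDerivWithinAt u u' (Ici 0) 0 := by
  rw [hasDerivWithinAt_iff_isLittleO, Asymptotics.isLittleO_iff]
  intro c hc
  obtain ⟨δ, hδ, hle⟩ := h c hc
  filter_upwards [Icc_mem_nhdsGE (lt_min hτ hδ)] with s hs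
  rw [sub_zero, Real.norm_of_nonneg hs.1]
  exact hle s ⟨hs.1, hs.2.trans (min_le_left _ _)⟩ (hs.2.trans (min_le_right _ _))

lemma hasDerivWithinAt_toLpD {p : ℝ≥0∞} [Fact (1 ≤ p)] {τ : ℝ} (hτ : 0 < τ)
    {b : ℝ → α → A} {b' : α → A} (hb : ∀ s ∈ Icc 0 τ, MemLp (b s) p μ) (hb' : MemLp b' p μ)
    (h : ∀ ε > 0, ∃ δ > 0, ∀ s ∈ Icc 0 τ, s ≤ δ →
      eLpNorm (fun x => b s x - b 0 x - s • b' x) p μ ≤ ENNReal.ofReal (ε * s)) :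
    HasDerivWithinAt (fun s => toLpD μ p (b s)) (toLpD μ p b') (Ici 0) 0 := by
  refine hasDerivWithinAt_of_norm_le hτ fun ε hε => ?_
  obtain ⟨δ, hδ, hle⟩ := h ε hε
  refine ⟨δ, hδ, fun s hs hsδ => ?_⟩
  have h0 := hb 0 ⟨le_rfl, hτ.le⟩
  rw [toLpD_eq (hb s hs), toLpD_eq h0, toLpD_eq hb', ← MemLp.toLp_const_smul, ← MemLp.toLp_sub,
    ← MemLp.toLp_sub, Lp.norm_toLp]
  exact ENNReal.toReal_le_of_le_ofReal (mul_nonneg hε.le hs.1) (hle s hs hsδ)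

lemma hasDerivWithinAt_toLpD_top {τ : ℝ} (hτ : 0 < τ)
    {b : ℝ → α → A} {b' : α → A} (hb : ∀ s ∈ Icc 0 τ, MemLp (b s) ∞ μ) (hb' : MemLp b' ∞ μ)
    (h : ∀ ε > 0, ∃ δ > 0, ∀ s ∈ Icc 0 τ, s ≤ δ → ∀ x, ‖b s x - b 0 x - s • b' x‖ ≤ ε * s) :
    HasDerivWithinAt (fun s => toLpD μ ∞ (b s)) (toLpD μ ∞ b') (Ici 0) 0 := by
  refine hasDerivWithinAt_toLpD hτ hb hb' fun ε hε => ?_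
  obtain ⟨δ, hδ, hle⟩ := h ε hε
  refine ⟨δ, hδ, fun s hs hsδ => ?_⟩
  rw [eLpNorm_exponent_top]
  exact eLpNormEssSup_le_of_ae_bound (ae_of_all _ (hle s hs hsδ))

variable (μ) in
/-- Multiplication by the bounded function `b`, through the bilinear map `Bil`. -/
def mulOp (Bil : A →L[ℝ] F →L[ℝ] F') (b : α → A) : Lp F 2 μ →L[ℝ] Lp F' 2 μ :=
  Bil.holderL μ ∞ 2 2 (toLpD μ ∞ b)

lemma coeFn_mulOp (Bil : A →L[ℝ] F →L[ℝ] F') {b : α → A} (hb : MemLp b ∞ μ) (w : Lp F 2 μ) :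
    mulOp μ Bil b w =ᵐ[μ] fun x => Bil (b x) (w x) := by
  have h := Bil.coeFn_holder (r := 2) (toLpD μ ∞ b) w
  filter_upwards [h, coeFn_toLpD hb] with x h1 h2
  rw [← h2, ← h1]; rfl

lemma mulOp_toLpD (Bil : A →L[ℝ] F →L[ℝ] F') {b : α → A} (hb : MemLp b ∞ μ) {f : α → F}
    (hf : MemLp f 2 μ) : mulOp μ Bil b (toLpD μ 2 f) = toLpD μ 2 fun x => Bil (b x) (f x) := by
  have hm : MemLp (fun x => Bil (b x) (f x)) 2 μ := Bil.memLp_of_bilin 2 hb hf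
  apply Lp.ext
  filter_upwards [coeFn_mulOp Bil hb (toLpD μ 2 f), coeFn_toLpD hf, coeFn_toLpD hm] with x h1 h2 h3
  rw [h1, h2, h3]

lemma hasDerivWithinAt_mulOp (Bil : A →L[ℝ] F →L[ℝ] F') {b : ℝ → α → A} {b' : α → A}
    (h : HasDerivWithinAt (fun s => toLpD μ ∞ (b s)) (toLpD μ ∞ b') (Ici 0) 0) :
    HasDerivWithinAt (fun s => mulOp μ Bil (b s)) (mulOp μ Bil b') (Ici 0) 0 :=
  (Bil.holderL μ ∞ 2 2).hasFDerivAt.comp_hasDerivWithinAt (0 : ℝ) h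

end LpTools

/-! ### The space `L² × L²`: pairs of functions and diagonal multiplication operators -/

section L2PairTools

open scoped ENNReal

variable {N : ℕ}

/-- The element of `L²(ℝ^N) × L²(ℝ^N)^N` given by two functions. -/
def pairD (u : Eucl N → ℝ) (g : Eucl N → Eucl N) : L2Pair N :=
  WithLp.toLp 2 (toLpD volume 2 u, toLpD volume 2 g)

lemma pairD_fst (u : Eucl N → ℝ) (g : Eucl N → Eucl N) : (pairD u g).fst = toLpD volume 2 u := rfl

lemma pairD_snd (u : Eucl N → ℝ) (g : Eucl N → Eucl N) : (pairD u g).snd = toLpD volume 2 g := rfl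

lemma L2Pair.ext {w z : L2Pair N} (h1 : w.fst = z.fst) (h2 : w.snd = z.snd) : w = z :=
  WithLp.ofLp_injective 2 (Prod.ext h1 h2)

lemma inner_L2Pair (w z : L2Pair N) : ⟪w, z⟫_ℝ
    = (∫ x, (w.fst : Eucl N → ℝ) x * (z.fst : Eucl N → ℝ) x)
      + ∫ x, ⟪(w.snd : Eucl N → Eucl N) x, (z.snd : Eucl N → Eucl N) x⟫_ℝ := by
  rw [WithLp.prod_inner_apply, L2.inner_def, L2.inner_def]
  congr 1
  refine integral_congr_ae (ae_of_all _ fun x => ?_)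
  simp [mul_comm]

lemma norm_L2Pair_le (w : L2Pair N) : ‖w‖ ≤ ‖w.fst‖ + ‖w.snd‖ := by
  rw [WithLp.prod_norm_eq_of_L2, Real.sqrt_le_left (by positivity)]
  nlinarith [norm_nonneg w.fst, norm_nonneg w.snd]

/-- The isomorphism between `L²(ℝ^N) × L²(ℝ^N)^N` with the Hilbert and the maximum norm. -/
abbrev L2Pair.equiv (N : ℕ) : L2Pair N ≃L[ℝ]
    Lp ℝ 2 (volume : Measure (Eucl N)) × Lp (Eucl N) 2 (volume : Measure (Eucl N)) :=
  WithLp.prodContinuousLinearEquiv 2 ℝ _ _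

/-- The diagonal operator on `L²(ℝ^N) × L²(ℝ^N)^N` with the given components. -/
def diagOp (P : Lp ℝ 2 (volume : Measure (Eucl N)) →L[ℝ] Lp ℝ 2 (volume : Measure (Eucl N)))
    (Q : Lp (Eucl N) 2 (volume : Measure (Eucl N)) →L[ℝ]
      Lp (Eucl N) 2 (volume : Measure (Eucl N))) : L2Pair N →L[ℝ] L2Pair N :=
  ((L2Pair.equiv N).symm : _ →L[ℝ] L2Pair N) ∘L
    (ContinuousLinearMap.inl ℝ _ _ ∘L P ∘L ContinuousLinearMap.fst ℝ _ _
      + ContinuousLinearMap.inr ℝ _ _ ∘L Q ∘L ContinuousLinearMap.snd ℝ _ _) ∘L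
    (L2Pair.equiv N : L2Pair N →L[ℝ] _)

lemma diagOp_fst (P : Lp ℝ 2 (volume : Measure (Eucl N)) →L[ℝ] Lp ℝ 2 (volume : Measure (Eucl N)))
    (Q : Lp (Eucl N) 2 (volume : Measure (Eucl N)) →L[ℝ]
      Lp (Eucl N) 2 (volume : Measure (Eucl N))) (w : L2Pair N) :
    (diagOp P Q w).fst = P w.fst := by
  simp [diagOp]

lemma diagOp_snd (P : Lp ℝ 2 (volume : Measure (Eucl N)) →L[ℝ] Lp ℝ 2 (volume : Measure (Eucl N)))
    (Q : Lp (Eucl N) 2 (volume : Measure (Eucl N)) →L[ℝ]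
      Lp (Eucl N) 2 (volume : Measure (Eucl N))) (w : L2Pair N) :
    (diagOp P Q w).snd = Q w.snd := by
  simp [diagOp]

lemma hasDerivWithinAt_diagOp
    {P : ℝ → Lp ℝ 2 (volume : Measure (Eucl N)) →L[ℝ] Lp ℝ 2 (volume : Measure (Eucl N))}
    {Q : ℝ → Lp (Eucl N) 2 (volume : Measure (Eucl N)) →L[ℝ]
      Lp (Eucl N) 2 (volume : Measure (Eucl N))} {P' Q'}
    (hP : HasDerivWithinAt P P' (Ici 0) 0) (hQ : HasDerivWithinAt Q Q' (Ici 0) 0) :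
    HasDerivWithinAt (fun s => diagOp (P s) (Q s)) (diagOp P' Q') (Ici 0) 0 := by
  refine hasDerivWithinAt_of_norm_le (τ := 1) one_pos fun ε hε => ?_
  have h := (hP.hasFDerivWithinAt.isLittleO.bound (half_pos hε)).and
    (hQ.hasFDerivWithinAt.isLittleO.bound (half_pos hε))
  obtain ⟨δ, hδ, hsub⟩ := mem_nhdsGE_iff_exists_Icc_subset.mp h
  refine ⟨δ, hδ, fun s hs hsδ => ?_⟩
  obtain ⟨h1, h2⟩ := hsub ⟨hs.1, hsδ⟩
  simp only [sub_zero, ContinuousLinearMap.toSpanSingleton_apply,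
    Real.norm_of_nonneg hs.1] at h1 h2
  refine ContinuousLinearMap.opNorm_le_bound _ (mul_nonneg hε.le hs.1) fun w => ?_
  refine (norm_L2Pair_le _).trans ?_
  have e1 : ((diagOp (P s) (Q s) - diagOp (P 0) (Q 0) - s • diagOp P' Q') w).fst
      = (P s - P 0 - s • P') w.fst := by
    simp [diagOp_fst]
  have e2 : ((diagOp (P s) (Q s) - diagOp (P 0) (Q 0) - s • diagOp P' Q') w).snd
      = (Q s - Q 0 - s • Q') w.snd := by
    simp [diagOp_snd]
  rw [e1, e2]
  calc _ ≤ ‖P s - P 0 - s • P'‖ * ‖w.fst‖ + ‖Q s - Q 0 - s • Q'‖ * ‖w.snd‖ :=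
        add_le_add (ContinuousLinearMap.le_opNorm _ _) (ContinuousLinearMap.le_opNorm _ _)
    _ ≤ ε / 2 * s * ‖w‖ + ε / 2 * s * ‖w‖ := by
        gcongr
        · exact mul_nonneg (half_pos hε).le hs.1
        · exact WithLp.norm_fst_le _ _
        · exact mul_nonneg (half_pos hε).le hs.1
        · exact WithLp.norm_snd_le _ _
    _ = ε * s * ‖w‖ := by ring

/-- Multiplication of the components of `(u, g)` by bounded functions. -/
def pairOp (a : Eucl N → ℝ) (b : Eucl N → Eucl N →L[ℝ] Eucl N) : L2Pair N →L[ℝ] L2Pair N :=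
  diagOp (mulOp volume (ContinuousLinearMap.mul ℝ ℝ) a)
    (mulOp volume (ContinuousLinearMap.id ℝ (Eucl N →L[ℝ] Eucl N)) b)

lemma coeFn_pairOp_fst {a : Eucl N → ℝ} {b : Eucl N → Eucl N →L[ℝ] Eucl N}
    (ha : MemLp a ∞ volume) (w : L2Pair N) :
    (pairOp a b w).fst =ᵐ[volume] fun x => a x * (w.fst : Eucl N → ℝ) x := by
  rw [pairOp, diagOp_fst]; exact coeFn_mulOp _ ha _

lemma coeFn_pairOp_snd {a : Eucl N → ℝ} {b : Eucl N → Eucl N →L[ℝ] Eucl N}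
    (hb : MemLp b ∞ volume) (w : L2Pair N) :
    (pairOp a b w).snd =ᵐ[volume] fun x => b x ((w.snd : Eucl N → Eucl N) x) := by
  rw [pairOp, diagOp_snd]; exact coeFn_mulOp _ hb _

lemma inner_pairOp {a : Eucl N → ℝ} {b : Eucl N → Eucl N →L[ℝ] Eucl N}
    (ha : MemLp a ∞ volume) (hb : MemLp b ∞ volume) (w z : L2Pair N) :
    ⟪pairOp a b w, z⟫_ℝ = (∫ x, a x * (w.fst : Eucl N → ℝ) x * (z.fst : Eucl N → ℝ) x)
      + ∫ x, ⟪b x ((w.snd : Eucl N → Eucl N) x), (z.snd : Eucl N → Eucl N) x⟫_ℝ := by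
  rw [inner_L2Pair]
  congr 1
  · refine integral_congr_ae ?_
    filter_upwards [coeFn_pairOp_fst (b := b) ha w] with x hx
    rw [hx]
  · refine integral_congr_ae ?_
    filter_upwards [coeFn_pairOp_snd (a := a) hb w] with x hx
    rw [hx]

lemma integrable_mul_fst_fst {a : Eucl N → ℝ} (ha : MemLp a ∞ volume) (w z : L2Pair N) :
    Integrable (fun x => a x * (w.fst : Eucl N → ℝ) x * (z.fst : Eucl N → ℝ) x) volume := by
  have h1 : MemLp (fun x => a x * (w.fst : Eucl N → ℝ) x) 2 volume :=
    (ContinuousLinearMap.mul ℝ ℝ).memLp_of_bilin 2 ha (Lp.memLp w.fst)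
  exact h1.integrable_mul (Lp.memLp z.fst)

lemma integrable_inner_snd_snd {b : Eucl N → Eucl N →L[ℝ] Eucl N} (hb : MemLp b ∞ volume)
    (w z : L2Pair N) :
    Integrable (fun x => ⟪b x ((w.snd : Eucl N → Eucl N) x), (z.snd : Eucl N → Eucl N) x⟫_ℝ)
      volume := by
  have h1 : MemLp (fun x => b x ((w.snd : Eucl N → Eucl N) x)) 2 volume :=
    (ContinuousLinearMap.id ℝ (Eucl N →L[ℝ] Eucl N)).memLp_of_bilin 2 hb (Lp.memLp w.snd)
  exact memLp_one_iff_integrable.mp ((innerSL ℝ).memLp_of_bilin 1 h1 (Lp.memLp z.snd))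

lemma pairOp_symm {a : Eucl N → ℝ} {b : Eucl N → Eucl N →L[ℝ] Eucl N}
    (ha : MemLp a ∞ volume) (hb : MemLp b ∞ volume)
    (hsymm : ∀ x v w, ⟪b x v, w⟫_ℝ = ⟪v, b x w⟫_ℝ) (w z : L2Pair N) :
    ⟪pairOp a b w, z⟫_ℝ = ⟪w, pairOp a b z⟫_ℝ := by
  rw [real_inner_comm (pairOp a b z) w, inner_pairOp ha hb, inner_pairOp ha hb]
  congr 1
  · congr 1; ext x; ring
  · congr 1; ext x; rw [hsymm, real_inner_comm]

lemma hasDerivWithinAt_pairOp {a : ℝ → Eucl N → ℝ} {b : ℝ → Eucl N → Eucl N →L[ℝ] Eucl N}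
    {a' : Eucl N → ℝ} {b' : Eucl N → Eucl N →L[ℝ] Eucl N}
    (ha : HasDerivWithinAt (fun s => toLpD volume ∞ (a s)) (toLpD volume ∞ a') (Ici 0) 0)
    (hb : HasDerivWithinAt (fun s => toLpD volume ∞ (b s)) (toLpD volume ∞ b') (Ici 0) 0) :
    HasDerivWithinAt (fun s => pairOp (a s) (b s)) (pairOp a' b') (Ici 0) 0 :=
  hasDerivWithinAt_diagOp (hasDerivWithinAt_mulOp _ ha) (hasDerivWithinAt_mulOp _ hb)

lemma hasDerivWithinAt_pairD {u : ℝ → Eucl N → ℝ} {g : ℝ → Eucl N → Eucl N}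
    {u' : Eucl N → ℝ} {g' : Eucl N → Eucl N}
    (hu : HasDerivWithinAt (fun s => toLpD volume 2 (u s)) (toLpD volume 2 u') (Ici 0) 0)
    (hg : HasDerivWithinAt (fun s => toLpD volume 2 (g s)) (toLpD volume 2 g') (Ici 0) 0) :
    HasDerivWithinAt (fun s => pairD (u s) (g s)) (pairD u' g') (Ici 0) 0 := by
  let Φ : (Lp ℝ 2 (volume : Measure (Eucl N)) × Lp (Eucl N) 2 (volume : Measure (Eucl N)))
    →L[ℝ] L2Pair N := (L2Pair.equiv N).symm
  exact Φ.hasFDerivAt.comp_hasDerivWithinAt (0 : ℝ) (hu.prodMk hg)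

end L2PairTools

/-! ### Composition with expanding maps, and mollification -/

section VolumePreimage

set_option linter.unusedSectionVars false

open scoped ENNReal NNReal

variable {N : ℕ} {F : Type*} [NormedAddCommGroup F] [NormedSpace ℝ F]

/-- Preimages under an expanding map shrink in Hausdorff measure by a definite factor, and Lebesgue
measure is a multiple of `N`-dimensional Hausdorff measure. No differentiability is used, so the
bound also applies to the interpolations between `P` and the identity. -/
lemma map_volume_le_of_antilipschitz {K : ℝ≥0} {P : Eucl N → Eucl N} (hP : AntilipschitzWith K P)
    (hm : Measurable P) :
    Measure.map P volume ≤ (K : ℝ≥0∞) ^ N • (volume : Measure (Eucl N)) := by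
  have hfr : Module.finrank ℝ (Eucl N) = N := by simp
  have hH : (μH[(N : ℝ)] : Measure (Eucl N)).IsAddHaarMeasure := by
    have := isAddHaarMeasure_hausdorffMeasure (E := Eucl N)
    rwa [hfr] at this
  have hc := Measure.isAddLeftInvariant_eq_smul (volume : Measure (Eucl N)) μH[(N : ℝ)]
  refine Measure.le_iff.mpr fun A hA => ?_
  rw [Measure.map_apply hm hA, Measure.smul_apply, hc]
  have h := hP.hausdorffMeasure_preimage_le (Nat.cast_nonneg N) A
  rw [ENNReal.rpow_natCast] at h
  calc _ = (Measure.addHaarScalarFactor volume μH[(N : ℝ)] : ℝ≥0∞) * μH[(N : ℝ)] (P ⁻¹' A) := rfl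
    _ ≤ (Measure.addHaarScalarFactor volume μH[(N : ℝ)] : ℝ≥0∞) * ((K : ℝ≥0∞) ^ N * μH[(N : ℝ)] A) := by
      gcongr
    _ = (K : ℝ≥0∞) ^ N * ((Measure.addHaarScalarFactor volume μH[(N : ℝ)] : ℝ≥0∞) * μH[(N : ℝ)] A) := by
      ring
    _ = _ := rfl

lemma quasiMeasurePreserving_of_antilipschitz {P : Eucl N → Eucl N} (hP : AntilipschitzWith 2 P)
    (hm : Measurable P) : Measure.QuasiMeasurePreserving P volume volume :=
  ⟨hm, Measure.absolutelyContinuous_of_le_smul (map_volume_le_of_antilipschitz hP hm)⟩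

lemma memLp_comp {P : Eucl N → Eucl N} (hP : AntilipschitzWith 2 P)
    (hm : Measurable P) {f : Eucl N → F} {p : ℝ≥0∞} (hf : MemLp f p volume) :
    MemLp (fun x => f (P x)) p volume :=
  (hf.of_measure_le_smul (by finiteness) (map_volume_le_of_antilipschitz hP hm)).comp_of_map
    hm.aemeasurable

lemma eLpNorm_comp_le {P : Eucl N → Eucl N} (hP : AntilipschitzWith 2 P)
    (hm : Measurable P) {f : Eucl N → F} (hf : AEStronglyMeasurable f volume) :
    eLpNorm (fun x => f (P x)) 2 volume ≤ 2 ^ N * eLpNorm f 2 volume := by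
  have hle := map_volume_le_of_antilipschitz hP hm
  have hac : Measure.map P volume ≪ volume := Measure.absolutelyContinuous_of_le_smul hle
  have h1 : (1 : ℝ≥0∞) ≤ 2 ^ N := one_le_pow₀ (by norm_num)
  calc eLpNorm (fun x => f (P x)) 2 volume = eLpNorm f 2 (Measure.map P volume) :=
        (eLpNorm_map_measure (hf.mono_ac hac) hm.aemeasurable).symm
    _ ≤ eLpNorm f 2 ((2 : ℝ≥0∞) ^ N • volume) := eLpNorm_mono_measure _ (by simpa using hle)
    _ = ((2 : ℝ≥0∞) ^ N) ^ (1 / (2 : ℝ≥0∞)).toReal • eLpNorm f 2 volume :=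
        eLpNorm_smul_measure_of_ne_zero (by positivity) _ _ _
    _ ≤ 2 ^ N * eLpNorm f 2 volume := by
        rw [smul_eq_mul]
        gcongr
        -- The sharp factor is `2^(N/2)`; any constant depending only on `N` is enough.
        calc ((2 : ℝ≥0∞) ^ N) ^ (1 / (2 : ℝ≥0∞)).toReal ≤ ((2 : ℝ≥0∞) ^ N) ^ (1 : ℝ) :=
              ENNReal.rpow_le_rpow_of_exponent_le h1 (by norm_num)
          _ = 2 ^ N := ENNReal.rpow_one _

end VolumePreimage

/-! ### Averages over a probability measure in `L²` -/

section Average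

set_option linter.unusedSectionVars false

open scoped ENNReal

variable {α β F F' : Type*} [MeasurableSpace α] [MeasurableSpace β] [NormedAddCommGroup F]
  [NormedAddCommGroup F'] {μ : Measure α} [SFinite μ] {ν : Measure β} [IsProbabilityMeasure ν]

lemma lintegral_enorm_sq_eq {f : α → F} : ∫⁻ x, ‖f x‖ₑ ^ (2 : ℝ) ∂μ = eLpNorm f 2 μ ^ (2 : ℝ) :=
  by simpa using (eLpNorm_nnreal_pow_eq_lintegral (f := f) (μ := μ) (p := 2) two_ne_zero).symm

/-- The `L²` norm of a function dominated by an average is at most the largest `L²` norm of the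
averaged functions. -/
lemma eLpNorm_le_of_le_average {h : α → F} {k : α × β → F'}
    (hk : AEStronglyMeasurable k (μ.prod ν))
    (hle : ∀ x, ‖h x‖ₑ ≤ ∫⁻ t, ‖k (x, t)‖ₑ ∂ν) {C : ℝ≥0∞}
    (hC : ∀ᵐ t ∂ν, eLpNorm (fun x => k (x, t)) 2 μ ≤ C) : eLpNorm h 2 μ ≤ C := by
  have hmeas : AEMeasurable (fun q : α × β => ‖k q‖ₑ ^ (2 : ℝ)) (μ.prod ν) :=
    hk.enorm.pow_const _
  have key : eLpNorm h 2 μ ^ (2 : ℝ) ≤ C ^ (2 : ℝ) := by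
    rw [← lintegral_enorm_sq_eq]
    calc ∫⁻ x, ‖h x‖ₑ ^ (2 : ℝ) ∂μ ≤ ∫⁻ x, ∫⁻ t, ‖k (x, t)‖ₑ ^ (2 : ℝ) ∂ν ∂μ := by
          refine lintegral_mono_ae ?_
          filter_upwards [hk.prodMk_left] with x hx
          -- On a probability space the `L¹` norm is at most the `L²` norm; after squaring, Tonelli
          -- exchanges the two integrals.
          have h1 := eLpNorm_le_eLpNorm_of_exponent_le (p := 1) (q := 2) one_le_two hx
          rw [eLpNorm_one_eq_lintegral_enorm] at h1
          rw [lintegral_enorm_sq_eq]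
          exact ENNReal.rpow_le_rpow ((hle x).trans h1) (by norm_num)
      _ = ∫⁻ t, ∫⁻ x, ‖k (x, t)‖ₑ ^ (2 : ℝ) ∂μ ∂ν := lintegral_lintegral_swap hmeas
      _ ≤ ∫⁻ _, C ^ (2 : ℝ) ∂ν := by
          refine lintegral_mono_ae ?_
          filter_upwards [hC] with t ht
          rw [lintegral_enorm_sq_eq (f := fun x => k (x, t))]
          exact ENNReal.rpow_le_rpow ht (by norm_num)
      _ = C ^ (2 : ℝ) := by simp
  exact (ENNReal.rpow_le_rpow_iff (by norm_num)).mp key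

end Average

/-! ### Continuity of translations in `L²` -/

section Translation

set_option linter.unusedSectionVars false

variable {N : ℕ} {F : Type*} [NormedAddCommGroup F] [NormedSpace ℝ F]

lemma exists_eLpNorm_translate_sub_le {u : Eucl N → F} (hu : MemLp u 2 volume) {ε : ℝ}
    (hε : 0 < ε) : ∃ δ > 0, ∀ t : Eucl N, ‖t‖ < δ →
      eLpNorm (fun x => u (x - t) - u x) 2 volume ≤ ENNReal.ofReal ε := by
  let g : Eucl N → C(Eucl N, Eucl N) := fun t => ⟨fun x => x - t, by fun_prop⟩
  have hg : Continuous g := ContinuousMap.continuous_of_continuous_uncurry g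
    (by change Continuous fun q : Eucl N × Eucl N => q.2 - q.1; fun_prop)
  have hgm : ∀ t, MeasurePreserving (g t) volume volume := fun t =>
    measurePreserving_sub_right volume t
  have hc := (continuous_const (y := hu.toLp u)).compMeasurePreservingLp hg hgm
    (ENNReal.ofNat_ne_top)
  obtain ⟨δ, hδ, h⟩ := Metric.continuousAt_iff.mp (hc.continuousAt (x := 0)) ε hε
  refine ⟨δ, hδ, fun t ht => ?_⟩
  have := (h (x := t) (by simpa using ht)).le
  rw [Lp.toLp_compMeasurePreserving, Lp.toLp_compMeasurePreserving, Lp.dist_def] at this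
  have h2 := (ENNReal.le_ofReal_iff_toReal_le ((Lp.memLp _).sub (Lp.memLp _)).eLpNorm_ne_top
    hε.le).mpr this
  refine (eLpNorm_congr_ae ?_).trans_le h2
  filter_upwards [(hu.comp_measurePreserving (hgm t)).coeFn_toLp,
    (hu.comp_measurePreserving (hgm 0)).coeFn_toLp] with x h1 h0
  rw [Pi.sub_apply, h1, h0]
  simp [g]

end Translation

/-! ### Mollification by bump functions -/

section Mollify

set_option linter.unusedSectionVars false

open scoped Convolution ENNReal

variable {N : ℕ} {F : Type*} [NormedAddCommGroup F] [NormedSpace ℝ F] [CompleteSpace F]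
  (ρ : ContDiffBump (0 : Eucl N))

/-- Convolution of `u` with the normalized bump function `ρ`. -/
def mollify (u : Eucl N → F) : Eucl N → F :=
  (ρ.normed volume) ⋆[ContinuousLinearMap.lsmul ℝ ℝ, volume] u

lemma mollify_apply (u : Eucl N → F) (x : Eucl N) :
    mollify ρ u x = ∫ t, ρ.normed volume t • u (x - t) := rfl

lemma mollify_apply' (u : Eucl N → F) (x : Eucl N) :
    mollify ρ u x = ∫ t, ρ.normed volume (x - t) • u t := by
  rw [mollify_apply, ← integral_sub_left_eq_self _ volume x]
  simp

/-- The probability measure with density `ρ`. -/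
def bumpMeasure : Measure (Eucl N) :=
  volume.withDensity fun t => ENNReal.ofReal (ρ.normed volume t)

lemma measurable_bump : Measurable fun t => ENNReal.ofReal (ρ.normed volume t) :=
  (ρ.contDiff_normed (n := 0)).continuous.measurable.ennreal_ofReal

instance : IsProbabilityMeasure (bumpMeasure ρ) := by
  refine ⟨?_⟩
  rw [bumpMeasure, withDensity_apply _ MeasurableSet.univ, Measure.restrict_univ,
    ← ofReal_integral_eq_lintegral_ofReal ρ.integrable_normed (ae_of_all _ fun x =>
    ρ.nonneg_normed x), ρ.integral_normed, ENNReal.ofReal_one]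

lemma contDiff_mollify {u : Eucl N → F} (hu : LocallyIntegrable u volume) :
    ContDiff ℝ ∞ (mollify ρ u) :=
  ρ.hasCompactSupport_normed.contDiff_convolution_left _ ρ.contDiff_normed hu

/-- Since `ρ` has integral one, `ρ * u - u` is the average of the translation differences `u(· - t)
- u` over the probability measure with density `ρ`, which only charges `‖t‖ < ρ.rOut`. -/
lemma eLpNorm_mollify_sub_le {u : Eucl N → F} (hu : MemLp u 2 volume) {C : ℝ≥0∞}
    (hC : ∀ t : Eucl N, ‖t‖ < ρ.rOut → eLpNorm (fun x => u (x - t) - u x) 2 volume ≤ C) :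
    eLpNorm (fun x => mollify ρ u x - u x) 2 volume ≤ C := by
  have hli : LocallyIntegrable u volume := hu.locallyIntegrable one_le_two
  have hac : bumpMeasure ρ ≪ volume := withDensity_absolutelyContinuous _ _
  have hmeas : AEStronglyMeasurable (fun q : Eucl N × Eucl N => u (q.1 - q.2) - u q.1)
      (volume.prod (bumpMeasure ρ)) := by
    have h1 : AEStronglyMeasurable (fun q : Eucl N × Eucl N => u (q.1 - q.2))
        (volume.prod (bumpMeasure ρ)) :=
      hu.1.comp_quasiMeasurePreserving (quasiMeasurePreserving_sub volume (bumpMeasure ρ))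
    have h2 : AEStronglyMeasurable (fun q : Eucl N × Eucl N => u q.1)
        (volume.prod (bumpMeasure ρ)) := hu.1.comp_quasiMeasurePreserving
          Measure.quasiMeasurePreserving_fst
    exact h1.sub h2
  refine eLpNorm_le_of_le_average hmeas (fun x => ?_) ?_
  · have hint : Integrable (fun t => ρ.normed volume t • u (x - t)) volume :=
      (ρ.hasCompactSupport_normed (μ := volume)).convolutionExists_left
        (ContinuousLinearMap.lsmul ℝ ℝ) (ρ.contDiff_normed (n := 0)).continuous hli x
    have hint2 : Integrable (fun t => ρ.normed volume t • u x) volume :=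
      ρ.integrable_normed.smul_const _
    have e : mollify ρ u x - u x = ∫ t, ρ.normed volume t • (u (x - t) - u x) := by
      simp_rw [smul_sub]
      rw [integral_sub hint hint2, integral_smul_const, ρ.integral_normed, one_smul, mollify_apply]
    rw [e]
    refine (enorm_integral_le_lintegral_enorm _).trans ?_
    rw [bumpMeasure, lintegral_withDensity_eq_lintegral_mul_non_measurable _ (measurable_bump ρ)
      (ae_of_all _ fun t => ENNReal.ofReal_lt_top)]
    refine lintegral_mono fun t => ?_
    rw [enorm_smul, Pi.mul_apply, Real.enorm_of_nonneg (ρ.nonneg_normed t)]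
  · rw [bumpMeasure, ae_withDensity_iff (measurable_bump ρ)]
    refine ae_of_all _ fun t ht => hC t ?_
    have : t ∈ Function.support (ρ.normed volume) := fun h0 => ht (by rw [h0, ENNReal.ofReal_zero])
    rw [ρ.support_normed_eq] at this
    simpa using this

lemma support_mollify_subset (u : Eucl N → F) :
    Function.support (mollify ρ u) ⊆ Metric.thickening ρ.rOut (Function.support u) := by
  intro x hx
  obtain ⟨a, ha, b, hb, rfl⟩ := support_convolution_subset _ hx
  rw [ρ.support_normed_eq] at ha
  refine Metric.mem_thickening_iff.mpr ⟨b, hb, ?_⟩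
  rw [dist_eq_norm, add_sub_cancel_right]
  simpa using ha

end Mollify

/-! ### Weak gradients and their mollification -/

section WeakGradient

open scoped Convolution

variable {N : ℕ} {u : Eucl N → ℝ} {g : Eucl N → Eucl N}

lemma continuous_gradient {φ : Eucl N → ℝ} (hφ : ContDiff ℝ 1 φ) : Continuous (gradient φ) :=
  (InnerProductSpace.toDual ℝ (Eucl N)).symm.continuous.comp (hφ.continuous_fderiv one_ne_zero)

lemma hasCompactSupport_gradient {φ : Eucl N → ℝ} (hφ : HasCompactSupport φ) :
    HasCompactSupport (gradient φ) :=
  (hφ.fderiv ℝ).comp_left (map_zero (InnerProductSpace.toDual ℝ (Eucl N)).symm)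

lemma inner_gradient_eq_fderiv (φ : Eucl N → ℝ) (x v : Eucl N) :
    ⟪gradient φ x, v⟫_ℝ = fderiv ℝ φ x v := inner_gradient_left

lemma norm_gradient_eq (φ : Eucl N → ℝ) (x : Eucl N) : ‖gradient φ x‖ = ‖fderiv ℝ φ x‖ :=
  (InnerProductSpace.toDual ℝ (Eucl N)).symm.norm_map _

lemma isWeakGradient_iff (hu : LocallyIntegrable u volume) (hg : LocallyIntegrable g volume) :
    IsWeakGradient u g ↔ ∀ φ : Eucl N → ℝ, ContDiff ℝ ∞ φ → HasCompactSupport φ → ∀ v : Eucl N,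
      ∫ x, u x * ⟪gradient φ x, v⟫_ℝ = -∫ x, φ x * ⟪g x, v⟫_ℝ := by
  have key : ∀ φ : Eucl N → ℝ, ContDiff ℝ ∞ φ → HasCompactSupport φ → ∀ v : Eucl N,
      (∫ x, u x * ⟪gradient φ x, v⟫_ℝ = ⟪∫ x, u x • gradient φ x, v⟫_ℝ) ∧
      ∫ x, φ x * ⟪g x, v⟫_ℝ = ⟪∫ x, φ x • g x, v⟫_ℝ := by
    intro φ hφ hc v
    have hφ1 : ContDiff ℝ 1 φ := hφ.of_le (by exact_mod_cast le_top)
    have h1 : Integrable (fun x => u x • gradient φ x) volume :=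
      hu.integrable_smul_right_of_hasCompactSupport (continuous_gradient hφ1)
        (hasCompactSupport_gradient hc)
    have h2 : Integrable (fun x => φ x • g x) volume :=
      hg.integrable_smul_left_of_hasCompactSupport hφ.continuous hc
    refine ⟨?_, ?_⟩
    · rw [real_inner_comm, ← integral_inner h1]
      simp_rw [real_inner_smul_right, real_inner_comm v]
    · rw [real_inner_comm, ← integral_inner h2]
      simp_rw [real_inner_smul_right, real_inner_comm v]
  constructor
  · rintro ⟨_, _, h⟩ φ hφ hc v
    rw [(key φ hφ hc v).1, (key φ hφ hc v).2, h φ hφ hc, inner_neg_left]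
  · intro h
    refine ⟨hu, hg, fun φ hφ hc => ext_inner_right ℝ fun v => ?_⟩
    rw [← (key φ hφ hc v).1, inner_neg_left, ← (key φ hφ hc v).2, h φ hφ hc]

lemma isWeakGradient_of_contDiff {φ : Eucl N → ℝ} (hφ : ContDiff ℝ 1 φ) :
    IsWeakGradient φ (gradient φ) := by
  refine (isWeakGradient_iff hφ.continuous.locallyIntegrable
    (continuous_gradient hφ).locallyIntegrable).mpr fun ψ hψ hc v => ?_
  have hψ1 : ContDiff ℝ 1 ψ := hψ.of_le (by exact_mod_cast le_top)
  simp_rw [inner_gradient_eq_fderiv]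
  have hcφ' : Continuous fun x => fderiv ℝ φ x v := by
    have := hφ.continuous_fderiv one_ne_zero; fun_prop
  have hcψ' : Continuous fun x => fderiv ℝ ψ x v := by
    have := hψ1.continuous_fderiv one_ne_zero; fun_prop
  rw [integral_mul_fderiv_eq_neg_fderiv_mul_of_integrable]
  · simp_rw [mul_comm]
  · exact (hcφ'.mul hψ.continuous).integrable_of_hasCompactSupport hc.mul_left
  · exact (hφ.continuous.mul hcψ').integrable_of_hasCompactSupport
      ((hc.fderiv_apply (𝕜 := ℝ) v).mul_left)
  · exact (hφ.continuous.mul hψ.continuous).integrable_of_hasCompactSupport hc.mul_left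
  · exact fun x _ => hφ.differentiable one_ne_zero x
  · exact fun x _ => hψ1.differentiable one_ne_zero x

/-- Put the derivative on the kernel; then `t ↦ ρ(x - t)` is an admissible test function for the
weak gradient. -/
lemma gradient_mollify (ρ : ContDiffBump (0 : Eucl N)) (h : IsWeakGradient u g) :
    gradient (mollify ρ u) = mollify ρ g := by
  funext x
  refine ext_inner_right ℝ fun v => ?_
  rw [inner_gradient_eq_fderiv]
  have hρ : ContDiff ℝ ∞ (ρ.normed volume) := ρ.contDiff_normed
  have hρ1 : ContDiff ℝ 1 (ρ.normed volume) := ρ.contDiff_normed (n := 1)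
  have hρc : HasCompactSupport (ρ.normed (volume : Measure (Eucl N))) := ρ.hasCompactSupport_normed
  have hd := hρc.hasFDerivAt_convolution_right (ContinuousLinearMap.lsmul ℝ ℝ).flip h.1 hρ1 x
  have e1 : mollify ρ u = u ⋆[(ContinuousLinearMap.lsmul ℝ ℝ).flip, volume] ρ.normed volume :=
    (convolution_flip _).symm
  rw [e1, hd.fderiv, convolution_precompR_apply _ h.1 (hρc.fderiv ℝ)
    (hρ1.continuous_fderiv one_ne_zero), convolution_def]
  set φ : Eucl N → ℝ := fun t => ρ.normed volume (x - t) with hφdef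
  have hφ : ContDiff ℝ ∞ φ := hρ.comp (contDiff_const.sub contDiff_id)
  have hφc : HasCompactSupport φ :=
    hρc.comp_homeomorph (Homeomorph.subLeft x)
  have hφ' : ∀ t, ⟪gradient φ t, v⟫_ℝ = -fderiv ℝ (ρ.normed volume) (x - t) v := fun t => by
    rw [inner_gradient_eq_fderiv]
    have h1 : HasFDerivAt (fun t : Eucl N => x - t) (-ContinuousLinearMap.id ℝ (Eucl N)) t := by
      simpa using (hasFDerivAt_id t).const_sub x
    have h2 := ((hρ1.differentiable one_ne_zero (x - t)).hasFDerivAt).comp t h1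
    have h3 : fderiv ℝ φ t = _ := h2.fderiv
    rw [h3]; simp
  have hw := (isWeakGradient_iff h.1 h.2.1).mp h φ hφ hφc v
  simp_rw [hφ', mul_neg, integral_neg, neg_inj] at hw
  have hint : Integrable (fun t => φ t • g t) volume :=
    h.2.1.integrable_smul_left_of_hasCompactSupport hφ.continuous hφc
  rw [mollify_apply', real_inner_comm, ← integral_inner hint]
  simp_rw [real_inner_smul_right, fun y => real_inner_comm y v]
  rw [← hw]
  refine integral_congr_ae (ae_of_all _ fun t => ?_)
  simp [mul_comm]

/-- Approximation of an `H¹` function by smooth functions supported close to its support. -/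
lemma exists_smooth_approx (h : IsWeakGradient u g) (hu : MemLp u 2 volume) (hg : MemLp g 2 volume)
    {δ ε : ℝ} (hδ : 0 < δ) (hε : 0 < ε) : ∃ φ : Eucl N → ℝ, ContDiff ℝ ∞ φ ∧
      Function.support φ ⊆ Metric.thickening δ (Function.support u) ∧
      eLpNorm (fun x => φ x - u x) 2 volume ≤ ENNReal.ofReal ε ∧
      eLpNorm (fun x => gradient φ x - g x) 2 volume ≤ ENNReal.ofReal ε := by
  obtain ⟨δ₁, hδ₁, h1⟩ := exists_eLpNorm_translate_sub_le hu hε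
  obtain ⟨δ₂, hδ₂, h2⟩ := exists_eLpNorm_translate_sub_le hg hε
  set r := min δ (min δ₁ δ₂) with hr
  have hr0 : 0 < r := by positivity
  let ρ : ContDiffBump (0 : Eucl N) := ⟨r / 2, r, half_pos hr0, half_lt_self hr0⟩
  have hρr : ρ.rOut = r := rfl
  refine ⟨mollify ρ u, contDiff_mollify ρ h.1, (support_mollify_subset ρ u).trans
    (Metric.thickening_mono (min_le_left _ _) _), ?_, ?_⟩
  · exact eLpNorm_mollify_sub_le ρ hu fun t ht => h1 t
      (ht.trans_le ((min_le_right _ _).trans (min_le_left _ _)))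
  · rw [gradient_mollify ρ h]
    exact eLpNorm_mollify_sub_le ρ hg fun t ht => h2 t
      (ht.trans_le ((min_le_right _ _).trans (min_le_right _ _)))

/-- The fundamental lemma of the calculus of variations; it makes the choice in `weakGrad` harmless.
-/
lemma IsWeakGradient.ae_unique {g' : Eucl N → Eucl N} (h : IsWeakGradient u g)
    (h' : IsWeakGradient u g') : g =ᵐ[volume] g' := by
  have hz := ae_eq_zero_of_integral_contDiff_smul_eq_zero (μ := (volume : Measure (Eucl N)))
    (h.2.1.sub h'.2.1) fun φ hφ hc => by
      have i1 := h.2.1.integrable_smul_left_of_hasCompactSupport hφ.continuous hc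
      have i2 := h'.2.1.integrable_smul_left_of_hasCompactSupport hφ.continuous hc
      simp_rw [Pi.sub_apply, smul_sub]
      rw [integral_sub i1 i2, sub_eq_zero, ← neg_inj, ← h.2.2 φ hφ hc, ← h'.2.2 φ hφ hc]
  filter_upwards [hz] with x hx
  exact sub_eq_zero.mp hx

lemma IsWeakGradient.congr {u' : Eucl N → ℝ} {g' : Eucl N → Eucl N} (h : IsWeakGradient u g)
    (hu : u =ᵐ[volume] u') (hg : g =ᵐ[volume] g') : IsWeakGradient u' g' := by
  refine ⟨h.1.congr hu, h.2.1.congr hg, fun φ hφ hc => ?_⟩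
  rw [integral_congr_ae (g := fun x => u x • gradient φ x) (by
      filter_upwards [hu] with x hx; rw [hx]), h.2.2 φ hφ hc]
  congr 1
  exact integral_congr_ae (by filter_upwards [hg] with x hx; rw [hx])

lemma IsWeakGradient.weakGrad_ae_eq (h : IsWeakGradient u g) : weakGrad u =ᵐ[volume] g := by
  have hex : ∃ g, IsWeakGradient u g := ⟨g, h⟩
  rw [weakGrad, dif_pos hex]
  exact hex.choose_spec.ae_unique h

lemma MemH1.isWeakGradient (h : MemH1 u) : IsWeakGradient u (weakGrad u) := by
  obtain ⟨_, g, _, hg⟩ := h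
  exact hg.congr (ae_eq_refl _) hg.weakGrad_ae_eq.symm

lemma MemH1.memLp_weakGrad (h : MemH1 u) : MemLp (weakGrad u) 2 volume := by
  obtain ⟨_, g, hgL, hg⟩ := h
  exact (memLp_congr_ae hg.weakGrad_ae_eq).mpr hgL

end WeakGradient

/-! ### The spaces `H¹₀(Ω)` and `H¹(ℝ^N)` -/

section SobolevSpaces

open scoped ENNReal

variable {N : ℕ} {Ω : Set (Eucl N)}

/-- The test functions `C_c^∞(Ω)`. -/
structure IsTest (Ω : Set (Eucl N)) (φ : Eucl N → ℝ) : Prop where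
  contDiff : ContDiff ℝ ∞ φ
  hasCompactSupport : HasCompactSupport φ
  tsupport_subset : tsupport φ ⊆ Ω

lemma memLp_of_contDiff_one {φ : Eucl N → ℝ} (h : ContDiff ℝ 1 φ) (hc : HasCompactSupport φ)
    {p : ℝ≥0∞} : MemLp φ p volume :=
  h.continuous.memLp_of_hasCompactSupport hc

lemma memLp_gradient {φ : Eucl N → ℝ} (h : ContDiff ℝ 1 φ) (hc : HasCompactSupport φ)
    {p : ℝ≥0∞} : MemLp (gradient φ) p volume :=
  (continuous_gradient h).memLp_of_hasCompactSupport (hasCompactSupport_gradient hc)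

lemma gradient_add {φ ψ : Eucl N → ℝ} (hφ : ContDiff ℝ 1 φ) (hψ : ContDiff ℝ 1 ψ) :
    gradient (fun x => φ x + ψ x) = fun x => gradient φ x + gradient ψ x := by
  funext x
  refine ext_inner_right ℝ fun v => ?_
  rw [inner_add_left]
  simp_rw [inner_gradient_eq_fderiv]
  rw [fderiv_fun_add (hφ.differentiable one_ne_zero x) (hψ.differentiable one_ne_zero x)]
  rfl

lemma gradient_mul {φ ψ : Eucl N → ℝ} (hφ : ContDiff ℝ 1 φ) (hψ : ContDiff ℝ 1 ψ) :
    gradient (fun x => φ x * ψ x) = fun x => φ x • gradient ψ x + ψ x • gradient φ x := by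
  funext x
  refine ext_inner_right ℝ fun v => ?_
  rw [inner_add_left, real_inner_smul_left, real_inner_smul_left]
  simp_rw [inner_gradient_eq_fderiv]
  rw [fderiv_fun_mul (hφ.differentiable one_ne_zero x) (hψ.differentiable one_ne_zero x)]
  rfl

lemma gradient_const_smul {φ : Eucl N → ℝ} (c : ℝ) (hφ : ContDiff ℝ 1 φ) :
    gradient (fun x => c * φ x) = fun x => c • gradient φ x := by
  funext x
  refine ext_inner_right ℝ fun v => ?_
  rw [real_inner_smul_left]
  simp_rw [inner_gradient_eq_fderiv]
  rw [fderiv_const_mul (hφ.differentiable one_ne_zero x)]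
  rfl

lemma IsTest.contDiff_one {φ : Eucl N → ℝ} (h : IsTest Ω φ) : ContDiff ℝ 1 φ :=
  h.contDiff.of_le (by exact_mod_cast le_top)

lemma mem_testPairs_iff {w : L2Pair N} :
    w ∈ testPairs Ω ↔ ∃ φ, IsTest Ω φ ∧ w = pairD φ (gradient φ) := by
  constructor
  · rintro ⟨φ, h1, h2, h3, e1, e2⟩
    have ht : IsTest Ω φ := ⟨h1, h2, h3⟩
    refine ⟨φ, ht, L2Pair.ext ?_ ?_⟩
    · exact Lp.ext (e1.trans (coeFn_toLpD (memLp_of_contDiff_one ht.contDiff_one h2)).symm)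
    · exact Lp.ext (e2.trans (coeFn_toLpD (memLp_gradient ht.contDiff_one h2)).symm)
  · rintro ⟨φ, h, rfl⟩
    exact ⟨φ, h.1, h.2, h.3, coeFn_toLpD (memLp_of_contDiff_one h.contDiff_one h.2),
      coeFn_toLpD (memLp_gradient h.contDiff_one h.2)⟩

variable (Ω) in
/-- The test pairs form a subspace. -/
def testSubmodule : Submodule ℝ (L2Pair N) where
  carrier := testPairs Ω
  zero_mem' := ⟨0, contDiff_const, HasCompactSupport.zero, by simp, Lp.coeFn_zero _ _ _, by
    refine (Lp.coeFn_zero _ _ _).trans (ae_of_all _ fun x => ?_)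
    refine ext_inner_right ℝ fun v => ?_
    rw [inner_gradient_eq_fderiv]; simp⟩
  add_mem' := by
    rintro a b ⟨φ, h1, h2, h3, h4, h5⟩ ⟨ψ, k1, k2, k3, k4, k5⟩
    have hφ : ContDiff ℝ 1 φ := h1.of_le (by exact_mod_cast le_top)
    have hψ : ContDiff ℝ 1 ψ := k1.of_le (by exact_mod_cast le_top)
    refine ⟨fun x => φ x + ψ x, h1.add k1, h2.add k2,
      (tsupport_add φ ψ).trans (union_subset h3 k3), ?_, ?_⟩
    · filter_upwards [Lp.coeFn_add a.fst b.fst, h4, k4] with x e1 e2 e3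
      rw [← e2, ← e3]; exact e1
    · rw [gradient_add hφ hψ]
      filter_upwards [Lp.coeFn_add a.snd b.snd, h5, k5] with x e1 e2 e3
      rw [← e2, ← e3]; exact e1
  smul_mem' := by
    rintro c a ⟨φ, h1, h2, h3, h4, h5⟩
    have hφ : ContDiff ℝ 1 φ := h1.of_le (by exact_mod_cast le_top)
    refine ⟨fun x => c * φ x, contDiff_const.mul h1, h2.mul_left,
      (closure_mono (Function.support_mul_subset_right _ _)).trans h3, ?_, ?_⟩
    · filter_upwards [Lp.coeFn_smul c a.fst, h4] with x e1 e2
      rw [← e2]; exact e1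
    · rw [gradient_const_smul c hφ]
      filter_upwards [Lp.coeFn_smul c a.snd, h5] with x e1 e2
      rw [← e2]; exact e1

/-- The span in the definition adds nothing, so every element of `H¹₀(Ω)` is a limit of single test
pairs and closed conditions can be checked on those. -/
lemma coe_H10 : (H10 Ω : Set (L2Pair N)) = closure (testPairs Ω) := by
  rw [H10, Submodule.topologicalClosure_coe]
  congr 1
  exact congrArg _ (Submodule.span_eq (testSubmodule Ω))

lemma IsTest.pairD_mem {φ : Eucl N → ℝ} (h : IsTest Ω φ) : pairD φ (gradient φ) ∈ H10 Ω := by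
  rw [← SetLike.mem_coe, coe_H10]
  exact subset_closure (mem_testPairs_iff.mpr ⟨φ, h, rfl⟩)

lemma isClosed_H10 : IsClosed (H10 Ω : Set (L2Pair N)) := by
  rw [coe_H10]; exact isClosed_closure

/-- A closed condition satisfied by the test functions holds on `H¹₀(Ω)`. -/
lemma H10_induction {P : Set (L2Pair N)} (hP : IsClosed P)
    (h : ∀ φ, IsTest Ω φ → pairD φ (gradient φ) ∈ P) {w : L2Pair N} (hw : w ∈ H10 Ω) : w ∈ P := by
  rw [← SetLike.mem_coe, coe_H10] at hw
  refine closure_minimal (fun z hz => ?_) hP hw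
  obtain ⟨φ, hφ, rfl⟩ := mem_testPairs_iff.mp hz
  exact h φ hφ

lemma inner_pairD (w : L2Pair N) {a : Eucl N → ℝ} {b : Eucl N → Eucl N} (ha : MemLp a 2 volume)
    (hb : MemLp b 2 volume) : ⟪w, pairD a b⟫_ℝ
      = (∫ x, (w.fst : Eucl N → ℝ) x * a x) + ∫ x, ⟪(w.snd : Eucl N → Eucl N) x, b x⟫_ℝ := by
  rw [inner_L2Pair]
  congr 1
  · refine integral_congr_ae ?_
    filter_upwards [coeFn_toLpD ha] with x hx
    rw [pairD_fst, hx]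
  · refine integral_congr_ae ?_
    filter_upwards [coeFn_toLpD hb] with x hx
    rw [pairD_snd, hx]

/-- Being a pair `(u, ∇u)` is a family of orthogonality relations, hence a closed condition in `L² ×
L²`. -/
lemma isWeakGradient_coe_iff (w : L2Pair N) : IsWeakGradient (w.fst : Eucl N → ℝ) w.snd ↔
    ∀ φ : Eucl N → ℝ, ContDiff ℝ ∞ φ → HasCompactSupport φ → ∀ v : Eucl N,
      ⟪w, pairD (fun x => ⟪gradient φ x, v⟫_ℝ) (fun x => φ x • v)⟫_ℝ = 0 := by
  rw [isWeakGradient_iff ((Lp.memLp w.fst).locallyIntegrable one_le_two)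
    ((Lp.memLp w.snd).locallyIntegrable one_le_two)]
  refine forall₄_congr fun φ hφ hc v => ?_
  have hφ1 : ContDiff ℝ 1 φ := hφ.of_le (by exact_mod_cast le_top)
  have hb : MemLp (fun x => φ x • v) 2 volume :=
    (hφ.continuous.smul continuous_const).memLp_of_hasCompactSupport hc.smul_right
  rw [inner_pairD w ((memLp_gradient hφ1 hc).inner_const v) hb,
    ← add_eq_zero_iff_eq_neg]
  simp_rw [real_inner_smul_right]

lemma isWeakGradient_of_mem_H10 {w : L2Pair N} (hw : w ∈ H10 Ω) :
    IsWeakGradient (w.fst : Eucl N → ℝ) w.snd := by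
  refine H10_induction (P := {w | IsWeakGradient (w.fst : Eucl N → ℝ) w.snd}) ?_ ?_ hw
  · have : {w : L2Pair N | IsWeakGradient (w.fst : Eucl N → ℝ) w.snd}
        = ⋂ (φ : Eucl N → ℝ) (_ : ContDiff ℝ ∞ φ) (_ : HasCompactSupport φ) (v : Eucl N),
          {w | ⟪w, pairD (fun x => ⟪gradient φ x, v⟫_ℝ) (fun x => φ x • v)⟫_ℝ = 0} := by
      ext w
      simpa using isWeakGradient_coe_iff w
    rw [this]
    exact isClosed_iInter fun φ => isClosed_iInter fun _ => isClosed_iInter fun _ =>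
      isClosed_iInter fun v => isClosed_eq (by fun_prop) continuous_const
  · intro φ hφ
    exact (isWeakGradient_of_contDiff hφ.contDiff_one).congr
      (coeFn_toLpD (memLp_of_contDiff_one hφ.contDiff_one hφ.2)).symm
      (coeFn_toLpD (memLp_gradient hφ.contDiff_one hφ.2)).symm

lemma MemH1.of_mem_H10 {w : L2Pair N} (hw : w ∈ H10 Ω) {u : Eucl N → ℝ}
    (hu : w.fst =ᵐ[volume] u) : MemH1 u :=
  ⟨(memLp_congr_ae hu).mp (Lp.memLp w.fst), w.snd, Lp.memLp w.snd,
    (isWeakGradient_of_mem_H10 hw).congr hu (ae_eq_refl _)⟩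

lemma weakGrad_ae_eq_of_mem_H10 {w : L2Pair N} (hw : w ∈ H10 Ω) {u : Eucl N → ℝ}
    (hu : w.fst =ᵐ[volume] u) : weakGrad u =ᵐ[volume] w.snd :=
  ((isWeakGradient_of_mem_H10 hw).congr hu (ae_eq_refl _)).weakGrad_ae_eq

lemma memLp_indicator_one {S : Set (Eucl N)} (hS : MeasurableSet S) {F : Type*}
    [NormedAddCommGroup F] (c : F) : MemLp (S.indicator fun _ => c) ∞ volume :=
  (memLp_top_const c).indicator hS

/-- Multiplication by the indicator of the complement of `Ω` is a bounded operator that kills every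
test pair, hence the whole closure. -/
lemma ae_eq_zero_of_mem_H10 (hΩ : IsOpen Ω) {w : L2Pair N} (hw : w ∈ H10 Ω) :
    ∀ᵐ x, x ∉ Ω → (w.fst : Eucl N → ℝ) x = 0 ∧ (w.snd : Eucl N → Eucl N) x = 0 := by
  have hm : MeasurableSet Ωᶜ := hΩ.measurableSet.compl
  set Q : L2Pair N →L[ℝ] L2Pair N := pairOp (Ωᶜ.indicator fun _ => 1)
    (Ωᶜ.indicator fun _ => ContinuousLinearMap.id ℝ (Eucl N)) with hQ
  have hfst := fun w => coeFn_pairOp_fst (b := Ωᶜ.indicator fun _ =>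
    ContinuousLinearMap.id ℝ (Eucl N)) (memLp_indicator_one hm (1 : ℝ)) w
  have hsnd := fun w => coeFn_pairOp_snd (a := Ωᶜ.indicator fun _ => (1 : ℝ))
    (memLp_indicator_one hm (ContinuousLinearMap.id ℝ (Eucl N))) w
  have h0 : w ∈ {w | Q w = 0} := by
    refine H10_induction (isClosed_eq Q.continuous continuous_const) (fun φ hφ => ?_) hw
    show Q _ = 0
    refine L2Pair.ext (Lp.ext ?_) (Lp.ext ?_)
    · filter_upwards [hfst (pairD φ (gradient φ)), Lp.coeFn_zero ℝ 2 (volume : Measure (Eucl N)),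
        coeFn_toLpD (memLp_of_contDiff_one hφ.contDiff_one hφ.2 (p := 2))] with x h1 h2 h3
      refine h1.trans (Eq.trans ?_ h2.symm)
      rw [pairD_fst, h3]
      by_cases hx : x ∈ Ω
      · simp [hx]
      · rw [image_eq_zero_of_notMem_tsupport fun h => hx (hφ.3 h)]; simp
    · filter_upwards [hsnd (pairD φ (gradient φ)),
        Lp.coeFn_zero (Eucl N) 2 (volume : Measure (Eucl N)),
        coeFn_toLpD (memLp_gradient hφ.contDiff_one hφ.2 (p := 2))] with x h1 h2 h3
      refine h1.trans (Eq.trans ?_ h2.symm)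
      rw [pairD_snd, h3]
      by_cases hx : x ∈ Ω
      · simp [hx]
      · have : gradient φ x = 0 := by
          rw [gradient, fderiv_of_notMem_tsupport (𝕜 := ℝ) fun h => hx (hφ.3 h), map_zero]
        rw [this]; simp
  have h0 : Q w = 0 := h0
  filter_upwards [hfst w, hsnd w, Lp.coeFn_zero ℝ 2 (volume : Measure (Eucl N)),
    Lp.coeFn_zero (Eucl N) 2 (volume : Measure (Eucl N))] with x h1 h2 h3 h4 hx
  rw [← hQ, h0] at h1 h2
  constructor
  · have := h1.symm.trans h3; simpa [hx] using this
  · have := h2.symm.trans h4; simpa [hx] using this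

lemma norm_pairD_sub_le {u u' : Eucl N → ℝ} {g g' : Eucl N → Eucl N} (hu : MemLp u 2 volume)
    (hu' : MemLp u' 2 volume) (hg : MemLp g 2 volume) (hg' : MemLp g' 2 volume) {ε : ℝ}
    (hε : 0 ≤ ε) (h1 : eLpNorm (fun x => u' x - u x) 2 volume ≤ ENNReal.ofReal ε)
    (h2 : eLpNorm (fun x => g' x - g x) 2 volume ≤ ENNReal.ofReal ε) :
    ‖pairD u g - pairD u' g'‖ ≤ 2 * ε := by
  rw [norm_sub_rev]
  refine (norm_L2Pair_le _).trans ?_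
  have e1 : ‖(pairD u' g' - pairD u g).fst‖ ≤ ε := by
    change ‖toLpD volume 2 u' - toLpD volume 2 u‖ ≤ ε
    rw [toLpD_eq hu, toLpD_eq hu', ← MemLp.toLp_sub, Lp.norm_toLp]
    exact ENNReal.toReal_le_of_le_ofReal hε h1
  have e2 : ‖(pairD u' g' - pairD u g).snd‖ ≤ ε := by
    change ‖toLpD volume 2 g' - toLpD volume 2 g‖ ≤ ε
    rw [toLpD_eq hg, toLpD_eq hg', ← MemLp.toLp_sub, Lp.norm_toLp]
    exact ENNReal.toReal_le_of_le_ofReal hε h2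
  linarith

lemma mem_H10_of_forall_approx {w : L2Pair N}
    (h : ∀ ε > 0, ∃ z ∈ H10 Ω, ‖w - z‖ ≤ ε) : w ∈ H10 Ω := by
  rw [← SetLike.mem_coe, ← isClosed_H10.closure_eq, Metric.mem_closure_iff]
  intro ε hε
  obtain ⟨z, hz, hle⟩ := h (ε / 2) (half_pos hε)
  exact ⟨z, hz, by rw [dist_eq_norm]; linarith⟩

/-- `C¹` functions with compact support in `Ω` are in `H¹₀(Ω)`. -/
lemma pairD_mem_H10_of_contDiff_one (hΩ : IsOpen Ω) {φ : Eucl N → ℝ} (hφ : ContDiff ℝ 1 φ)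
    (hc : HasCompactSupport φ) (hs : tsupport φ ⊆ Ω) : pairD φ (gradient φ) ∈ H10 Ω := by
  refine mem_H10_of_forall_approx fun ε hε => ?_
  -- Mollifying enlarges the support by less than `δ`, so the approximants remain test functions in
  -- `Ω`.
  obtain ⟨δ, hδ, hsub⟩ := hc.isCompact.exists_cthickening_subset_open hΩ hs
  have hm := memLp_of_contDiff_one hφ hc (p := 2)
  have hg := memLp_gradient hφ hc (p := 2)
  obtain ⟨ψ, h1, h2, h3, h4⟩ := exists_smooth_approx (isWeakGradient_of_contDiff hφ) hm hg hδ
    (half_pos hε)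
  have hts : tsupport ψ ⊆ Metric.cthickening δ (tsupport φ) := by
    refine closure_minimal (h2.trans ?_) Metric.isClosed_cthickening
    exact (Metric.thickening_subset_cthickening _ _).trans
      (Metric.cthickening_subset_of_subset _ subset_closure)
  have hψ : IsTest Ω ψ := ⟨h1, (hc.isCompact.cthickening).of_isClosed_subset
    (isClosed_tsupport ψ) hts, hts.trans hsub⟩
  refine ⟨_, hψ.pairD_mem, ?_⟩
  have := norm_pairD_sub_le hm (memLp_of_contDiff_one hψ.contDiff_one hψ.2) hg
    (memLp_gradient hψ.contDiff_one hψ.2) (half_pos hε).le h3 h4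
  linarith

/-- A cutoff function, equal to `1` on the unit ball. -/
def cutoff (N : ℕ) : ContDiffBump (0 : Eucl N) := ⟨1, 2, one_pos, one_lt_two⟩

/-- Compare with a compactly supported `g` close to `h`. For large `n` the cutoff is `1` on the
support of `g`, so there is no error there; elsewhere the error is at most `‖h‖ = ‖h - g‖`. -/
lemma exists_cutoff_approx {F : Type*} [NormedAddCommGroup F] [NormedSpace ℝ F]
    {h : Eucl N → F} (hh : MemLp h 2 volume) {ε : ℝ} (hε : 0 < ε) :
    ∀ᶠ n : ℕ in atTop, eLpNorm (fun x => cutoff N ((n : ℝ)⁻¹ • x) • h x - h x) 2 volume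
      ≤ ENNReal.ofReal ε := by
  obtain ⟨g, hgc, hgε, -, hgm⟩ := hh.exists_hasCompactSupport_eLpNorm_sub_le (by simp)
    (ε := ENNReal.ofReal ε) (by simpa using hε)
  obtain ⟨R, hR⟩ := hgc.isCompact.isBounded.subset_closedBall (0 : Eucl N)
  obtain ⟨n₀, hn₀⟩ := exists_nat_gt (max R 0)
  filter_upwards [eventually_ge_atTop n₀] with n hn
  have hn' : max R 0 < n := hn₀.trans_le (by exact_mod_cast hn)
  refine le_trans (eLpNorm_mono fun x => ?_) hgε
  have hn0 : (0 : ℝ) < n := (le_max_right _ _).trans_lt hn'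
  rw [Pi.sub_apply]
  by_cases hx : x ∈ tsupport g
  · have hx1 : (n : ℝ)⁻¹ • x ∈ Metric.closedBall (0 : Eucl N) (cutoff N).rIn := by
      have := hR hx
      rw [mem_closedBall_zero_iff] at this ⊢
      rw [norm_smul, norm_inv, Real.norm_of_nonneg hn0.le, inv_mul_le_iff₀ hn0]
      change ‖x‖ ≤ n * 1
      linarith [le_max_left R 0]
    rw [(cutoff N).one_of_mem_closedBall hx1]; simp
  · rw [image_eq_zero_of_notMem_tsupport hx, sub_zero]
    have h1 := (cutoff N).nonneg (x := (n : ℝ)⁻¹ • x)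
    have h2 := (cutoff N).le_one (x := (n : ℝ)⁻¹ • x)
    have : cutoff N ((n : ℝ)⁻¹ • x) • h x - h x = (cutoff N ((n : ℝ)⁻¹ • x) - 1) • h x := by
      rw [sub_smul, one_smul]
    rw [this, norm_smul]
    refine mul_le_of_le_one_left (norm_nonneg _) ?_
    rw [Real.norm_eq_abs, abs_le]; constructor <;> linarith

/-- Multiply by cutoffs dilated by `n`: their gradients are of size `1/n`, so the extra term `φ ∇χ`
disappears in `L²`. -/
lemma pairD_mem_H10_univ_of_contDiff {φ : Eucl N → ℝ} (hφ : ContDiff ℝ 1 φ)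
    (hm : MemLp φ 2 volume) (hg : MemLp (gradient φ) 2 volume) :
    pairD φ (gradient φ) ∈ H10 (univ : Set (Eucl N)) := by
  refine mem_H10_of_forall_approx fun ε hε => ?_
  have hχ : ContDiff ℝ 1 (cutoff N) := (cutoff N).contDiff
  obtain ⟨C, hC⟩ := (continuous_gradient hχ).bounded_above_of_compact_support
    (hasCompactSupport_gradient (cutoff N).hasCompactSupport)
  have hC0 : 0 ≤ C := (norm_nonneg _).trans (hC 0)
  set A := (eLpNorm φ 2 volume).toReal with hA
  have hA0 : 0 ≤ A := ENNReal.toReal_nonneg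
  have hAe : eLpNorm φ 2 volume = ENNReal.ofReal A := (ENNReal.ofReal_toReal hm.2.ne).symm
  have hlim : ∀ᶠ n : ℕ in atTop, (n : ℝ)⁻¹ * (C * A) ≤ ε / 4 := by
    have : Tendsto (fun n : ℕ => (n : ℝ)⁻¹ * (C * A)) atTop (𝓝 (0 * (C * A))) :=
      tendsto_inv_atTop_nhds_zero_nat.mul_const _
    rw [zero_mul] at this
    filter_upwards [this.eventually (gt_mem_nhds (show (0 : ℝ) < ε / 4 by positivity))] with n hn
    exact hn.le
  obtain ⟨n, h1, h2, h3, hn⟩ := ((exists_cutoff_approx hm (show (0 : ℝ) < ε / 2 by positivity)).and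
    ((exists_cutoff_approx hg (show (0 : ℝ) < ε / 4 by positivity)).and
      (hlim.and (eventually_gt_atTop 0)))).exists
  have hn0 : (0 : ℝ) < n := by exact_mod_cast hn
  set χ : Eucl N → ℝ := fun x => cutoff N ((n : ℝ)⁻¹ • x) with hχdef
  have hχn : ContDiff ℝ 1 χ := hχ.comp (contDiff_const_smul _)
  have hχc : HasCompactSupport χ :=
    (cutoff N).hasCompactSupport.comp_homeomorph (Homeomorph.smulOfNeZero (n : ℝ)⁻¹ (by positivity))
  have hgχ : ∀ x, gradient χ x = (n : ℝ)⁻¹ • gradient (cutoff N) ((n : ℝ)⁻¹ • x) := by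
    intro x
    refine ext_inner_right ℝ fun v => ?_
    rw [real_inner_smul_left, inner_gradient_eq_fderiv, inner_gradient_eq_fderiv]
    have hd : HasFDerivAt (fun x : Eucl N => (n : ℝ)⁻¹ • x)
        ((n : ℝ)⁻¹ • ContinuousLinearMap.id ℝ (Eucl N)) x :=
      ((n : ℝ)⁻¹ • ContinuousLinearMap.id ℝ (Eucl N)).hasFDerivAt
    have e : fderiv ℝ χ x = _ :=
      (((hχ.differentiable one_ne_zero _).hasFDerivAt).comp x hd).fderiv
    rw [e]
    simp
  have hpc : HasCompactSupport fun x => χ x * φ x := hχc.mul_right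
  have hpd : ContDiff ℝ 1 fun x => χ x * φ x := hχn.mul hφ
  refine ⟨_, pairD_mem_H10_of_contDiff_one isOpen_univ hpd hpc (subset_univ _), ?_⟩
  have hbd : eLpNorm (fun x => φ x • gradient χ x) 2 volume ≤ ENNReal.ofReal (ε / 4) := by
    calc _ ≤ eLpNorm (((n : ℝ)⁻¹ * C) • φ) 2 volume := by
          refine eLpNorm_mono fun x => ?_
          rw [hgχ, norm_smul, norm_smul, Pi.smul_apply, norm_smul, norm_inv, Real.norm_natCast,
            Real.norm_of_nonneg (by positivity : 0 ≤ (n : ℝ)⁻¹ * C), mul_comm ‖φ x‖]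
          gcongr
          exact hC _
      _ ≤ _ := by
          rw [eLpNorm_const_smul, hAe, Real.enorm_of_nonneg (by positivity),
            ← ENNReal.ofReal_mul (by positivity)]
          exact ENNReal.ofReal_le_ofReal (by linarith [h3])
  have h5 : eLpNorm (fun x => gradient (fun x => χ x * φ x) x - gradient φ x) 2 volume
      ≤ ENNReal.ofReal (ε / 2) := by
    rw [gradient_mul hχn hφ]
    have e : (fun x => χ x • gradient φ x + φ x • gradient χ x - gradient φ x)
        = (fun x => χ x • gradient φ x - gradient φ x) + fun x => φ x • gradient χ x := by
      funext x; simp only [Pi.add_apply]; abel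
    have hcg := continuous_gradient hφ
    have hcχ := continuous_gradient hχn
    have hc1 := hφ.continuous
    have hc2 := hχn.continuous
    rw [e]
    refine (eLpNorm_add_le (by fun_prop) (by fun_prop) one_le_two).trans ?_
    refine (add_le_add h2 hbd).trans ?_
    rw [← ENNReal.ofReal_add (by positivity) (by positivity)]
    exact ENNReal.ofReal_le_ofReal (by linarith)
  have := norm_pairD_sub_le hm (memLp_of_contDiff_one hpd hpc) hg
    (memLp_gradient hpd hpc) (half_pos hε).le h1 h5
  linarith

/-- `H¹₀(ℝ^N) = H¹(ℝ^N)`. -/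
lemma IsWeakGradient.pairD_mem_H10 {u : Eucl N → ℝ} {g : Eucl N → Eucl N}
    (h : IsWeakGradient u g) (hu : MemLp u 2 volume) (hg : MemLp g 2 volume) :
    pairD u g ∈ H10 (univ : Set (Eucl N)) := by
  refine mem_H10_of_forall_approx fun ε hε => ?_
  obtain ⟨ψ, h1, -, h3, h4⟩ := exists_smooth_approx h hu hg one_pos (half_pos hε)
  have hψ : ContDiff ℝ 1 ψ := h1.of_le (by exact_mod_cast le_top)
  have m1 : MemLp ψ 2 volume := by
    have : MemLp (fun x => ψ x - u x) 2 volume :=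
      ⟨h1.continuous.aestronglyMeasurable.sub hu.1, h3.trans_lt ENNReal.ofReal_lt_top⟩
    exact (memLp_congr_ae (ae_of_all _ fun x => by simp)).mp (this.add hu)
  have m2 : MemLp (gradient ψ) 2 volume := by
    have : MemLp (fun x => gradient ψ x - g x) 2 volume :=
      ⟨(continuous_gradient hψ).aestronglyMeasurable.sub hg.1, h4.trans_lt ENNReal.ofReal_lt_top⟩
    exact (memLp_congr_ae (ae_of_all _ fun x => by simp)).mp (this.add hg)
  refine ⟨_, pairD_mem_H10_univ_of_contDiff hψ m1 m2, ?_⟩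
  have := norm_pairD_sub_le hu m1 hg m2 (half_pos hε).le h3 h4
  linarith

lemma MemH1.pairD_mem_H10 {u : Eucl N → ℝ} (h : MemH1 u) :
    pairD u (weakGrad u) ∈ H10 (univ : Set (Eucl N)) :=
  h.isWeakGradient.pairD_mem_H10 h.1 h.memLp_weakGrad

end SobolevSpaces

/-! ### Composition with diffeomorphisms -/

section Composition

open scoped ENNReal NNReal

variable {N : ℕ} {Ω : Set (Eucl N)} {F : Type*} [NormedAddCommGroup F] [NormedSpace ℝ F]

/-- Composition with `P` on `L²(ℝ^N)`. -/
def compLp (P : Eucl N → Eucl N) (hP : AntilipschitzWith 2 P) (hc : Continuous P) :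
    Lp F 2 (volume : Measure (Eucl N)) →L[ℝ] Lp F 2 (volume : Measure (Eucl N)) :=
  LinearMap.mkContinuous
    { toFun := fun w => toLpD volume 2 fun x => w (P x)
      map_add' := fun w z => by
        have hq := quasiMeasurePreserving_of_antilipschitz hP hc.measurable
        refine Lp.ext ?_
        filter_upwards [coeFn_toLpD (memLp_comp hP hc.measurable (Lp.memLp (w + z))),
          coeFn_toLpD (memLp_comp hP hc.measurable (Lp.memLp w)),
          coeFn_toLpD (memLp_comp hP hc.measurable (Lp.memLp z)),
          Lp.coeFn_add (toLpD volume 2 fun x => w (P x)) (toLpD volume 2 fun x => z (P x)),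
          hq.ae (Lp.coeFn_add w z)] with x h1 h2 h3 h4 h5
        rw [h1, h4, Pi.add_apply, h2, h3, h5, Pi.add_apply]
      map_smul' := fun c w => by
        have hq := quasiMeasurePreserving_of_antilipschitz hP hc.measurable
        refine Lp.ext ?_
        filter_upwards [coeFn_toLpD (memLp_comp hP hc.measurable (Lp.memLp (c • w))),
          coeFn_toLpD (memLp_comp hP hc.measurable (Lp.memLp w)),
          Lp.coeFn_smul c (toLpD volume 2 fun x => w (P x)),
          hq.ae (Lp.coeFn_smul c w)] with x h1 h2 h4 h5
        rw [h1, RingHom.id_apply, h4, Pi.smul_apply, h2, h5, Pi.smul_apply] }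
    (2 ^ N) fun w => by
      refine norm_toLpD_le_of_eLpNorm_le (memLp_comp hP hc.measurable (Lp.memLp w))
        (by positivity) ?_
      refine (eLpNorm_comp_le hP hc.measurable (Lp.memLp w).1).trans ?_
      rw [ENNReal.ofReal_mul (by positivity), Lp.norm_def, ENNReal.ofReal_toReal (Lp.memLp w).2.ne,
        ENNReal.ofReal_pow (by norm_num), ENNReal.ofReal_ofNat]

lemma coeFn_compLp {P : Eucl N → Eucl N} (hP : AntilipschitzWith 2 P) (hc : Continuous P)
    (w : Lp F 2 (volume : Measure (Eucl N))) : compLp P hP hc w =ᵐ[volume] fun x => w (P x) :=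
  coeFn_toLpD (memLp_comp hP hc.measurable (Lp.memLp w))

lemma compLp_toLpD {P : Eucl N → Eucl N} (hP : AntilipschitzWith 2 P) (hc : Continuous P)
    {f : Eucl N → F} (hf : MemLp f 2 volume) :
    compLp P hP hc (toLpD volume 2 f) = toLpD volume 2 fun x => f (P x) := by
  have hq := quasiMeasurePreserving_of_antilipschitz hP hc.measurable
  refine Lp.ext ?_
  filter_upwards [coeFn_compLp hP hc (toLpD volume 2 f),
    coeFn_toLpD (memLp_comp hP hc.measurable hf), hq.ae (coeFn_toLpD hf)] with x h1 h2 h3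
  rw [h1, h2, h3]

lemma memLp_top_of_continuous {A : Type*} [NormedAddCommGroup A] {b : Eucl N → A}
    (hb : Continuous b) {C : ℝ} (hC : ∀ x, ‖b x‖ ≤ C) : MemLp b ∞ volume :=
  memLp_top_of_bound hb.aestronglyMeasurable C (ae_of_all _ hC)

lemma continuous_adjoint_fderiv {P : Eucl N → Eucl N} (hP : ContDiff ℝ 1 P) :
    Continuous fun x => ContinuousLinearMap.adjoint (fderiv ℝ P x) :=
  ContinuousLinearMap.adjoint.continuous.comp (hP.continuous_fderiv one_ne_zero)

lemma memLp_adjoint_fderiv {P : Eucl N → Eucl N} (hP : ContDiff ℝ 1 P) {K : ℝ≥0}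
    (hl : LipschitzWith K P) :
    MemLp (fun x => ContinuousLinearMap.adjoint (fderiv ℝ P x)) ∞ volume :=
  memLp_top_of_continuous (continuous_adjoint_fderiv hP) (C := K) fun x => by
    rw [LinearIsometryEquiv.norm_map]
    exact norm_fderiv_le_of_lipschitz ℝ hl

/-- Composition with `P` on pairs `(u, ∇u)`. -/
def compOp (P : Eucl N → Eucl N) (hP : AntilipschitzWith 2 P) (hc : Continuous P) :
    L2Pair N →L[ℝ] L2Pair N :=
  diagOp (compLp P hP hc)
    (mulOp volume (ContinuousLinearMap.id ℝ (Eucl N →L[ℝ] Eucl N))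
      (fun x => ContinuousLinearMap.adjoint (fderiv ℝ P x)) ∘L compLp P hP hc)

lemma coeFn_compOp_fst {P : Eucl N → Eucl N} (hP : AntilipschitzWith 2 P) (hc : Continuous P)
    (w : L2Pair N) :
    (compOp P hP hc w).fst =ᵐ[volume] fun x => (w.fst : Eucl N → ℝ) (P x) := by
  rw [compOp, diagOp_fst]; exact coeFn_compLp hP hc _

lemma coeFn_compOp_snd {P : Eucl N → Eucl N} (hP : AntilipschitzWith 2 P) (hd : ContDiff ℝ 1 P)
    {K : ℝ≥0} (hl : LipschitzWith K P) (w : L2Pair N) :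
    (compOp P hP hd.continuous w).snd =ᵐ[volume]
      fun x => ContinuousLinearMap.adjoint (fderiv ℝ P x) ((w.snd : Eucl N → Eucl N) (P x)) := by
  rw [compOp, diagOp_snd, ContinuousLinearMap.comp_apply]
  filter_upwards [coeFn_mulOp (ContinuousLinearMap.id ℝ (Eucl N →L[ℝ] Eucl N))
    (memLp_adjoint_fderiv hd hl) (compLp P hP hd.continuous w.snd),
    coeFn_compLp hP hd.continuous w.snd] with x h1 h2
  rw [h1, h2]; rfl

lemma gradient_comp {P : Eucl N → Eucl N} (hP : ContDiff ℝ 1 P) {φ : Eucl N → ℝ}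
    (hφ : ContDiff ℝ 1 φ) : gradient (fun x => φ (P x))
      = fun x => ContinuousLinearMap.adjoint (fderiv ℝ P x) (gradient φ (P x)) := by
  funext x
  refine ext_inner_right ℝ fun v => ?_
  rw [inner_gradient_eq_fderiv, ContinuousLinearMap.adjoint_inner_left, inner_gradient_eq_fderiv]
  have e : fderiv ℝ (fun x => φ (P x)) x = _ :=
    ((hφ.differentiable one_ne_zero (P x)).hasFDerivAt.comp x
      (hP.differentiable one_ne_zero x).hasFDerivAt).fderiv
  rw [e]; rfl

lemma compOp_pairD_of_memLp {P : Eucl N → Eucl N} (hP : AntilipschitzWith 2 P)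
    (hd : ContDiff ℝ 1 P) {K : ℝ≥0} (hl : LipschitzWith K P) {u : Eucl N → ℝ}
    {g : Eucl N → Eucl N} (hu : MemLp u 2 volume) (hg : MemLp g 2 volume) :
    compOp P hP hd.continuous (pairD u g)
      = pairD (fun x => u (P x)) fun x => ContinuousLinearMap.adjoint (fderiv ℝ P x) (g (P x)) := by
  refine L2Pair.ext ?_ ?_
  · rw [compOp, diagOp_fst, pairD_fst, pairD_fst, compLp_toLpD _ _ hu]
  · rw [compOp, diagOp_snd, pairD_snd, pairD_snd, ContinuousLinearMap.comp_apply,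
      compLp_toLpD _ _ hg, mulOp_toLpD _ (memLp_adjoint_fderiv hd hl)
        (memLp_comp hP hd.continuous.measurable hg)]
    rfl

lemma compOp_pairD {P : Eucl N → Eucl N} (hP : AntilipschitzWith 2 P) (hd : ContDiff ℝ 1 P)
    {K : ℝ≥0} (hl : LipschitzWith K P) {φ : Eucl N → ℝ} (hφ : ContDiff ℝ 1 φ)
    (hc : HasCompactSupport φ) : compOp P hP hd.continuous (pairD φ (gradient φ))
      = pairD (fun x => φ (P x)) (gradient fun x => φ (P x)) := by
  rw [compOp_pairD_of_memLp hP hd hl (memLp_of_contDiff_one hφ hc) (memLp_gradient hφ hc),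
    gradient_comp hd hφ]

/-- Composition with the diffeomorphism `e` maps `H¹₀(e(Ω))` to `H¹₀(Ω)`. -/
lemma compOp_mem_H10 (e : Eucl N ≃ₜ Eucl N) (hP : AntilipschitzWith 2 e) (hd : ContDiff ℝ 1 e)
    {K : ℝ≥0} (hl : LipschitzWith K e) (hΩ : IsOpen Ω) {w : L2Pair N} (hw : w ∈ H10 (e '' Ω)) :
    compOp e hP hd.continuous w ∈ H10 Ω := by
  refine H10_induction (P := {w | compOp e hP hd.continuous w ∈ H10 Ω})
    (isClosed_H10.preimage (compOp e hP hd.continuous).continuous) (fun φ hφ => ?_) hw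
  show compOp e hP hd.continuous _ ∈ H10 Ω
  rw [compOp_pairD hP hd hl hφ.contDiff_one hφ.2]
  -- The composition `φ ∘ e` is only `C¹`, hence not itself a test function.
  refine pairD_mem_H10_of_contDiff_one hΩ (hφ.contDiff_one.comp hd)
    (hφ.2.comp_homeomorph e) ?_
  change tsupport (φ ∘ e) ⊆ Ω
  rw [tsupport_comp_eq_preimage]
  intro x hx
  obtain ⟨y, hy, hyx⟩ := hφ.3 hx
  rwa [← e.injective hyx]

/-- `C¹` maps which differ from the identity by a contraction. -/
structure NearId (P : Eucl N → Eucl N) : Prop where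
  contDiff : ContDiff ℝ 1 P
  lip : ∀ x y, ‖(P x - x) - (P y - y)‖ ≤ 1 / 4 * ‖x - y‖

namespace NearId

variable {P : Eucl N → Eucl N}

/-- The perturbation is a contraction with constant at most `1/4`, so distances shrink at most by
the factor `3/4 ≥ 1/2`. All interpolations between the identity and `P` are needed in order to
integrate along the segments from `x` to `P x`. -/
lemma antilipschitz_segment (h : NearId P) {θ : ℝ} (hθ : θ ∈ Icc (0 : ℝ) 1) :
    AntilipschitzWith 2 fun x => x + θ • (P x - x) := by
  refine AntilipschitzWith.of_le_mul_dist fun x y => ?_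
  rw [dist_eq_norm, dist_eq_norm]
  have h1 : ‖θ • ((P x - x) - (P y - y))‖ ≤ 1 / 4 * ‖x - y‖ := by
    rw [norm_smul, Real.norm_of_nonneg hθ.1]
    exact (mul_le_of_le_one_left (norm_nonneg _) hθ.2).trans (h.lip x y)
  have h2 : x - y = (x + θ • (P x - x) - (y + θ • (P y - y)))
      - θ • ((P x - x) - (P y - y)) := by rw [smul_sub θ (P x - x)]; abel
  have h3 := norm_sub_le (x + θ • (P x - x) - (y + θ • (P y - y))) (θ • ((P x - x) - (P y - y)))
  rw [← h2] at h3
  push_cast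
  linarith [norm_nonneg (x - y)]

lemma antilipschitz (h : NearId P) : AntilipschitzWith 2 P := by
  simpa using h.antilipschitz_segment (θ := 1) (by simp)

lemma lipschitz (h : NearId P) : LipschitzWith 2 P := by
  refine LipschitzWith.of_dist_le_mul fun x y => ?_
  rw [dist_eq_norm, dist_eq_norm]
  have h3 := norm_add_le ((P x - x) - (P y - y)) (x - y)
  have h2 : (P x - x) - (P y - y) + (x - y) = P x - P y := by abel
  rw [h2] at h3
  push_cast
  linarith [h.lip x y, norm_nonneg (x - y)]

lemma approximatesLinearOn (h : NearId P) : ApproximatesLinearOn P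
    ((ContinuousLinearEquiv.refl ℝ (Eucl N) : Eucl N ≃L[ℝ] Eucl N) : Eucl N →L[ℝ] Eucl N) univ
    (1 / 4 : ℝ≥0) := by
  intro x _ y _
  have h2 := h.lip x y
  have e : P x - P y - ((ContinuousLinearEquiv.refl ℝ (Eucl N) : Eucl N ≃L[ℝ] Eucl N) :
    Eucl N →L[ℝ] Eucl N) (x - y) = (P x - x) - (P y - y) := by
    simp; abel
  rw [e]
  simpa using h2

/-- The first alternative is dimension zero, where the identity has norm `0`. -/
lemma lt_inv_norm : Subsingleton (Eucl N) ∨ (1 / 4 : ℝ≥0)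
    < ‖(((ContinuousLinearEquiv.refl ℝ (Eucl N)).symm : Eucl N ≃L[ℝ] Eucl N) :
      Eucl N →L[ℝ] Eucl N)‖₊⁻¹ := by
  rcases subsingleton_or_nontrivial (Eucl N) with hs | hs
  · exact Or.inl hs
  · right
    have : ‖(((ContinuousLinearEquiv.refl ℝ (Eucl N)).symm : Eucl N ≃L[ℝ] Eucl N) :
      Eucl N →L[ℝ] Eucl N)‖₊ = 1 := by
      rw [ContinuousLinearEquiv.refl_symm, ContinuousLinearEquiv.coe_refl]
      exact Subtype.ext ContinuousLinearMap.norm_id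
    rw [this, inv_one, ← NNReal.coe_lt_coe]
    push_cast
    norm_num

/-- A map close to the identity, as a homeomorphism. -/
def toHomeo (h : NearId P) : Eucl N ≃ₜ Eucl N :=
  h.approximatesLinearOn.toHomeomorph P lt_inv_norm

lemma norm_fderiv_sub_le (h : NearId P) (x v : Eucl N) :
    ‖fderiv ℝ P x v - v‖ ≤ 1 / 4 * ‖v‖ := by
  have hd := h.contDiff.differentiable one_ne_zero x
  have hl : LipschitzWith (1 / 4 : ℝ≥0) fun x => P x - x :=
    LipschitzWith.of_dist_le_mul fun x y => by
      rw [dist_eq_norm, dist_eq_norm]; simpa using h.lip x y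
  have h1 := norm_fderiv_le_of_lipschitz ℝ (x₀ := x) hl
  rw [fderiv_fun_sub hd differentiableAt_fun_id, fderiv_fun_id] at h1
  have := (fderiv ℝ P x - ContinuousLinearMap.id ℝ (Eucl N)).le_of_opNorm_le h1 v
  simpa using this

lemma injective_fderiv (h : NearId P) (x : Eucl N) : Function.Injective (fderiv ℝ P x) := by
  rw [injective_iff_map_eq_zero]
  intro v hv
  have := h.norm_fderiv_sub_le x v
  rw [hv, zero_sub, norm_neg] at this
  exact norm_le_zero_iff.mp (by linarith [norm_nonneg v])

/-- The derivative of a map close to the identity, as an isomorphism. -/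
def fderivEquiv (h : NearId P) (x : Eucl N) : Eucl N ≃L[ℝ] Eucl N :=
  (LinearEquiv.ofInjectiveEndo (fderiv ℝ P x : Eucl N →ₗ[ℝ] Eucl N)
    (h.injective_fderiv x)).toContinuousLinearEquiv

lemma contDiff_symm (h : NearId P) : ContDiff ℝ 1 h.toHomeo.symm :=
  h.toHomeo.contDiff_symm (f₀' := h.fderivEquiv)
    (fun x => (h.contDiff.differentiable one_ne_zero x).hasFDerivAt) h.contDiff

lemma antilipschitz_symm (h : NearId P) : AntilipschitzWith 2 h.toHomeo.symm :=
  AntilipschitzWith.of_le_mul_dist fun x y => by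
    have := h.lipschitz.dist_le_mul (h.toHomeo.symm x) (h.toHomeo.symm y)
    rwa [show P (h.toHomeo.symm x) = x from h.toHomeo.apply_symm_apply x,
      show P (h.toHomeo.symm y) = y from h.toHomeo.apply_symm_apply y] at this

lemma lipschitz_symm (h : NearId P) : LipschitzWith 2 h.toHomeo.symm :=
  LipschitzWith.of_dist_le_mul fun x y => by
    have := h.antilipschitz.le_mul_dist (h.toHomeo.symm x) (h.toHomeo.symm y)
    rwa [show P (h.toHomeo.symm x) = x from h.toHomeo.apply_symm_apply x,
      show P (h.toHomeo.symm y) = y from h.toHomeo.apply_symm_apply y] at this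

end NearId

end Composition

/-! ### Difference quotients of Sobolev functions -/

section DifferenceQuotients

open scoped ENNReal NNReal

variable {N : ℕ} {Ω : Set (Eucl N)}

/-- Write `φ(P x) - φ(x)` as the average over `θ` of `∇φ(x + θ(P x - x)) · (P x - x)`; each
interpolated map costs at most the factor `2^N` in `L²`. -/
lemma eLpNorm_comp_sub_le_of_contDiff {P : Eucl N → Eucl N} (hP : NearId P) {m : ℝ} (hm0 : 0 ≤ m)
    (hm : ∀ x, ‖P x - x‖ ≤ m) {φ : Eucl N → ℝ} (hφ : ContDiff ℝ 1 φ) :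
    eLpNorm (fun x => φ (P x) - φ x) 2 volume
      ≤ ENNReal.ofReal m * (2 ^ N * eLpNorm (gradient φ) 2 volume) := by
  have : IsProbabilityMeasure (volume.restrict (Icc (0 : ℝ) 1)) := ⟨by simp⟩
  have hcg := continuous_gradient hφ
  have hcP := hP.contDiff.continuous
  set k : Eucl N × ℝ → Eucl N := fun q => m • gradient φ (q.1 + q.2 • (P q.1 - q.1)) with hk
  have hkc : Continuous k := by fun_prop
  refine eLpNorm_le_of_le_average (k := k) (ν := volume.restrict (Icc (0 : ℝ) 1))
    hkc.aestronglyMeasurable (fun x => ?_) ?_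
  · have hder : ∀ θ : ℝ, HasDerivAt (fun θ : ℝ => φ (x + θ • (P x - x)))
        (fderiv ℝ φ (x + θ • (P x - x)) (P x - x)) θ := fun θ => by
      have h1 : HasDerivAt (fun θ : ℝ => x + θ • (P x - x)) (P x - x) θ := by
        have := ((hasDerivAt_id θ).smul_const (P x - x)).const_add x
        rwa [one_smul] at this
      exact (hφ.differentiable one_ne_zero _).hasFDerivAt.comp_hasDerivAt θ h1
    have hcd : Continuous fun θ : ℝ => fderiv ℝ φ (x + θ • (P x - x)) (P x - x) := by
      have := hφ.continuous_fderiv one_ne_zero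
      fun_prop
    have hftc := intervalIntegral.integral_eq_sub_of_hasDerivAt (a := 0) (b := 1)
      (fun θ _ => hder θ) (hcd.intervalIntegrable _ _)
    simp only [one_smul, zero_smul, add_zero, add_sub_cancel] at hftc
    rw [← hftc, intervalIntegral.integral_of_le zero_le_one, ← integral_Icc_eq_integral_Ioc]
    refine (enorm_integral_le_lintegral_enorm _).trans (lintegral_mono fun θ => ?_)
    rw [enorm_le_iff_norm_le]
    refine (ContinuousLinearMap.le_opNorm _ _).trans ?_
    rw [hk, norm_smul, norm_gradient_eq, Real.norm_of_nonneg hm0, mul_comm]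
    gcongr
    exact hm x
  · filter_upwards [ae_restrict_mem measurableSet_Icc] with θ hθ
    have hc : Continuous fun x => x + θ • (P x - x) := by fun_prop
    have h1 := eLpNorm_comp_le (hP.antilipschitz_segment hθ) hc.measurable
      (f := gradient φ) hcg.aestronglyMeasurable
    calc eLpNorm (fun x => k (x, θ)) 2 volume
        = eLpNorm (m • fun x => gradient φ (x + θ • (P x - x))) 2 volume := rfl
      _ ≤ _ := by
        rw [eLpNorm_const_smul, Real.enorm_of_nonneg hm0]
        gcongr

/-- The difference between `u ∘ P` and `u` is controlled by the gradient of `u`. -/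
lemma norm_compLp_sub_le {P : Eucl N → Eucl N} (hP : NearId P) {m : ℝ} (hm0 : 0 ≤ m)
    (hm : ∀ x, ‖P x - x‖ ≤ m) {w : L2Pair N} (hw : w ∈ H10 Ω) :
    ‖compLp P hP.antilipschitz hP.contDiff.continuous w.fst - w.fst‖ ≤ m * 2 ^ N * ‖w.snd‖ := by
  refine H10_induction (P := {w | ‖compLp P hP.antilipschitz hP.contDiff.continuous w.fst - w.fst‖
    ≤ m * 2 ^ N * ‖w.snd‖}) (isClosed_le ?_ ?_) (fun φ hφ => ?_) hw
  · have h1 : Continuous fun w : L2Pair N => w.fst := WithLp.continuous_fst _ _ _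
    fun_prop
  · have h1 : Continuous fun w : L2Pair N => w.snd := WithLp.continuous_snd _ _ _
    fun_prop
  · have hm2 := memLp_of_contDiff_one hφ.contDiff_one hφ.2 (p := 2)
    have hg2 := memLp_gradient hφ.contDiff_one hφ.2 (p := 2)
    have hmP := memLp_comp hP.antilipschitz hP.contDiff.continuous.measurable hm2
    show ‖compLp P hP.antilipschitz hP.contDiff.continuous (toLpD volume 2 φ) - toLpD volume 2 φ‖
      ≤ m * 2 ^ N * ‖toLpD volume 2 (gradient φ)‖
    rw [compLp_toLpD _ _ hm2, toLpD_eq hmP, toLpD_eq hm2, ← MemLp.toLp_sub, Lp.norm_toLp,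
      toLpD_eq hg2, Lp.norm_toLp]
    refine ENNReal.toReal_le_of_le_ofReal (by positivity) ?_
    refine (eLpNorm_comp_sub_le_of_contDiff hP hm0 hm hφ.contDiff_one).trans ?_
    rw [ENNReal.ofReal_mul (by positivity), ENNReal.ofReal_mul hm0,
      ENNReal.ofReal_toReal hg2.2.ne, ENNReal.ofReal_pow (by norm_num), ENNReal.ofReal_ofNat,
      mul_assoc]

lemma exists_taylor_le {φ : Eucl N → ℝ} (hφ : ContDiff ℝ 1 φ) (hc : HasCompactSupport φ) {ε : ℝ}
    (hε : 0 < ε) : ∃ δ > 0, ∀ x y : Eucl N, ‖y - x‖ ≤ δ →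
      ‖φ y - φ x - fderiv ℝ φ x (y - x)‖ ≤ ε * ‖y - x‖ := by
  have huc : UniformContinuous (fderiv ℝ φ) :=
    (hc.fderiv ℝ).uniformContinuous_of_continuous (hφ.continuous_fderiv one_ne_zero)
  obtain ⟨δ, hδ, h⟩ := Metric.uniformContinuous_iff.mp huc ε hε
  refine ⟨δ / 2, half_pos hδ, fun x y hxy => ?_⟩
  refine (convex_closedBall x (δ / 2)).norm_image_sub_le_of_norm_fderiv_le'
    (fun z _ => hφ.differentiable one_ne_zero z) (fun z hz => ?_)
    (Metric.mem_closedBall_self (half_pos hδ).le) (by rwa [mem_closedBall_iff_norm])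
  rw [← dist_eq_norm]
  exact (h (lt_of_le_of_lt (Metric.mem_closedBall.mp hz) (half_lt_self hδ))).le

/-- The operator `(u, g) ↦ g · W`. -/
def innerOp (W : Eucl N → Eucl N) :
    Lp (Eucl N) 2 (volume : Measure (Eucl N)) →L[ℝ] Lp ℝ 2 (volume : Measure (Eucl N)) :=
  mulOp volume (innerSL ℝ) W

lemma coeFn_innerOp {W : Eucl N → Eucl N} (hW : MemLp W ∞ volume)
    (g : Lp (Eucl N) 2 (volume : Measure (Eucl N))) :
    innerOp W g =ᵐ[volume] fun x => ⟪g x, W x⟫_ℝ := by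
  filter_upwards [coeFn_mulOp (innerSL ℝ) hW g] with x hx
  rw [innerOp, hx, real_inner_comm]; rfl

lemma norm_innerOp_le {W : Eucl N → Eucl N} {m : ℝ} (hW : MemLp W ∞ volume) (hm : ∀ x, ‖W x‖ ≤ m)
    (g : Lp (Eucl N) 2 (volume : Measure (Eucl N))) : ‖innerOp W g‖ ≤ m * ‖g‖ := by
  refine Lp.norm_le_mul_norm_of_ae_le_mul ?_
  filter_upwards [coeFn_innerOp hW g] with x hx
  rw [hx]
  refine (norm_inner_le_norm _ _).trans ?_
  rw [mul_comm]; gcongr; exact hm x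

lemma exists_test_approx {w : L2Pair N} (hw : w ∈ H10 Ω) {ε : ℝ} (hε : 0 < ε) :
    ∃ φ, IsTest Ω φ ∧ ‖w - pairD φ (gradient φ)‖ < ε := by
  rw [← SetLike.mem_coe, coe_H10] at hw
  obtain ⟨z, hz, hlt⟩ := Metric.mem_closure_iff.mp hw ε hε
  obtain ⟨φ, hφ, rfl⟩ := mem_testPairs_iff.mp hz
  exact ⟨φ, hφ, by rwa [← dist_eq_norm]⟩

lemma norm_le_of_eLpNorm_coeFn_le {α E : Type*} [MeasurableSpace α] {μ : Measure α}
    [NormedAddCommGroup E] {f : Lp E 2 μ} {C : ℝ} (hC : 0 ≤ C)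
    (h : eLpNorm f 2 μ ≤ ENNReal.ofReal C) : ‖f‖ ≤ C := by
  rw [Lp.norm_def]
  exact ENNReal.toReal_le_of_le_ofReal hC h

namespace ShortFlow

variable {τ M : ℝ} {V T : ℝ → Eucl N → Eucl N} (hF : ShortFlow τ M V T)
include hF

lemma nearId {s : ℝ} (hs : s ∈ Icc 0 τ) : NearId (T s) where
  contDiff := hF.contDiff_flow hs
  lip x y := by
    refine (hF.norm_displacement_sub_le hs x y).trans ?_
    gcongr
    have := hF.small
    have h1 := hF.M_pos
    nlinarith [hs.2, hs.1]

lemma memLp_velocity : MemLp (V 0) ∞ volume :=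
  memLp_top_of_continuous (hF.contDiff 0 hF.zero_mem).continuous (hF.bound 0 hF.zero_mem)

/-- Taylor's formula for `φ` and the uniform expansion of `T_s` make the error `o(s)` uniformly in
`x`; it lives in a fixed compact set of finite measure, so it is also `o(s)` in `L²`. -/
lemma norm_comp_test_sub_le {φ : Eucl N → ℝ} (hφ : IsTest Ω φ) {ε : ℝ} (hε : 0 < ε) :
    ∃ δ > 0, ∀ s ∈ Icc 0 τ, s ≤ δ → eLpNorm
      (fun x => φ (T s x) - φ x - s * ⟪gradient φ x, V 0 x⟫_ℝ) 2 volume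
        ≤ ENNReal.ofReal (ε * s) := by
  have hM := hF.M_pos
  set K := Metric.cthickening 1 (tsupport φ) with hK
  have hKc : IsCompact K := hφ.2.isCompact.cthickening
  have hKm : MeasurableSet K := hKc.isClosed.measurableSet
  -- The `L²` norm of the indicator of `K`; a pointwise bound `εs/(κ + 1)` therefore gives at most
  -- `εs` in `L²`.
  set κ := ((volume K) ^ (1 / 2 : ℝ)).toReal with hκ
  have hκ0 : 0 ≤ κ := ENNReal.toReal_nonneg
  have hκe : (volume K) ^ (1 / 2 : ℝ) = ENNReal.ofReal κ :=
    (ENNReal.ofReal_toReal (ENNReal.rpow_ne_top_of_nonneg (by norm_num)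
      hKc.measure_lt_top.ne)).symm
  obtain ⟨C, hC⟩ := (continuous_gradient hφ.contDiff_one).bounded_above_of_compact_support
    (hasCompactSupport_gradient hφ.2)
  have hC0 : 0 ≤ C := (norm_nonneg _).trans (hC 0)
  obtain ⟨δ₁, hδ₁, h1⟩ := exists_taylor_le hφ.contDiff_one hφ.2
    (show 0 < ε / (2 * M * (κ + 1)) by positivity)
  obtain ⟨δ₂, hδ₂, h2⟩ := hF.flow_expansion (show 0 < ε / (2 * (C + 1) * (κ + 1)) by positivity)
  refine ⟨min (δ₁ / M) δ₂, by positivity, fun s hs hsδ => ?_⟩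
  have hs0 := hs.1
  have hMs : M * s ≤ δ₁ := by
    have := hsδ.trans (min_le_left _ _)
    rwa [le_div_iff₀ hM, mul_comm] at this
  have hMs1 : M * s ≤ 1 := by nlinarith [hs.2, hF.small]
  have hdisp : ∀ x, ‖T s x - x‖ ≤ M * s := fun x => hF.norm_flow_sub_self_le hs x
  have hbound : ∀ x, ‖φ (T s x) - φ x - s * ⟪gradient φ x, V 0 x⟫_ℝ‖
      ≤ ε / (κ + 1) * s := fun x => by
    have e : φ (T s x) - φ x - s * ⟪gradient φ x, V 0 x⟫_ℝ
        = (φ (T s x) - φ x - fderiv ℝ φ x (T s x - x))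
          + ⟪gradient φ x, T s x - x - s • V 0 x⟫_ℝ := by
      rw [inner_sub_right, inner_gradient_eq_fderiv φ x (T s x - x), real_inner_smul_right]; ring
    rw [e]
    have t1 := h1 x (T s x) ((hdisp x).trans hMs)
    have t2 := h2 s hs (hsδ.trans (min_le_right _ _)) x
    calc _ ≤ ‖φ (T s x) - φ x - fderiv ℝ φ x (T s x - x)‖
            + ‖gradient φ x‖ * ‖T s x - x - s • V 0 x‖ :=
          (norm_add_le _ _).trans (by gcongr; exact norm_inner_le_norm _ _)
      _ ≤ ε / (2 * M * (κ + 1)) * (M * s) + (C + 1) * (ε / (2 * (C + 1) * (κ + 1)) * s) := by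
          gcongr
          · exact t1.trans (by gcongr; exact hdisp x)
          · exact (hC x).trans (by linarith)
      _ = ε / (κ + 1) * s := by field_simp; ring
  have hzero : ∀ x, x ∉ K → φ (T s x) - φ x - s * ⟪gradient φ x, V 0 x⟫_ℝ = 0 := fun x hx => by
    have n1 : x ∉ tsupport φ := fun h => hx (Metric.self_subset_cthickening _ h)
    have n2 : T s x ∉ tsupport φ := fun h => hx
      (Metric.mem_cthickening_of_dist_le x (T s x) 1 _ h (by
        rw [dist_comm, dist_eq_norm]; exact (hdisp x).trans hMs1))
    rw [inner_gradient_eq_fderiv, fderiv_of_notMem_tsupport (𝕜 := ℝ) n1,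
      image_eq_zero_of_notMem_tsupport n1, image_eq_zero_of_notMem_tsupport n2]
    simp
  calc _ ≤ eLpNorm (K.indicator fun _ => ε / (κ + 1) * s) 2 volume := by
        refine eLpNorm_mono fun x => ?_
        by_cases hx : x ∈ K
        · rw [indicator_of_mem hx]; exact (hbound x).trans (Real.le_norm_self _)
        · rw [hzero x hx]; simp
    _ = ENNReal.ofReal (ε / (κ + 1) * s) * ENNReal.ofReal κ := by
        rw [eLpNorm_indicator_const hKm two_ne_zero ENNReal.ofNat_ne_top, ENNReal.toReal_ofNat,
          hκe, Real.enorm_of_nonneg (by positivity)]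
    _ ≤ _ := by
        rw [← ENNReal.ofReal_mul (by positivity)]
        refine ENNReal.ofReal_le_ofReal ?_
        have : ε / (κ + 1) * s * κ = ε * s * (κ / (κ + 1)) := by ring
        rw [this]
        exact mul_le_of_le_one_right (by positivity) ((div_le_one (by positivity)).mpr (by linarith))

/-- The derivative at `s = 0` of `u ∘ T_s` in `L²` is `∇u · V(0)`. -/
lemma hasDerivWithinAt_comp {w : L2Pair N} (hw : w ∈ H10 Ω) :
    HasDerivWithinAt (fun s => toLpD volume 2 fun x => (w.fst : Eucl N → ℝ) (T s x))
      (innerOp (V 0) w.snd) (Ici 0) 0 := by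
  have hM := hF.M_pos
  set C := M * 2 ^ N + M with hC
  have hC0 : 0 < C := by positivity
  refine hasDerivWithinAt_of_norm_le hF.pos fun ε hε => ?_
  -- Density argument: the error `A` below is linear with norm at most `sC` on `H¹₀(Ω)`, so
  -- replacing `w` by `φ` costs `εs/2`, and the test function contributes the other half.
  obtain ⟨φ, hφ, hlt⟩ := exists_test_approx hw (show 0 < ε / (2 * C) by positivity)
  obtain ⟨δ, hδ, hle⟩ := hF.norm_comp_test_sub_le hφ (half_pos hε)
  refine ⟨δ, hδ, fun s hs hsδ => ?_⟩
  have hn := hF.nearId hs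
  have hs0 := hs.1
  have hV := hF.memLp_velocity
  set A : L2Pair N → Lp ℝ 2 (volume : Measure (Eucl N)) := fun z =>
    compLp (T s) hn.antilipschitz hn.contDiff.continuous z.fst - z.fst
      - s • innerOp (V 0) z.snd with hA
  have hAsub : ∀ y z, A y - A z = A (y - z) := fun y z => by
    simp only [hA, WithLp.sub_fst, WithLp.sub_snd, map_sub, smul_sub]; abel
  have hAbd : ∀ z ∈ H10 Ω, ‖A z‖ ≤ s * C * ‖z‖ := fun z hz => by
    calc ‖A z‖ ≤ M * s * 2 ^ N * ‖z.snd‖ + s * (M * ‖z.snd‖) := by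
          refine (norm_sub_le _ _).trans (add_le_add
            (norm_compLp_sub_le hn (by positivity) (fun x => hF.norm_flow_sub_self_le hs x) hz) ?_)
          rw [norm_smul, Real.norm_of_nonneg hs0]
          gcongr
          exact norm_innerOp_le hV (hF.bound 0 hF.zero_mem) _
      _ = s * C * ‖z.snd‖ := by rw [hC]; ring
      _ ≤ _ := by gcongr; exact WithLp.norm_snd_le _ _
  have hm2 := memLp_of_contDiff_one hφ.contDiff_one hφ.2 (p := 2)
  have hg2 := memLp_gradient hφ.contDiff_one hφ.2 (p := 2)
  have hAφ : ‖A (pairD φ (gradient φ))‖ ≤ ε / 2 * s := by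
    refine norm_le_of_eLpNorm_coeFn_le (by positivity) (le_trans (le_of_eq ?_) (hle s hs hsδ))
    refine eLpNorm_congr_ae ?_
    have hq := quasiMeasurePreserving_of_antilipschitz hn.antilipschitz
      hn.contDiff.continuous.measurable
    filter_upwards [Lp.coeFn_sub (compLp (T s) hn.antilipschitz hn.contDiff.continuous
        (toLpD volume 2 φ) - toLpD volume 2 φ) (s • innerOp (V 0) (toLpD volume 2 (gradient φ))),
      Lp.coeFn_sub (compLp (T s) hn.antilipschitz hn.contDiff.continuous
        (toLpD volume 2 φ)) (toLpD volume 2 φ), Lp.coeFn_smul s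
        (innerOp (V 0) (toLpD volume 2 (gradient φ))), coeFn_innerOp hV
        (toLpD volume 2 (gradient φ)), coeFn_compLp hn.antilipschitz hn.contDiff.continuous
        (toLpD volume 2 φ), coeFn_toLpD hm2, hq.ae (coeFn_toLpD hm2), coeFn_toLpD hg2]
      with x a1 a2 a3 a4 a5 a6 a7 a8
    refine a1.trans ?_
    rw [Pi.sub_apply, a2, Pi.sub_apply, a3, Pi.smul_apply, a4, a5, a6, a7, a8, smul_eq_mul]
  have e0 : (toLpD volume 2 fun x => (w.fst : Eucl N → ℝ) (T 0 x)) = w.fst := by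
    simp_rw [hF.initial]; exact toLpD_coeFn _
  have es : (toLpD volume 2 fun x => (w.fst : Eucl N → ℝ) (T s x))
      = compLp (T s) hn.antilipschitz hn.contDiff.continuous w.fst := rfl
  show ‖(toLpD volume 2 fun x => (w.fst : Eucl N → ℝ) (T s x))
    - (toLpD volume 2 fun x => (w.fst : Eucl N → ℝ) (T 0 x)) - s • innerOp (V 0) w.snd‖ ≤ ε * s
  rw [e0, es]
  change ‖A w‖ ≤ ε * s
  have hd := hAbd _ (Submodule.sub_mem _ hw hφ.pairD_mem)
  rw [← hAsub] at hd
  calc ‖A w‖ = ‖(A w - A (pairD φ (gradient φ))) + A (pairD φ (gradient φ))‖ := by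
        rw [sub_add_cancel]
    _ ≤ s * C * (ε / (2 * C)) + ε / 2 * s := by
        refine (norm_add_le _ _).trans (add_le_add (hd.trans ?_) hAφ)
        gcongr
    _ = ε * s := by field_simp; ring

end ShortFlow

end DifferenceQuotients

/-! ### Transport of Sobolev functions by a flow -/

section Transport

open scoped ENNReal NNReal

variable {N : ℕ} {Ω : Set (Eucl N)}

/-- The slopes lie in the closed subspace, and so does their limit. -/
lemma mem_of_hasDerivWithinAt_of_isClosed {E : Type*} [NormedAddCommGroup E] [NormedSpace ℝ E]
    {K : Submodule ℝ E} (hK : IsClosed (K : Set E)) {c : ℝ → E} {c' : E}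
    (h : HasDerivWithinAt c c' (Ici 0) 0) {τ : ℝ} (hτ : 0 < τ) (hc : ∀ s ∈ Icc 0 τ, c s ∈ K) :
    c' ∈ K := by
  rw [← hasDerivWithinAt_Ioi_iff_Ici,
    hasDerivWithinAt_iff_tendsto_slope' self_notMem_Ioi] at h
  refine hK.mem_of_tendsto h ?_
  filter_upwards [Ioc_mem_nhdsGT hτ] with s hs
  rw [slope_def_module]
  exact K.smul_mem _ (K.sub_mem (hc s ⟨hs.1.le, hs.2⟩) (hc 0 ⟨le_rfl, hτ.le⟩))

namespace ShortFlow

variable {τ M : ℝ} {V T : ℝ → Eucl N → Eucl N} (hF : ShortFlow τ M V T)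
include hF

lemma quasiMeasurePreserving {s : ℝ} (hs : s ∈ Icc 0 τ) :
    Measure.QuasiMeasurePreserving (T s) volume volume :=
  quasiMeasurePreserving_of_antilipschitz (hF.nearId hs).antilipschitz
    (hF.contDiff_flow hs).continuous.measurable

lemma memLp_comp {F : Type*} [NormedAddCommGroup F] [NormedSpace ℝ F] {s : ℝ}
    (hs : s ∈ Icc 0 τ) {f : Eucl N → F} {p : ℝ≥0∞} (hf : MemLp f p volume) :
    MemLp (fun x => f (T s x)) p volume :=
  MinimaxShape.memLp_comp (hF.nearId hs).antilipschitz (hF.contDiff_flow hs).continuous.measurable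
    hf

lemma hasDerivWithinAt_comp_memH1 {u : Eucl N → ℝ} (hu : MemH1 u) :
    HasDerivWithinAt (fun s => toLpD volume 2 fun x => u (T s x))
      (toLpD volume 2 fun x => ⟪weakGrad u x, V 0 x⟫_ℝ) (Ici 0) 0 := by
  have h := hF.hasDerivWithinAt_comp hu.pairD_mem_H10
  have e1 : innerOp (V 0) (pairD u (weakGrad u)).snd
      = toLpD volume 2 fun x => ⟪weakGrad u x, V 0 x⟫_ℝ := by
    rw [pairD_snd, innerOp, mulOp_toLpD _ hF.memLp_velocity hu.memLp_weakGrad]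
    simp_rw [real_inner_comm (V 0 _)]; rfl
  rw [e1] at h
  have key : ∀ s ∈ Icc 0 τ, (toLpD volume 2 fun x => u (T s x))
      = toLpD volume 2 fun x => ((pairD u (weakGrad u)).fst : Eucl N → ℝ) (T s x) := fun s hs =>
    toLpD_congr (hF.memLp_comp hs hu.1)
      ((hF.quasiMeasurePreserving hs).ae (coeFn_toLpD hu.1).symm)
  refine h.congr_of_eventuallyEq ?_ (key 0 hF.zero_mem)
  filter_upwards [Icc_mem_nhdsGE hF.pos] with s hs using key s hs

/-- Apply the scalar result to each coordinate. The value of the derivative is left open: for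
gradients it is identified afterwards by closedness of the space of pairs `(u, ∇u)`. -/
lemma hasDerivWithinAt_comp_vector {g : Eucl N → Eucl N}
    (hg : ∀ v, MemH1 fun x => ⟪g x, v⟫_ℝ) :
    ∃ g', HasDerivWithinAt (fun s => toLpD volume 2 fun x => g (T s x)) g' (Ici 0) 0 := by
  set b := EuclideanSpace.basisFun (Fin N) ℝ
  set L : Fin N → Lp ℝ 2 (volume : Measure (Eucl N)) →L[ℝ] Lp (Eucl N) 2 (volume : Measure (Eucl N)) :=
    fun i => (ContinuousLinearMap.toSpanSingleton ℝ (b i)).compLpL 2 volume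
  have hsum : ∀ x, g x = ∑ i, ⟪g x, b i⟫_ℝ • b i := fun x => by
    conv_lhs => rw [← b.sum_repr' (g x)]
    simp_rw [real_inner_comm (b _)]
  have key : ∀ s ∈ Icc 0 τ, (toLpD volume 2 fun x => g (T s x))
      = ∑ i, L i (toLpD volume 2 fun x => ⟪g (T s x), b i⟫_ℝ) := fun s hs => by
    have hm : ∀ i, MemLp (fun x => ⟪g (T s x), b i⟫_ℝ) 2 volume := fun i =>
      hF.memLp_comp hs (hg (b i)).1
    have hmg : MemLp (fun x => g (T s x)) 2 volume := by
      have : (fun x => g (T s x)) = fun x => ∑ i, ⟪g (T s x), b i⟫_ℝ • b i := by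
        funext x; exact hsum _
      rw [this]
      exact memLp_finsetSum _ fun i _ =>
        (ContinuousLinearMap.toSpanSingleton ℝ (b i)).comp_memLp' (hm i)
    refine Lp.ext ?_
    have h1 : ∀ᵐ x, ∀ i, (L i (toLpD volume 2 fun x => ⟪g (T s x), b i⟫_ℝ)) x
        = ⟪g (T s x), b i⟫_ℝ • b i := by
      refine ae_all_iff.mpr fun i => ?_
      filter_upwards [(ContinuousLinearMap.toSpanSingleton ℝ (b i)).coeFn_compLpL (p := 2)
        (μ := volume) (toLpD volume 2 fun x => ⟪g (T s x), b i⟫_ℝ), coeFn_toLpD (hm i)]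
        with x h2 h3
      rw [h2, h3]; rfl
    filter_upwards [coeFn_toLpD hmg, h1, Lp.coeFn_finsetSum Finset.univ
      (fun i => L i (toLpD volume 2 fun x => ⟪g (T s x), b i⟫_ℝ))] with x h2 h3 h4
    rw [h2, h4, hsum, Finset.sum_apply]
    exact Finset.sum_congr rfl fun i _ => (h3 i).symm
  have hder := HasDerivWithinAt.fun_sum (u := Finset.univ) fun i _ =>
    (L i).hasFDerivAt.comp_hasDerivWithinAt (0 : ℝ) (hF.hasDerivWithinAt_comp_memH1 (hg (b i)))
  refine ⟨_, hder.congr_of_eventuallyEq ?_ (key 0 hF.zero_mem)⟩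
  filter_upwards [Icc_mem_nhdsGE hF.pos] with s hs using key s hs

lemma hasDerivWithinAt_adjoint_fderiv : HasDerivWithinAt
    (fun s => toLpD volume ∞ fun x => ContinuousLinearMap.adjoint (fderiv ℝ (T s) x))
    (toLpD volume ∞ fun x => ContinuousLinearMap.adjoint (fderiv ℝ (V 0) x)) (Ici 0) 0 := by
  refine hasDerivWithinAt_toLpD_top hF.pos
    (fun s hs => memLp_adjoint_fderiv (hF.contDiff_flow hs) (hF.nearId hs).lipschitz)
    (memLp_top_of_continuous (continuous_adjoint_fderiv (hF.contDiff 0 hF.zero_mem)) (C := M)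
      fun x => by rw [LinearIsometryEquiv.norm_map]; exact hF.bound_deriv 0 hF.zero_mem x)
    fun ε hε => ?_
  obtain ⟨δ, hδ, h⟩ := hF.fderiv_expansion hε
  refine ⟨δ, hδ, fun s hs hsδ x => ?_⟩
  have e0 : fderiv ℝ (T 0) x = ContinuousLinearMap.id ℝ (Eucl N) := by
    have : T 0 = id := funext hF.initial
    rw [this, fderiv_id]
  have e : ContinuousLinearMap.adjoint (fderiv ℝ (T s) x)
      - ContinuousLinearMap.adjoint (fderiv ℝ (T 0) x)
      - s • ContinuousLinearMap.adjoint (fderiv ℝ (V 0) x)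
      = ContinuousLinearMap.adjoint (fderiv ℝ (T s) x - ContinuousLinearMap.id ℝ (Eucl N)
        - s • fderiv ℝ (V 0) x) := by
    rw [map_sub, map_sub, e0, map_smulₛₗ]; rfl
  rw [e, LinearIsometryEquiv.norm_map]
  exact h s hs hsδ x

lemma image_toHomeo_univ {s : ℝ} (hs : s ∈ Icc 0 τ) :
    (hF.nearId hs).toHomeo '' univ = univ := by
  rw [image_univ]; exact (hF.nearId hs).toHomeo.surjective.range_eq

lemma pairD_comp_mem {u : Eucl N → ℝ} (hu : MemH1 u) {s : ℝ} (hs : s ∈ Icc 0 τ) :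
    pairD (fun x => u (T s x)) (fun x => ContinuousLinearMap.adjoint (fderiv ℝ (T s) x)
      (weakGrad u (T s x))) ∈ H10 (univ : Set (Eucl N)) := by
  have hn := hF.nearId hs
  have hw : pairD u (weakGrad u) ∈ H10 (hn.toHomeo '' univ) := by
    rw [hF.image_toHomeo_univ hs]; exact hu.pairD_mem_H10
  have h := compOp_mem_H10 hn.toHomeo hn.antilipschitz hn.contDiff hn.lipschitz isOpen_univ hw
  have e := compOp_pairD_of_memLp hn.antilipschitz hn.contDiff hn.lipschitz hu.1 hu.memLp_weakGrad
  rw [← e]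
  exact h

lemma memLp_adjoint_comp {u : Eucl N → ℝ} (hu : MemH1 u) {s : ℝ} (hs : s ∈ Icc 0 τ) :
    MemLp (fun x => ContinuousLinearMap.adjoint (fderiv ℝ (T s) x) (weakGrad u (T s x))) 2
      volume :=
  (ContinuousLinearMap.id ℝ (Eucl N →L[ℝ] Eucl N)).memLp_of_bilin 2
    (memLp_adjoint_fderiv (hF.nearId hs).contDiff (hF.nearId hs).lipschitz)
    (hF.memLp_comp hs hu.memLp_weakGrad)

lemma memH1_comp {u : Eucl N → ℝ} (hu : MemH1 u) {s : ℝ} (hs : s ∈ Icc 0 τ) :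
    MemH1 fun x => u (T s x) :=
  MemH1.of_mem_H10 (hF.pairD_comp_mem hu hs) (coeFn_toLpD (hF.memLp_comp hs hu.1))

lemma weakGrad_comp {u : Eucl N → ℝ} (hu : MemH1 u) {s : ℝ} (hs : s ∈ Icc 0 τ) :
    weakGrad (fun x => u (T s x)) =ᵐ[volume]
      fun x => ContinuousLinearMap.adjoint (fderiv ℝ (T s) x) (weakGrad u (T s x)) :=
  (weakGrad_ae_eq_of_mem_H10 (hF.pairD_comp_mem hu hs)
    (coeFn_toLpD (hF.memLp_comp hs hu.1))).trans (coeFn_toLpD (hF.memLp_adjoint_comp hu hs))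

/-- For `u ∈ H²`, the function `∇u · V(0)` is in `H¹`, and its gradient is the derivative of
`∇(u ∘ T_s)` at `s = 0`. -/
theorem hasDerivWithinAt_weakGrad_comp {u : Eucl N → ℝ} (hu : MemH2 u) :
    MemH1 (fun x => ⟪weakGrad u x, V 0 x⟫_ℝ) ∧
    HasDerivWithinAt (fun s => toLpD volume 2 (weakGrad fun x => u (T s x)))
      (toLpD volume 2 (weakGrad fun x => ⟪weakGrad u x, V 0 x⟫_ℝ)) (Ici 0) 0 := by
  obtain ⟨g', hg'⟩ := hF.hasDerivWithinAt_comp_vector hu.2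
  have hmul := (hasDerivWithinAt_mulOp (ContinuousLinearMap.id ℝ (Eucl N →L[ℝ] Eucl N))
    hF.hasDerivWithinAt_adjoint_fderiv).clm_apply hg'
  have key : ∀ s ∈ Icc 0 τ, toLpD volume 2 (weakGrad fun x => u (T s x))
      = mulOp volume (ContinuousLinearMap.id ℝ (Eucl N →L[ℝ] Eucl N))
        (fun x => ContinuousLinearMap.adjoint (fderiv ℝ (T s) x))
        (toLpD volume 2 fun x => weakGrad u (T s x)) := fun s hs => by
    rw [mulOp_toLpD _ (memLp_adjoint_fderiv (hF.nearId hs).contDiff (hF.nearId hs).lipschitz)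
      (hF.memLp_comp hs hu.1.memLp_weakGrad)]
    exact (toLpD_congr (hF.memLp_adjoint_comp hu.1 hs) (hF.weakGrad_comp hu.1 hs).symm).symm
  have hder := hmul.congr_of_eventuallyEq (f₁ := fun s =>
    toLpD volume 2 (weakGrad fun x => u (T s x)))
    (by filter_upwards [Icc_mem_nhdsGE hF.pos] with s hs using key s hs) (key 0 hF.zero_mem)
  have hpair := (L2Pair.equiv N).symm.hasFDerivAt.comp_hasDerivWithinAt (0 : ℝ)
    ((hF.hasDerivWithinAt_comp_memH1 hu.1).prodMk hder)
  -- The pairs `(u ∘ T_s, ∇(u ∘ T_s))` stay in `H¹₀(ℝ^N)`, so their derivative at `0` does too: its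
  -- second component is the weak gradient of the first, `∇u · V(0)`, with no product rule for
  -- second derivatives.
  have hmem := mem_of_hasDerivWithinAt_of_isClosed isClosed_H10 hpair hF.pos
    (K := H10 (univ : Set (Eucl N))) fun s hs => by
      have h := (hF.memH1_comp hu.1 hs).pairD_mem_H10
      exact h
  have hL : MemLp (fun x => ⟪weakGrad u x, V 0 x⟫_ℝ) 2 volume := by
    have h1 := (innerSL ℝ).memLp_of_bilin 2 hF.memLp_velocity hu.1.memLp_weakGrad
    refine (memLp_congr_ae (ae_of_all _ fun x => ?_)).mp h1
    exact real_inner_comm (weakGrad u x) (V 0 x)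
  have hc := coeFn_toLpD hL
  have hH1 := MemH1.of_mem_H10 hmem hc
  refine ⟨hH1, ?_⟩
  have hw := weakGrad_ae_eq_of_mem_H10 hmem hc
  rw [toLpD_congr hH1.memLp_weakGrad hw]
  rw [toLpD_coeFn]
  exact hder

end ShortFlow

end Transport

/-! ### The coefficients `J_s` and `B(s)` -/

section Coefficients

open scoped ENNReal NNReal

variable {N : ℕ} {Ω : Set (Eucl N)}

/-- The space of linear endomorphisms of `ℝ^N`. -/
abbrev Endo (N : ℕ) : Type := Eucl N →L[ℝ] Eucl N

/-- The trace, as a continuous linear form. -/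
def traceL (N : ℕ) : Endo N →L[ℝ] ℝ :=
  LinearMap.toContinuousLinearMap
    (LinearMap.trace ℝ (Eucl N) ∘ₗ ContinuousLinearMap.coeLM ℝ)

lemma traceL_apply (A : Endo N) : traceL N A = LinearMap.trace ℝ (Eucl N) (A : Eucl N →ₗ[ℝ] Eucl N) :=
  rfl

lemma differentiable_det : Differentiable ℝ fun A : Endo N => A.det := by
  set b := (EuclideanSpace.basisFun (Fin N) ℝ).toBasis
  let ℓ : Fin N → Fin N → Endo N →L[ℝ] ℝ := fun i j => LinearMap.toContinuousLinearMap
    { toFun := fun A => LinearMap.toMatrix b b (A : Eucl N →ₗ[ℝ] Eucl N) i j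
      map_add' := fun A B => by simp
      map_smul' := fun c A => by simp }
  have e : (fun A : Endo N => A.det)
      = fun A => ∑ σ : Equiv.Perm (Fin N), ((Equiv.Perm.sign σ : ℤ) : ℝ) * ∏ i, ℓ (σ i) i A := by
    funext A
    rw [ContinuousLinearMap.det, ← LinearMap.det_toMatrix b, Matrix.det_apply']
    rfl
  rw [e]
  fun_prop

/-- Differentiability is known since the determinant is a polynomial in the entries, so only
directional derivatives are needed: `det(I + tH) = 1 + t tr H + O(t²)`. -/
lemma hasFDerivAt_det : HasFDerivAt (fun A : Endo N => A.det) (traceL N) 1 := by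
  have hd := (differentiable_det (N := N) 1).hasFDerivAt
  convert hd using 1
  ext H
  set b := (EuclideanSpace.basisFun (Fin N) ℝ).toBasis
  have hline : HasDerivAt (fun t : ℝ => (1 : Endo N) + t • H) H 0 := by
    have := ((hasDerivAt_id (0 : ℝ)).smul_const H).const_add (1 : Endo N)
    rwa [one_smul] at this
  have h1 : HasDerivAt (fun t : ℝ => ((1 : Endo N) + t • H).det)
      (fderiv ℝ (fun A : Endo N => A.det) 1 H) 0 := by
    have hd' : HasFDerivAt (fun A : Endo N => A.det) (fderiv ℝ (fun A : Endo N => A.det) 1)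
        ((1 : Endo N) + (0 : ℝ) • H) := by
      have z : (1 : Endo N) + (0 : ℝ) • H = 1 := by ext v; simp
      rw [z]; exact hd
    exact hd'.comp_hasDerivAt (0 : ℝ) hline
  set m := LinearMap.toMatrix b b (H : Eucl N →ₗ[ℝ] Eucl N) with hm
  set q := (Matrix.det (1 + (Polynomial.X : Polynomial ℝ) • m.map Polynomial.C)).divX.divX
  have e : (fun t : ℝ => ((1 : Endo N) + t • H).det)
      = fun t => 1 + m.trace * t + q.eval t * t ^ 2 := by
    funext t
    rw [← Matrix.det_one_add_smul, ContinuousLinearMap.det, ← LinearMap.det_toMatrix b]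
    congr 1
    have : (((1 : Endo N) + t • H : Endo N) : Eucl N →ₗ[ℝ] Eucl N)
        = LinearMap.id + t • (H : Eucl N →ₗ[ℝ] Eucl N) := rfl
    rw [this, map_add, map_smul, LinearMap.toMatrix_id]
  have h2 : HasDerivAt (fun t : ℝ => 1 + m.trace * t + q.eval t * t ^ 2) m.trace 0 := by
    have a := ((hasDerivAt_id (0 : ℝ)).const_mul m.trace).const_add 1
    have c := (q.hasDerivAt (0 : ℝ)).mul ((hasDerivAt_id (0 : ℝ)).pow 2)
    exact (a.add c).congr_deriv (by simp)
  rw [e] at h1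
  rw [traceL_apply, LinearMap.trace_eq_matrix_trace ℝ b]
  exact h2.unique h1

/-- The adjoint, as a continuous linear map. -/
def adjointL (N : ℕ) : Endo N →L[ℝ] Endo N :=
  LinearMap.toContinuousLinearMap
    { toFun := fun A => ContinuousLinearMap.adjoint A
      map_add' := fun A B => map_add _ A B
      map_smul' := fun c A => by rw [map_smulₛₗ]; rfl }

/-- The map `A ↦ det(A) A⁻¹ (A⁻¹)*`. -/
def piola (A : Endo N) : Endo N :=
  A.det • (A.inverse ∘L ContinuousLinearMap.adjoint A.inverse)

/-- The derivative `H ↦ tr(H) I - H - H*` of `piola` at the identity. -/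
def piola' (N : ℕ) : Endo N →L[ℝ] Endo N :=
  (traceL N).smulRight (ContinuousLinearMap.id ℝ (Eucl N)) - ContinuousLinearMap.id ℝ (Endo N)
    - adjointL N

lemma inverse_eq : (ContinuousLinearMap.inverse : Endo N → Endo N) = Ring.inverse :=
  ContinuousLinearMap.ringInverse_eq_inverse.symm

lemma inverse_one : ContinuousLinearMap.inverse (1 : Endo N) = 1 := by
  rw [inverse_eq]; exact Ring.inverse_one _

lemma det_one : (1 : Endo N).det = 1 := by
  simp [ContinuousLinearMap.det, ContinuousLinearMap.one_def]

lemma adjoint_one : ContinuousLinearMap.adjoint (1 : Endo N) = 1 := ContinuousLinearMap.adjoint_id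

lemma piola_one : piola (1 : Endo N) = 1 := by
  rw [piola, inverse_one, det_one, adjoint_one, one_smul]; rfl

/-- Product rule at the identity: the determinant contributes `tr(H) I`, the inverse `-H` and its
adjoint `-H*`. -/
lemma hasFDerivAt_piola : HasFDerivAt (piola (N := N)) (piola' N) 1 := by
  have hinv : HasFDerivAt (ContinuousLinearMap.inverse : Endo N → Endo N)
      (-ContinuousLinearMap.id ℝ (Endo N)) 1 := by
    rw [inverse_eq]
    exact (hasFDerivAt_ringInverse (𝕜 := ℝ) (1 : (Endo N)ˣ)).congr_fderiv (by ext A v; simp)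
  have hadj : HasFDerivAt (fun A : Endo N => ContinuousLinearMap.adjoint A.inverse)
      ((adjointL N) ∘L (-ContinuousLinearMap.id ℝ (Endo N))) 1 :=
    (adjointL N).hasFDerivAt.comp (1 : Endo N) hinv
  refine ((hasFDerivAt_det (N := N)).fun_smul (hinv.clm_comp hadj)).congr_fderiv ?_
  ext A : 1
  simp only [inverse_one, det_one, adjoint_one, piola', add_apply, sub_apply,
    ContinuousLinearMap.smulRight_apply, ContinuousLinearMap.comp_apply,
    neg_apply, one_smul]
  simp [ContinuousLinearMap.one_def]
  abel

lemma isUnit_of_norm_sub_one_le {A : Endo N} (h : A ∈ Metric.closedBall (1 : Endo N) (1 / 4)) :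
    IsUnit A := by
  rw [mem_closedBall_iff_norm, norm_sub_rev] at h
  have := (Units.oneSub (1 - A) (h.trans_lt (by norm_num))).isUnit
  simpa using this

/-- The ball is connected and consists of invertible maps, so the determinant cannot change sign
from its value `1` at the identity. -/
lemma det_pos_of_norm_sub_one_le {A : Endo N} (h : A ∈ Metric.closedBall (1 : Endo N) (1 / 4)) :
    0 < A.det := by
  by_contra hneg
  have hc : ContinuousOn (fun A : Endo N => A.det) (Metric.closedBall (1 : Endo N) (1 / 4)) :=
    differentiable_det.continuous.continuousOn
  obtain ⟨B, hB, h0⟩ := (convex_closedBall (1 : Endo N) (1 / 4)).isPreconnected.intermediate_value h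
    (Metric.mem_closedBall_self (by norm_num)) hc (show (0 : ℝ) ∈ Icc A.det (1 : Endo N).det from
      ⟨not_lt.mp hneg, by rw [det_one]; exact zero_le_one⟩)
  have hu : IsUnit (LinearMap.det (B : Eucl N →ₗ[ℝ] Eucl N)) := by
    have := (isUnit_of_norm_sub_one_le hB).map
      (ContinuousLinearMap.toLinearMapRingHom : Endo N →+* (Eucl N →ₗ[ℝ] Eucl N))
    exact this.map (LinearMap.det : (Eucl N →ₗ[ℝ] Eucl N) →* ℝ)
  exact hu.ne_zero h0

lemma continuousOn_piola :
    ContinuousOn (piola (N := N)) (Metric.closedBall (1 : Endo N) (1 / 4)) := by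
  intro A hA
  have hinv : ContinuousAt (ContinuousLinearMap.inverse : Endo N → Endo N) A := by
    rw [inverse_eq]
    exact (differentiableAt_inverse (𝕜 := ℝ) (isUnit_of_norm_sub_one_le hA)).continuousAt
  have hadj : ContinuousAt (fun A : Endo N => ContinuousLinearMap.adjoint A.inverse) A :=
    (adjointL N).continuous.continuousAt.comp hinv
  exact (differentiable_det.continuous.continuousAt.smul (hinv.clm_comp hadj)).continuousWithinAt

lemma piola_symm (A : Endo N) (v w : Eucl N) : ⟪piola A v, w⟫_ℝ = ⟪v, piola A w⟫_ℝ := by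
  simp only [piola, smul_apply, ContinuousLinearMap.comp_apply, real_inner_smul_left,
    real_inner_smul_right]
  rw [← ContinuousLinearMap.adjoint_inner_right A.inverse, ContinuousLinearMap.adjoint_inner_left]

namespace ShortFlow

variable {τ M : ℝ} {V T : ℝ → Eucl N → Eucl N} (hF : ShortFlow τ M V T)
include hF

lemma fderiv_mem_closedBall {s : ℝ} (hs : s ∈ Icc 0 τ) (x : Eucl N) :
    fderiv ℝ (T s) x ∈ Metric.closedBall (1 : Endo N) (1 / 4) := by
  rw [mem_closedBall_iff_norm]
  refine (hF.norm_fderiv_sub_one_le hs x).trans ?_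
  nlinarith [hF.small, hF.M_pos, hs.1, hs.2]

lemma fderiv_zero (x : Eucl N) : fderiv ℝ (T 0) x = 1 := by
  have : T 0 = id := funext hF.initial
  rw [this, fderiv_id]; rfl

lemma jac_pos {s : ℝ} (hs : s ∈ Icc 0 τ) (x : Eucl N) : 0 < jac T s x :=
  det_pos_of_norm_sub_one_le (hF.fderiv_mem_closedBall hs x)

/-- `DT_s` takes its values in one fixed compact ball of endomorphisms, where a continuous `Φ` is
bounded. -/
lemma memLp_coefficient {G : Type*} [NormedAddCommGroup G]
    {Φ : Endo N → G} (hc : ContinuousOn Φ (Metric.closedBall 1 (1 / 4)))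
    (hΩ : MeasurableSet Ω) {s : ℝ} (hs : s ∈ Icc 0 τ) :
    MemLp (Ω.indicator fun x => Φ (fderiv ℝ (T s) x)) ∞ volume := by
  have hcont : Continuous fun x => Φ (fderiv ℝ (T s) x) :=
    hc.comp_continuous ((hF.contDiff_flow hs).continuous_fderiv one_ne_zero)
      (hF.fderiv_mem_closedBall hs)
  obtain ⟨C, hC⟩ := (isCompact_closedBall (1 : Endo N) (1 / 4)).exists_bound_of_continuousOn hc
  exact (memLp_top_of_continuous hcont fun x => hC _ (hF.fderiv_mem_closedBall hs x)).indicator hΩ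

lemma memLp_coefficient_deriv {G : Type*} [NormedAddCommGroup G] [NormedSpace ℝ G]
    (Φ' : Endo N →L[ℝ] G) (hΩ : MeasurableSet Ω) :
    MemLp (Ω.indicator fun x => Φ' (fderiv ℝ (V 0) x)) ∞ volume := by
  refine (memLp_top_of_continuous (C := ‖Φ'‖ * M) (Φ'.continuous.comp
    ((hF.contDiff 0 hF.zero_mem).continuous_fderiv one_ne_zero)) fun x => ?_).indicator hΩ
  refine (Φ'.le_opNorm _).trans ?_
  gcongr
  exact hF.bound_deriv 0 hF.zero_mem x

/-- Smooth functions of `DT_s` are differentiable at `s = 0` in the supremum norm. -/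
lemma hasDerivWithinAt_coefficient {G : Type*} [NormedAddCommGroup G] [NormedSpace ℝ G]
    {Φ : Endo N → G} {Φ' : Endo N →L[ℝ] G} (hΦ : HasFDerivAt Φ Φ' 1)
    (hc : ContinuousOn Φ (Metric.closedBall 1 (1 / 4))) (hΩ : MeasurableSet Ω) :
    HasDerivWithinAt (fun s => toLpD volume ∞ (Ω.indicator fun x => Φ (fderiv ℝ (T s) x)))
      (toLpD volume ∞ (Ω.indicator fun x => Φ' (fderiv ℝ (V 0) x))) (Ici 0) 0 := by
  have hM := hF.M_pos
  refine hasDerivWithinAt_toLpD_top hF.pos (fun s hs => hF.memLp_coefficient hc hΩ hs)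
    (hF.memLp_coefficient_deriv Φ' hΩ) fun ε hε => ?_
  -- As `‖DT_s - I‖ ≤ 2Ms`, this tolerance turns the Taylor error of `Φ` into `εs/2`.
  have hε1 : 0 < ε / (4 * M) := by positivity
  obtain ⟨δ₁, hδ₁, h1⟩ := Metric.eventually_nhds_iff.mp
    ((hasFDerivAt_iff_isLittleO_nhds_zero.mp hΦ).bound hε1)
  obtain ⟨δ₂, hδ₂, h2⟩ := hF.fderiv_expansion
    (show 0 < ε / (2 * (‖Φ'‖ + 1)) by have := norm_nonneg Φ'; positivity)
  refine ⟨min (δ₁ / (4 * M)) δ₂, by positivity, fun s hs hsδ x => ?_⟩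
  have hs0 := hs.1
  by_cases hx : x ∈ Ω
  · simp only [indicator_of_mem hx]
    set A := fderiv ℝ (T s) x
    have hA : ‖A - 1‖ ≤ 2 * M * s := hF.norm_fderiv_sub_one_le hs x
    have hlt : 2 * M * s < δ₁ := by
      have := (le_div_iff₀ (by positivity)).mp (hsδ.trans (min_le_left _ _))
      linarith [mul_nonneg hM.le hs0]
    have t1 := h1 (y := A - 1) (by rw [dist_zero_right]; exact hA.trans_lt hlt)
    rw [add_sub_cancel] at t1
    have t2 : ‖A - 1 - s • fderiv ℝ (V 0) x‖ ≤ _ := h2 s hs (hsδ.trans (min_le_right _ _)) x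
    rw [hF.fderiv_zero]
    have e : Φ A - Φ 1 - s • Φ' (fderiv ℝ (V 0) x)
        = (Φ A - Φ 1 - Φ' (A - 1)) + Φ' (A - 1 - s • fderiv ℝ (V 0) x) := by
      rw [map_sub Φ' (A - 1), map_smul]; abel
    rw [e]
    calc _ ≤ ε / (4 * M) * (2 * M * s) + (‖Φ'‖ + 1) * (ε / (2 * (‖Φ'‖ + 1)) * s) := by
          refine (norm_add_le _ _).trans (add_le_add (t1.trans (by gcongr))
            ((Φ'.le_opNorm _).trans ?_))
          gcongr
          linarith
      _ = ε * s := by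
          have := norm_nonneg Φ'
          field_simp; ring
  · simp only [indicator_of_notMem hx]
    simpa using mul_nonneg hε.le hs0

end ShortFlow

end Coefficients

/-! ### The Lagrangian as a quadratic form -/

section Forms

open scoped ENNReal NNReal

variable {N : ℕ} {Ω : Set (Eucl N)}

lemma inner_pairOp_indicator {a : Eucl N → ℝ} {b : Eucl N → Eucl N →L[ℝ] Eucl N}
    (hΩ : MeasurableSet Ω) (ha : MemLp (Ω.indicator a) ∞ volume)
    (hb : MemLp (Ω.indicator b) ∞ volume) {w z : L2Pair N} {u v : Eucl N → ℝ}
    {g h : Eucl N → Eucl N} (hu : w.fst =ᵐ[volume] u) (hg : w.snd =ᵐ[volume] g)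
    (hv : z.fst =ᵐ[volume] v) (hh : z.snd =ᵐ[volume] h) :
    IntegrableOn (fun x => ⟪b x (g x), h x⟫_ℝ) Ω ∧ IntegrableOn (fun x => a x * u x * v x) Ω ∧
      IntegrableOn (fun x => ⟪b x (g x), h x⟫_ℝ + a x * u x * v x) Ω ∧
      ⟪pairOp (Ω.indicator a) (Ω.indicator b) w, z⟫_ℝ
        = ∫ x in Ω, (⟪b x (g x), h x⟫_ℝ + a x * u x * v x) := by
  have e1 : (fun x => Ω.indicator a x * (w.fst : Eucl N → ℝ) x * (z.fst : Eucl N → ℝ) x)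
      =ᵐ[volume] Ω.indicator fun x => a x * u x * v x := by
    filter_upwards [hu, hv] with x h1 h2
    rw [h1, h2]
    by_cases hx : x ∈ Ω <;> simp [hx]
  have e2 : (fun x => ⟪Ω.indicator b x ((w.snd : Eucl N → Eucl N) x),
      (z.snd : Eucl N → Eucl N) x⟫_ℝ) =ᵐ[volume] Ω.indicator fun x => ⟪b x (g x), h x⟫_ℝ := by
    filter_upwards [hg, hh] with x h1 h2
    rw [h1, h2]
    by_cases hx : x ∈ Ω <;> simp [hx]
  have i1 : IntegrableOn (fun x => a x * u x * v x) Ω :=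
    (integrable_indicator_iff hΩ).mp ((integrable_mul_fst_fst ha w z).congr e1)
  have i2 : IntegrableOn (fun x => ⟪b x (g x), h x⟫_ℝ) Ω :=
    (integrable_indicator_iff hΩ).mp ((integrable_inner_snd_snd hb w z).congr e2)
  refine ⟨i2, i1, i2.add i1, ?_⟩
  rw [inner_pairOp ha hb, integral_congr_ae e1, integral_congr_ae e2, integral_indicator hΩ,
    integral_indicator hΩ, integral_add i2 i1, add_comm]

lemma inner_pairD_indicator {q : Eucl N → ℝ} (hΩ : MeasurableSet Ω)
    (hq : MemLp (Ω.indicator q) 2 volume) {z : L2Pair N} {v : Eucl N → ℝ}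
    (hv : z.fst =ᵐ[volume] v) : IntegrableOn (fun x => q x * v x) Ω ∧
      ⟪pairD (Ω.indicator q) 0, z⟫_ℝ = ∫ x in Ω, q x * v x := by
  have e1 : (fun x => (z.fst : Eucl N → ℝ) x * Ω.indicator q x)
      =ᵐ[volume] Ω.indicator fun x => q x * v x := by
    filter_upwards [hv] with x h1
    rw [h1]
    by_cases hx : x ∈ Ω <;> simp [hx, mul_comm]
  refine ⟨(integrable_indicator_iff hΩ).mp (((Lp.memLp z.fst).integrable_mul hq).congr e1), ?_⟩
  rw [real_inner_comm, inner_pairD z hq MemLp.zero, integral_congr_ae e1, integral_indicator hΩ]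
  simp

/-- The operator with coefficients `c J_s` and `B(s)` on `Ω`. -/
def coefOp (c : ℝ) (T : ℝ → Eucl N → Eucl N) (Ω : Set (Eucl N)) (s : ℝ) : L2Pair N →L[ℝ] L2Pair N :=
  pairOp (Ω.indicator fun x => c * jac T s x) (Ω.indicator fun x => matB T s x)

/-- The operator with coefficients `c div W` and `div W I - DW - DW*` on `Ω`. -/
def coefOp' (c : ℝ) (W : Eucl N → Eucl N) (Ω : Set (Eucl N)) : L2Pair N →L[ℝ] L2Pair N :=
  pairOp (Ω.indicator fun x => c * divergence W x) (Ω.indicator fun x => matB' W x)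

/-- The target data transported by `T_s`. -/
def targetPair (ηt ηd : Eucl N → ℝ) (T : ℝ → Eucl N → Eucl N) (s : ℝ) : L2Pair N :=
  pairD (fun x => ηd (T s x)) (weakGrad fun x => ηt (T s x))

/-- The source term transported by `T_s`. -/
def sourcePair (f : Eucl N → ℝ) (T : ℝ → Eucl N → Eucl N) (Ω : Set (Eucl N)) (s : ℝ) : L2Pair N :=
  pairD (Ω.indicator fun x => jac T s x * f (T s x)) 0

lemma matB'_eq (W : Eucl N → Eucl N) (x : Eucl N) : matB' W x = piola' N (fderiv ℝ W x) := rfl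

lemma matB_eq (T : ℝ → Eucl N → Eucl N) (s : ℝ) (x : Eucl N) :
    matB T s x = piola (fderiv ℝ (T s) x) := rfl

lemma toLpD_zero {α A : Type*} [MeasurableSpace α] {μ : Measure α} [NormedAddCommGroup A]
    [NormedSpace ℝ A] {p : ℝ≥0∞} : toLpD μ p (0 : α → A) = 0 := by
  have h : MemLp (0 : α → A) p μ := MemLp.zero
  rw [toLpD_eq h]
  exact h.toLp_zero

namespace ShortFlow

variable {τ M : ℝ} {V T : ℝ → Eucl N → Eucl N} (hF : ShortFlow τ M V T)
include hF

lemma memLp_jac (c : ℝ) (hΩ : MeasurableSet Ω) {s : ℝ} (hs : s ∈ Icc 0 τ) :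
    MemLp (Ω.indicator fun x => c * jac T s x) ∞ volume :=
  hF.memLp_coefficient (Φ := fun A => c * A.det)
    (differentiable_det.continuous.const_mul c).continuousOn hΩ hs

lemma memLp_matB (hΩ : MeasurableSet Ω) {s : ℝ} (hs : s ∈ Icc 0 τ) :
    MemLp (Ω.indicator fun x => matB T s x) ∞ volume :=
  hF.memLp_coefficient continuousOn_piola hΩ hs

lemma memLp_divergence (c : ℝ) (hΩ : MeasurableSet Ω) :
    MemLp (Ω.indicator fun x => c * divergence (V 0) x) ∞ volume :=
  hF.memLp_coefficient_deriv (c • traceL N) hΩ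

lemma memLp_matB' (hΩ : MeasurableSet Ω) : MemLp (Ω.indicator fun x => matB' (V 0) x) ∞ volume :=
  hF.memLp_coefficient_deriv (piola' N) hΩ

lemma hasDerivWithinAt_jac (c : ℝ) (hΩ : MeasurableSet Ω) :
    HasDerivWithinAt (fun s => toLpD volume ∞ (Ω.indicator fun x => c * jac T s x))
      (toLpD volume ∞ (Ω.indicator fun x => c * divergence (V 0) x)) (Ici 0) 0 :=
  hF.hasDerivWithinAt_coefficient (Φ := fun A => c * A.det) (Φ' := c • traceL N)
    ((hasFDerivAt_det (N := N)).const_mul c) (differentiable_det.continuous.const_mul c).continuousOn hΩ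

lemma hasDerivWithinAt_matB (hΩ : MeasurableSet Ω) :
    HasDerivWithinAt (fun s => toLpD volume ∞ (Ω.indicator fun x => matB T s x))
      (toLpD volume ∞ (Ω.indicator fun x => matB' (V 0) x)) (Ici 0) 0 := by
  have h := hF.hasDerivWithinAt_coefficient (Φ := piola) (Φ' := piola' N) hasFDerivAt_piola
    continuousOn_piola hΩ
  simp_rw [matB_eq, matB'_eq]
  exact h

lemma hasDerivWithinAt_coefOp (c : ℝ) (hΩ : MeasurableSet Ω) :
    HasDerivWithinAt (coefOp c T Ω) (coefOp' c (V 0) Ω) (Ici 0) 0 :=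
  hasDerivWithinAt_pairOp (hF.hasDerivWithinAt_jac c hΩ) (hF.hasDerivWithinAt_matB hΩ)

lemma coefOp_symm (c : ℝ) (hΩ : MeasurableSet Ω) {s : ℝ} (hs : s ∈ Icc 0 τ) (w z : L2Pair N) :
    ⟪coefOp c T Ω s w, z⟫_ℝ = ⟪w, coefOp c T Ω s z⟫_ℝ := by
  refine pairOp_symm (hF.memLp_jac c hΩ hs) (hF.memLp_matB hΩ hs) (fun x v w => ?_) w z
  by_cases hx : x ∈ Ω
  · simp only [indicator_of_mem hx]; exact piola_symm _ v w
  · simp [hx]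

lemma hasDerivWithinAt_targetPair {ηt ηd : Eucl N → ℝ} (hd : MemH1 ηd) (ht : MemH2 ηt) :
    HasDerivWithinAt (targetPair ηt ηd T) (pairD (fun x => ⟪weakGrad ηd x, V 0 x⟫_ℝ)
      (weakGrad fun x => ⟪weakGrad ηt x, V 0 x⟫_ℝ)) (Ici 0) 0 :=
  hasDerivWithinAt_pairD (hF.hasDerivWithinAt_comp_memH1 hd)
    (hF.hasDerivWithinAt_weakGrad_comp ht).2

lemma memLp_source {f : Eucl N → ℝ} (hf : MemLp f 2 volume) (hΩ : MeasurableSet Ω) {s : ℝ}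
    (hs : s ∈ Icc 0 τ) : MemLp (Ω.indicator fun x => jac T s x * f (T s x)) 2 volume := by
  have h := (ContinuousLinearMap.mul ℝ ℝ).memLp_of_bilin 2 (hF.memLp_jac 1 hΩ hs)
    (hF.memLp_comp hs hf)
  refine (memLp_congr_ae (ae_of_all _ fun x => ?_)).mp h
  by_cases hx : x ∈ Ω <;> simp [hx]

lemma jac_zero (x : Eucl N) : jac T 0 x = 1 := by rw [jac, hF.fderiv_zero, det_one]

lemma matB_zero (x : Eucl N) : matB T 0 x = 1 := by
  change piola (fderiv ℝ (T 0) x) = 1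
  rw [hF.fderiv_zero, piola_one]

lemma memLp_inner_velocity {g : Eucl N → Eucl N} (hg : MemLp g 2 volume) :
    MemLp (fun x => ⟪g x, V 0 x⟫_ℝ) 2 volume := by
  refine (memLp_congr_ae (ae_of_all _ fun x => ?_)).mp
    ((innerSL ℝ).memLp_of_bilin 2 hF.memLp_velocity hg)
  exact real_inner_comm (g x) (V 0 x)

lemma memLp_source_deriv {f : Eucl N → ℝ} (hf : MemH1 f) (hΩ : MeasurableSet Ω) :
    MemLp (Ω.indicator fun x => f x * divergence (V 0) x + ⟪weakGrad f x, V 0 x⟫_ℝ) 2 volume := by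
  have h1 := (ContinuousLinearMap.mul ℝ ℝ).memLp_of_bilin 2 (hF.memLp_divergence 1 hΩ) hf.1
  have h2 := (hF.memLp_inner_velocity hf.memLp_weakGrad).indicator hΩ
  refine (memLp_congr_ae (ae_of_all _ fun x => ?_)).mp (h1.add h2)
  by_cases hx : x ∈ Ω <;> simp [hx, mul_comm]

lemma hasDerivWithinAt_sourcePair {f : Eucl N → ℝ} (hf : MemH1 f) (hΩ : MeasurableSet Ω) :
    HasDerivWithinAt (sourcePair f T Ω) (pairD (Ω.indicator fun x =>
      f x * divergence (V 0) x + ⟪weakGrad f x, V 0 x⟫_ℝ) 0) (Ici 0) 0 := by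
  have hzero : HasDerivWithinAt (fun _ : ℝ => toLpD volume 2 (0 : Eucl N → Eucl N))
      (toLpD volume 2 (0 : Eucl N → Eucl N)) (Ici 0) 0 := by
    simp_rw [toLpD_zero]
    exact hasDerivWithinAt_const _ _ _
  refine hasDerivWithinAt_pairD ?_ hzero
  have hmul := (hasDerivWithinAt_mulOp (ContinuousLinearMap.mul ℝ ℝ)
    (hF.hasDerivWithinAt_jac 1 hΩ)).clm_apply (hF.hasDerivWithinAt_comp_memH1 hf)
  have key : ∀ s ∈ Icc 0 τ, toLpD volume 2 (Ω.indicator fun x => jac T s x * f (T s x))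
      = mulOp volume (ContinuousLinearMap.mul ℝ ℝ) (Ω.indicator fun x => 1 * jac T s x)
        (toLpD volume 2 fun x => f (T s x)) := fun s hs => by
    rw [mulOp_toLpD _ (hF.memLp_jac 1 hΩ hs) (hF.memLp_comp hs hf.1)]
    refine toLpD_congr (hF.memLp_source hf.1 hΩ hs) (ae_of_all _ fun x => ?_)
    by_cases hx : x ∈ Ω <;> simp [hx]
  refine (hmul.congr_of_eventuallyEq (f₁ := fun s =>
    toLpD volume 2 (Ω.indicator fun x => jac T s x * f (T s x)))
    (by filter_upwards [Icc_mem_nhdsGE hF.pos] with s hs using key s hs)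
    (key 0 hF.zero_mem)).congr_deriv ?_
  have hi := hF.memLp_inner_velocity hf.memLp_weakGrad
  have h0 := hF.memLp_comp hF.zero_mem hf.1
  have m1 := (ContinuousLinearMap.mul ℝ ℝ).memLp_of_bilin 2 (hF.memLp_divergence 1 hΩ) h0
  have m2 := (ContinuousLinearMap.mul ℝ ℝ).memLp_of_bilin 2 (hF.memLp_jac 1 hΩ hF.zero_mem) hi
  rw [mulOp_toLpD _ (hF.memLp_divergence 1 hΩ) h0, mulOp_toLpD _ (hF.memLp_jac 1 hΩ hF.zero_mem) hi,
    toLpD_eq m1, toLpD_eq m2, ← MemLp.toLp_add, toLpD_eq (hF.memLp_source_deriv hf hΩ)]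
  refine MemLp.toLp_congr _ _ (ae_of_all _ fun x => ?_)
  by_cases hx : x ∈ Ω
  · simp [hx, hF.jac_zero, hF.initial, mul_comm]
  · simp [hx]

end ShortFlow

end Forms

/-! ### The transported problem -/

section TransportedProblem

open scoped ENNReal NNReal

variable {N : ℕ} {Ω : Set (Eucl N)}

lemma coeFn_sub_fst {w z : L2Pair N} {u v : Eucl N → ℝ} (hu : w.fst =ᵐ[volume] u)
    (hv : z.fst =ᵐ[volume] v) : (w - z).fst =ᵐ[volume] fun x => u x - v x := by
  filter_upwards [Lp.coeFn_sub w.fst z.fst, hu, hv] with x h1 h2 h3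
  rw [← h2, ← h3]; exact h1

lemma coeFn_sub_snd {w z : L2Pair N} {u v : Eucl N → Eucl N} (hu : w.snd =ᵐ[volume] u)
    (hv : z.snd =ᵐ[volume] v) : (w - z).snd =ᵐ[volume] fun x => u x - v x := by
  filter_upwards [Lp.coeFn_sub w.snd z.snd, hu, hv] with x h1 h2 h3
  rw [← h2, ← h3]; exact h1

namespace ShortFlow

variable {τ M : ℝ} {V T : ℝ → Eucl N → Eucl N} (hF : ShortFlow τ M V T)
include hF

lemma inner_coefOp (c : ℝ) (hΩ : MeasurableSet Ω) {s : ℝ} (hs : s ∈ Icc 0 τ) {w z : L2Pair N}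
    {u v : Eucl N → ℝ} {g h : Eucl N → Eucl N} (hu : w.fst =ᵐ[volume] u)
    (hg : w.snd =ᵐ[volume] g) (hv : z.fst =ᵐ[volume] v) (hh : z.snd =ᵐ[volume] h) :
    IntegrableOn (fun x => ⟪matB T s x (g x), h x⟫_ℝ) Ω ∧
      IntegrableOn (fun x => c * jac T s x * u x * v x) Ω ∧
      IntegrableOn (fun x => ⟪matB T s x (g x), h x⟫_ℝ + c * jac T s x * u x * v x) Ω ∧
      ⟪coefOp c T Ω s w, z⟫_ℝ
        = ∫ x in Ω, (⟪matB T s x (g x), h x⟫_ℝ + c * jac T s x * u x * v x) :=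
  inner_pairOp_indicator hΩ (hF.memLp_jac c hΩ hs) (hF.memLp_matB hΩ hs) hu hg hv hh

lemma inner_coefOp' (c : ℝ) (hΩ : MeasurableSet Ω) {w z : L2Pair N}
    {u v : Eucl N → ℝ} {g h : Eucl N → Eucl N} (hu : w.fst =ᵐ[volume] u)
    (hg : w.snd =ᵐ[volume] g) (hv : z.fst =ᵐ[volume] v) (hh : z.snd =ᵐ[volume] h) :
    IntegrableOn (fun x => ⟪matB' (V 0) x (g x), h x⟫_ℝ) Ω ∧
      IntegrableOn (fun x => c * divergence (V 0) x * u x * v x) Ω ∧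
      IntegrableOn (fun x => ⟪matB' (V 0) x (g x), h x⟫_ℝ
        + c * divergence (V 0) x * u x * v x) Ω ∧
      ⟪coefOp' c (V 0) Ω w, z⟫_ℝ
        = ∫ x in Ω, (⟪matB' (V 0) x (g x), h x⟫_ℝ + c * divergence (V 0) x * u x * v x) :=
  inner_pairOp_indicator hΩ (hF.memLp_divergence c hΩ) (hF.memLp_matB' hΩ) hu hg hv hh

lemma inner_sourcePair {f : Eucl N → ℝ} (hf : MemLp f 2 volume) (hΩ : MeasurableSet Ω) {s : ℝ}
    (hs : s ∈ Icc 0 τ) {z : L2Pair N} {v : Eucl N → ℝ} (hv : z.fst =ᵐ[volume] v) :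
    IntegrableOn (fun x => jac T s x * f (T s x) * v x) Ω ∧
      ⟪sourcePair f T Ω s, z⟫_ℝ = ∫ x in Ω, jac T s x * f (T s x) * v x :=
  inner_pairD_indicator hΩ (hF.memLp_source hf hΩ hs) hv

lemma coeFn_targetPair_fst {ηt ηd : Eucl N → ℝ} (hd : MemH1 ηd) {s : ℝ} (hs : s ∈ Icc 0 τ) :
    (targetPair ηt ηd T s).fst =ᵐ[volume] fun x => ηd (T s x) :=
  coeFn_toLpD (hF.memLp_comp hs hd.1)

lemma coeFn_targetPair_snd {ηt ηd : Eucl N → ℝ} (ht : MemH1 ηt) {s : ℝ} (hs : s ∈ Icc 0 τ) :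
    (targetPair ηt ηd T s).snd =ᵐ[volume] weakGrad fun x => ηt (T s x) :=
  coeFn_toLpD (hF.memH1_comp ht hs).memLp_weakGrad

/-- One family of operators serves both forms: the zeroth-order coefficient `J_s` gives the cost,
and `-k² J_s` the Helmholtz form. -/
lemma lagrangian_eq (k : ℝ) {f ηt ηd : Eucl N → ℝ} (hf : MemH1 f) (hd : MemH1 ηd) (ht : MemH1 ηt)
    (hΩ : MeasurableSet Ω) {s : ℝ} (hs : s ∈ Icc 0 τ) (φ ψ : H10 Ω) :
    lagrangian k f ηt ηd T Ω s φ ψ = quadLagrangian (coefOp 1 T Ω s) (coefOp (-k ^ 2) T Ω s)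
      (targetPair ηt ηd T s) (sourcePair f T Ω s) φ ψ := by
  have e1 : (φ : L2Pair N).fst =ᵐ[volume] fn φ := ae_eq_refl _
  have e2 : (φ : L2Pair N).snd =ᵐ[volume] grad φ := ae_eq_refl _
  have e3 : (ψ : L2Pair N).fst =ᵐ[volume] fn ψ := ae_eq_refl _
  have e4 : (ψ : L2Pair N).snd =ᵐ[volume] grad ψ := ae_eq_refl _
  have d1 := coeFn_sub_fst e1 (hF.coeFn_targetPair_fst (ηt := ηt) hd hs)
  have d2 := coeFn_sub_snd e2 (hF.coeFn_targetPair_snd (ηd := ηd) ht hs)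
  obtain ⟨-, -, -, h1⟩ := hF.inner_coefOp 1 hΩ hs d1 d2 d1 d2
  obtain ⟨-, -, i34, h2⟩ := hF.inner_coefOp (-k ^ 2) hΩ hs e1 e2 e3 e4
  obtain ⟨i5, h3⟩ := hF.inner_sourcePair hf.1 hΩ hs e3
  rw [quadLagrangian, h1, h2, h3, lagrangian, add_sub_assoc, ← integral_sub i34 i5]
  congr 1
  · refine integral_congr_ae (ae_of_all _ fun x => ?_)
    simp only [sq_abs]; ring
  · refine integral_congr_ae (ae_of_all _ fun x => ?_)
    simp only; ring

lemma isState_iff (k : ℝ) {f : Eucl N → ℝ} (hf : MemH1 f) (hΩ : MeasurableSet Ω) (u : H10 Ω) :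
    IsState k f Ω u ↔ ∀ v : H10 Ω, ⟪coefOp (-k ^ 2) T Ω 0 (u : L2Pair N), (v : L2Pair N)⟫_ℝ
      = ⟪sourcePair f T Ω 0, (v : L2Pair N)⟫_ℝ := by
  refine forall_congr' fun v => ?_
  have e1 : (u : L2Pair N).fst =ᵐ[volume] fn u := ae_eq_refl _
  have e2 : (u : L2Pair N).snd =ᵐ[volume] grad u := ae_eq_refl _
  have e3 : (v : L2Pair N).fst =ᵐ[volume] fn v := ae_eq_refl _
  have e4 : (v : L2Pair N).snd =ᵐ[volume] grad v := ae_eq_refl _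
  obtain ⟨-, -, -, h2⟩ := hF.inner_coefOp (-k ^ 2) hΩ hF.zero_mem e1 e2 e3 e4
  obtain ⟨-, h3⟩ := hF.inner_sourcePair hf.1 hΩ hF.zero_mem e3
  rw [h2, h3]
  simp only [hF.jac_zero, hF.matB_zero, hF.initial, one_mul, mul_one,
    one_apply_eq_self, neg_mul, ← sub_eq_add_neg]

lemma isAdjoint_iff (k : ℝ) {ηt ηd : Eucl N → ℝ} (hd : MemH1 ηd) (ht : MemH1 ηt)
    (hΩ : MeasurableSet Ω) (η q : H10 Ω) : IsAdjoint k ηt ηd Ω η q ↔ ∀ v : H10 Ω,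
      2 * ⟪coefOp 1 T Ω 0 ((η : L2Pair N) - targetPair ηt ηd T 0), (v : L2Pair N)⟫_ℝ
        + ⟪coefOp (-k ^ 2) T Ω 0 (q : L2Pair N), (v : L2Pair N)⟫_ℝ = 0 := by
  refine forall_congr' fun v => ?_
  have e1 : (η : L2Pair N).fst =ᵐ[volume] fn η := ae_eq_refl _
  have e2 : (η : L2Pair N).snd =ᵐ[volume] grad η := ae_eq_refl _
  have e3 : (v : L2Pair N).fst =ᵐ[volume] fn v := ae_eq_refl _
  have e4 : (v : L2Pair N).snd =ᵐ[volume] grad v := ae_eq_refl _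
  have e5 : (q : L2Pair N).fst =ᵐ[volume] fn q := ae_eq_refl _
  have e6 : (q : L2Pair N).snd =ᵐ[volume] grad q := ae_eq_refl _
  have d1 := coeFn_sub_fst e1 (hF.coeFn_targetPair_fst (ηt := ηt) hd hF.zero_mem)
  have d2 := coeFn_sub_snd e2 (hF.coeFn_targetPair_snd (ηd := ηd) ht hF.zero_mem)
  obtain ⟨-, -, i12, h1⟩ := hF.inner_coefOp 1 hΩ hF.zero_mem d1 d2 e3 e4
  obtain ⟨-, -, i34, h2⟩ := hF.inner_coefOp (-k ^ 2) hΩ hF.zero_mem e5 e6 e3 e4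
  rw [h1, h2, ← integral_const_mul, ← integral_add (i12.const_mul 2) i34]
  simp only [hF.jac_zero, hF.matB_zero, hF.initial, one_mul, mul_one,
    one_apply_eq_self]
  refine Eq.congr (integral_congr_ae (ae_of_all _ fun x => ?_)) rfl
  simp only; ring

lemma shapeDerivative_eq (k : ℝ) {f ηt ηd : Eucl N → ℝ} (hf : MemH1 f) (hd : MemH1 ηd)
    (ht : MemH2 ηt) (hΩ : MeasurableSet Ω) (η p : H10 Ω) :
    ⟪coefOp' 1 (V 0) Ω ((η : L2Pair N) - targetPair ηt ηd T 0),
        (η : L2Pair N) - targetPair ηt ηd T 0⟫_ℝ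
      - 2 * ⟪coefOp 1 T Ω 0 ((η : L2Pair N) - targetPair ηt ηd T 0),
          pairD (fun x => ⟪weakGrad ηd x, V 0 x⟫_ℝ) (weakGrad fun x => ⟪weakGrad ηt x, V 0 x⟫_ℝ)⟫_ℝ
      + ⟪coefOp' (-k ^ 2) (V 0) Ω (η : L2Pair N), (p : L2Pair N)⟫_ℝ
      - ⟪pairD (Ω.indicator fun x => f x * divergence (V 0) x + ⟪weakGrad f x, V 0 x⟫_ℝ) 0,
          (p : L2Pair N)⟫_ℝ = shapeDerivative k f ηt ηd (V 0) Ω η p := by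
  have e1 : (η : L2Pair N).fst =ᵐ[volume] fn η := ae_eq_refl _
  have e2 : (η : L2Pair N).snd =ᵐ[volume] grad η := ae_eq_refl _
  have e5 : (p : L2Pair N).fst =ᵐ[volume] fn p := ae_eq_refl _
  have e6 : (p : L2Pair N).snd =ᵐ[volume] grad p := ae_eq_refl _
  have d1 := coeFn_sub_fst e1 (hF.coeFn_targetPair_fst (ηt := ηt) hd hF.zero_mem)
  have d2 := coeFn_sub_snd e2 (hF.coeFn_targetPair_snd (ηd := ηd) ht.1 hF.zero_mem)
  have g1 : (pairD (fun x => ⟪weakGrad ηd x, V 0 x⟫_ℝ)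
      (weakGrad fun x => ⟪weakGrad ηt x, V 0 x⟫_ℝ)).fst
      =ᵐ[volume] fun x => ⟪weakGrad ηd x, V 0 x⟫_ℝ :=
    coeFn_toLpD (hF.memLp_inner_velocity hd.memLp_weakGrad)
  have g2 : (pairD (fun x => ⟪weakGrad ηd x, V 0 x⟫_ℝ)
      (weakGrad fun x => ⟪weakGrad ηt x, V 0 x⟫_ℝ)).snd
      =ᵐ[volume] weakGrad fun x => ⟪weakGrad ηt x, V 0 x⟫_ℝ :=
    coeFn_toLpD (hF.hasDerivWithinAt_weakGrad_comp ht).1.memLp_weakGrad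
  obtain ⟨i1, i2, -, h1⟩ := hF.inner_coefOp' 1 hΩ d1 d2 d1 d2
  obtain ⟨i3, i4, -, h2⟩ := hF.inner_coefOp 1 hΩ hF.zero_mem d1 d2 g1 g2
  obtain ⟨-, -, i56, h3⟩ := hF.inner_coefOp' (-k ^ 2) hΩ e1 e2 e5 e6
  obtain ⟨i7, h4⟩ := inner_pairD_indicator hΩ (hF.memLp_source_deriv hf hΩ) e5
  rw [h1, h2, h3, h4, integral_add i1 i2, integral_add i3 i4, mul_add, add_sub_assoc _ (integral _ _),
    ← integral_sub i56 i7]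
  simp only [hF.jac_zero, hF.matB_zero, hF.initial, one_mul, mul_one,
    one_apply_eq_self] at i1 i2 i3 i4 ⊢
  -- The abstract formula groups the terms by operator, the explicit one by gradient part and
  -- function part.
  have s1 : ∀ a b c d : ℝ, a + b - (c + d) = (a - c) + (b - d) := fun a b c d => by ring
  rw [shapeDerivative, s1, ← integral_const_mul, ← integral_const_mul,
    ← integral_sub i1 (i3.const_mul 2), ← integral_sub i2 (i4.const_mul 2)]
  congr 1
  · congr 1
    refine integral_congr_ae (ae_of_all _ fun x => ?_)
    simp only [sq_abs]; ring
  · refine integral_congr_ae (ae_of_all _ fun x => ?_)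
    simp only; ring

end ShortFlow

end TransportedProblem

/-! ### The problem in the perturbed domains -/

section PerturbedDomains

open scoped ENNReal NNReal

variable {N : ℕ} {Ω : Set (Eucl N)}

lemma compOp_compOp {P Q : Eucl N → Eucl N} (hP : AntilipschitzWith 2 P) (hPd : ContDiff ℝ 1 P)
    (hPl : LipschitzWith 2 P) (hQ : AntilipschitzWith 2 Q) (hQd : ContDiff ℝ 1 Q)
    (hQl : LipschitzWith 2 Q) (hQP : ∀ x, Q (P x) = x) (w : L2Pair N) :
    compOp P hP hPd.continuous (compOp Q hQ hQd.continuous w) = w := by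
  have hq := quasiMeasurePreserving_of_antilipschitz hP hPd.continuous.measurable
  refine L2Pair.ext (Lp.ext ?_) (Lp.ext ?_)
  · filter_upwards [coeFn_compOp_fst hP hPd.continuous (compOp Q hQ hQd.continuous w),
      hq.ae (coeFn_compOp_fst hQ hQd.continuous w)] with x h1 h2
    rw [h1, h2, hQP]
  · filter_upwards [coeFn_compOp_snd hP hPd hPl (compOp Q hQ hQd.continuous w),
      hq.ae (coeFn_compOp_snd hQ hQd hQl w)] with x h1 h2
    rw [h1, h2, hQP]
    -- Differentiating `Q ∘ P = id` and taking adjoints shows that the two gradient factors cancel.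
    have hd : HasFDerivAt (fun x => Q (P x)) (fderiv ℝ Q (P x) ∘L fderiv ℝ P x) x :=
      (hQd.differentiable one_ne_zero (P x)).hasFDerivAt.comp x
        (hPd.differentiable one_ne_zero x).hasFDerivAt
    simp_rw [hQP] at hd
    have e := hd.unique (hasFDerivAt_id x)
    have e2 := congrArg ContinuousLinearMap.adjoint e
    rw [ContinuousLinearMap.adjoint_comp, ContinuousLinearMap.adjoint_id] at e2
    exact DFunLike.congr_fun e2 _

/-- The reason for the form of `B(s)`: gradients of composed functions carry the factor `DT_s*`, and
`B(s)` removes both factors, leaving the Jacobian of the change of variables. -/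
lemma inner_piola_adjoint {A : Endo N} (hA : IsUnit A) (v w : Eucl N) :
    ⟪piola A (ContinuousLinearMap.adjoint A v), ContinuousLinearMap.adjoint A w⟫_ℝ
      = A.det * ⟪v, w⟫_ℝ := by
  have h1 : A ∘L A.inverse = ContinuousLinearMap.id ℝ (Eucl N) := by
    have := Ring.mul_inverse_cancel A hA
    rw [inverse_eq]; exact this
  have h2 : ContinuousLinearMap.adjoint A.inverse (ContinuousLinearMap.adjoint A v) = v := by
    have := congrArg ContinuousLinearMap.adjoint h1
    rw [ContinuousLinearMap.adjoint_comp, ContinuousLinearMap.adjoint_id] at this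
    exact DFunLike.congr_fun this v
  have h3 : A (A.inverse v) = v := DFunLike.congr_fun h1 v
  rw [piola, smul_apply, ContinuousLinearMap.comp_apply, h2, real_inner_smul_left,
    ContinuousLinearMap.adjoint_inner_right, h3]

namespace ShortFlow

variable {τ M : ℝ} {V T : ℝ → Eucl N → Eucl N} (hF : ShortFlow τ M V T)
include hF

/-- Composition with `T_s` on pairs `(u, ∇u)`. -/
def pullback {s : ℝ} (hs : s ∈ Icc 0 τ) : L2Pair N →L[ℝ] L2Pair N :=
  compOp (T s) (hF.nearId hs).antilipschitz (hF.nearId hs).contDiff.continuous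

/-- Composition with the inverse of `T_s` on pairs `(u, ∇u)`. -/
def pushforward {s : ℝ} (hs : s ∈ Icc 0 τ) : L2Pair N →L[ℝ] L2Pair N :=
  compOp (hF.nearId hs).toHomeo.symm (hF.nearId hs).antilipschitz_symm
    (hF.nearId hs).contDiff_symm.continuous

lemma pullback_pushforward {s : ℝ} (hs : s ∈ Icc 0 τ) (w : L2Pair N) :
    hF.pullback hs (hF.pushforward hs w) = w :=
  have hn := hF.nearId hs
  compOp_compOp hn.antilipschitz hn.contDiff hn.lipschitz hn.antilipschitz_symm hn.contDiff_symm
    hn.lipschitz_symm (fun x => hn.toHomeo.symm_apply_apply x) w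

lemma pushforward_pullback {s : ℝ} (hs : s ∈ Icc 0 τ) (w : L2Pair N) :
    hF.pushforward hs (hF.pullback hs w) = w :=
  have hn := hF.nearId hs
  compOp_compOp hn.antilipschitz_symm hn.contDiff_symm hn.lipschitz_symm hn.antilipschitz
    hn.contDiff hn.lipschitz (fun x => hn.toHomeo.apply_symm_apply x) w

lemma isOpen_image (hΩ : IsOpen Ω) {s : ℝ} (hs : s ∈ Icc 0 τ) : IsOpen (T s '' Ω) :=
  (hF.nearId hs).toHomeo.isOpenMap Ω hΩ

lemma pullback_mem (hΩ : IsOpen Ω) {s : ℝ} (hs : s ∈ Icc 0 τ) {w : L2Pair N}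
    (hw : w ∈ H10 (T s '' Ω)) : hF.pullback hs w ∈ H10 Ω :=
  have hn := hF.nearId hs
  compOp_mem_H10 hn.toHomeo hn.antilipschitz hn.contDiff hn.lipschitz hΩ hw

lemma pushforward_mem (hΩ : IsOpen Ω) {s : ℝ} (hs : s ∈ Icc 0 τ) {w : L2Pair N}
    (hw : w ∈ H10 Ω) : hF.pushforward hs w ∈ H10 (T s '' Ω) := by
  have hn := hF.nearId hs
  refine compOp_mem_H10 hn.toHomeo.symm hn.antilipschitz_symm hn.contDiff_symm hn.lipschitz_symm
    (hF.isOpen_image hΩ hs) ?_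
  have : hn.toHomeo.symm '' (T s '' Ω) = Ω := by
    exact hn.toHomeo.toEquiv.symm_image_image Ω
  rwa [this]

lemma setIntegral_image {s : ℝ} (hs : s ∈ Icc 0 τ) (hΩ : MeasurableSet Ω) (g : Eucl N → ℝ) :
    ∫ x in T s '' Ω, g x = ∫ x in Ω, jac T s x * g (T s x) := by
  have hn := hF.nearId hs
  rw [integral_image_eq_integral_abs_det_fderiv_smul volume hΩ
    (fun x _ => (hn.contDiff.differentiable one_ne_zero x).hasFDerivAt.hasFDerivWithinAt)
    hn.toHomeo.injective.injOn]
  refine integral_congr_ae (ae_of_all _ fun x => ?_)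
  simp only [smul_eq_mul]
  rw [show |(fderiv ℝ (T s) x).det| = jac T s x from abs_of_pos (hF.jac_pos hs x)]

lemma inner_coefOp_pullback (c : ℝ) (hΩ : MeasurableSet Ω) {s : ℝ} (hs : s ∈ Icc 0 τ)
    (w z : L2Pair N) : ⟪coefOp c T Ω s (hF.pullback hs w), hF.pullback hs z⟫_ℝ
      = ∫ x in T s '' Ω, (⟪(w.snd : Eucl N → Eucl N) x, (z.snd : Eucl N → Eucl N) x⟫_ℝ
        + c * (w.fst : Eucl N → ℝ) x * (z.fst : Eucl N → ℝ) x) := by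
  have hn := hF.nearId hs
  obtain ⟨-, -, -, h⟩ := hF.inner_coefOp c hΩ hs
    (coeFn_compOp_fst hn.antilipschitz hn.contDiff.continuous w)
    (coeFn_compOp_snd hn.antilipschitz hn.contDiff hn.lipschitz w)
    (coeFn_compOp_fst hn.antilipschitz hn.contDiff.continuous z)
    (coeFn_compOp_snd hn.antilipschitz hn.contDiff hn.lipschitz z)
  rw [hF.setIntegral_image hs hΩ]
  refine h.trans (integral_congr_ae (ae_of_all _ fun x => ?_))
  simp only
  rw [matB_eq, inner_piola_adjoint (isUnit_of_norm_sub_one_le (hF.fderiv_mem_closedBall hs x)), jac]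
  ring

lemma inner_sourcePair_pullback {f : Eucl N → ℝ} (hf : MemLp f 2 volume) (hΩ : MeasurableSet Ω)
    {s : ℝ} (hs : s ∈ Icc 0 τ) (z : L2Pair N) :
    ⟪sourcePair f T Ω s, hF.pullback hs z⟫_ℝ
      = ∫ x in T s '' Ω, f x * (z.fst : Eucl N → ℝ) x := by
  have hn := hF.nearId hs
  obtain ⟨-, h⟩ := hF.inner_sourcePair hf hΩ hs
    (coeFn_compOp_fst hn.antilipschitz hn.contDiff.continuous z)
  rw [hF.setIntegral_image hs hΩ]
  refine h.trans (integral_congr_ae (ae_of_all _ fun x => ?_))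
  simp only
  ring

lemma targetPair_eq {ηt ηd : Eucl N → ℝ} (hd : MemH1 ηd) (ht : MemH1 ηt) {s : ℝ}
    (hs : s ∈ Icc 0 τ) : targetPair ηt ηd T s = hF.pullback hs (pairD ηd (weakGrad ηt)) := by
  have hn := hF.nearId hs
  have h := compOp_pairD_of_memLp hn.antilipschitz hn.contDiff hn.lipschitz hd.1 ht.memLp_weakGrad
  have e : targetPair ηt ηd T s = pairD (fun x => ηd (T s x)) fun x =>
      ContinuousLinearMap.adjoint (fderiv ℝ (T s) x) (weakGrad ηt (T s x)) :=
    L2Pair.ext rfl (toLpD_congr (hF.memH1_comp ht hs).memLp_weakGrad (hF.weakGrad_comp ht hs))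
  exact e.trans h.symm

/-- The pullback preserves both sides of the equation, and it is a bijection between the spaces of
test functions on `Ω_s` and on `Ω`. -/
lemma isState_image_iff (k : ℝ) {f : Eucl N → ℝ} (hf : MemH1 f) (hΩ : IsOpen Ω) {s : ℝ}
    (hs : s ∈ Icc 0 τ) (w : H10 (T s '' Ω)) : IsState k f (T s '' Ω) w ↔
      ∀ v : H10 Ω, ⟪coefOp (-k ^ 2) T Ω s (hF.pullback hs (w : L2Pair N)), (v : L2Pair N)⟫_ℝ
        = ⟪sourcePair f T Ω s, (v : L2Pair N)⟫_ℝ := by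
  have key : ∀ v : H10 (T s '' Ω),
      ⟪coefOp (-k ^ 2) T Ω s (hF.pullback hs (w : L2Pair N)), hF.pullback hs (v : L2Pair N)⟫_ℝ
        = (∫ x in T s '' Ω, (⟪grad w x, grad v x⟫_ℝ - k ^ 2 * fn w x * fn v x)) ∧
      ⟪sourcePair f T Ω s, hF.pullback hs (v : L2Pair N)⟫_ℝ = ∫ x in T s '' Ω, f x * fn v x := by
    intro v
    refine ⟨?_, hF.inner_sourcePair_pullback hf.1 hΩ.measurableSet hs v⟩
    rw [hF.inner_coefOp_pullback _ hΩ.measurableSet hs]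
    simp only [neg_mul, ← sub_eq_add_neg]
    rfl
  constructor
  · intro h v
    have := h ⟨hF.pushforward hs v, hF.pushforward_mem hΩ hs v.2⟩
    rw [← (key _).1, ← (key _).2, hF.pullback_pushforward] at this
    exact this
  · intro h v
    rw [← (key v).1, ← (key v).2]
    exact h ⟨hF.pullback hs v, hF.pullback_mem hΩ hs v.2⟩

lemma cost_image_eq {ηt ηd : Eucl N → ℝ} (hd : MemH1 ηd) (ht : MemH1 ηt) (hΩ : IsOpen Ω) {s : ℝ}
    (hs : s ∈ Icc 0 τ) (w : H10 (T s '' Ω)) : cost ηt ηd (T s '' Ω) w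
      = ⟪coefOp 1 T Ω s (hF.pullback hs (w : L2Pair N) - targetPair ηt ηd T s),
        hF.pullback hs (w : L2Pair N) - targetPair ηt ηd T s⟫_ℝ := by
  have hm := (hF.isOpen_image hΩ hs).measurableSet
  rw [hF.targetPair_eq hd ht hs, ← map_sub, hF.inner_coefOp_pullback 1 hΩ.measurableSet hs]
  have e1 : (w : L2Pair N).fst =ᵐ[volume] fn w := ae_eq_refl _
  have e2 : (w : L2Pair N).snd =ᵐ[volume] grad w := ae_eq_refl _
  have e3 : (pairD ηd (weakGrad ηt)).fst =ᵐ[volume] ηd := coeFn_toLpD hd.1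
  have e4 : (pairD ηd (weakGrad ηt)).snd =ᵐ[volume] weakGrad ηt := coeFn_toLpD ht.memLp_weakGrad
  have d1 := coeFn_sub_fst e1 e3
  have d2 := coeFn_sub_snd e2 e4
  set z := (w : L2Pair N) - pairD ηd (weakGrad ηt)
  have i1 : Integrable (fun x => ‖grad w x - weakGrad ηt x‖ ^ 2) volume := by
    refine ((memLp_two_iff_integrable_sq_norm (Lp.memLp z.snd).1).mp (Lp.memLp z.snd)).congr ?_
    filter_upwards [d2] with x h
    rw [h]
  have i2 : Integrable (fun x => |fn w x - ηd x| ^ 2) volume := by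
    refine ((memLp_two_iff_integrable_sq_norm (Lp.memLp z.fst).1).mp (Lp.memLp z.fst)).congr ?_
    filter_upwards [d1] with x h
    rw [h, Real.norm_eq_abs]
  rw [cost, ← integral_add i1.integrableOn i2.integrableOn]
  refine integral_congr_ae (ae_restrict_of_ae ?_)
  filter_upwards [d1, d2] with x h1 h2
  rw [h1, h2, real_inner_self_eq_norm_sq, sq_abs]; ring

/-- Transport of the state to the perturbed domain. -/
theorem exists_state_image (k : ℝ) {f ηt ηd : Eucl N → ℝ} (hf : MemH1 f) (hd : MemH1 ηd)
    (ht : MemH1 ηt) (hΩ : IsOpen Ω) {s : ℝ} (hs : s ∈ Icc 0 τ) {η : H10 Ω}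
    (hη : ∀ u : H10 Ω, (∀ v : H10 Ω, ⟪coefOp (-k ^ 2) T Ω s (u : L2Pair N), (v : L2Pair N)⟫_ℝ
      = ⟪sourcePair f T Ω s, (v : L2Pair N)⟫_ℝ) ↔ u = η) :
    (∃ us : H10 (T s '' Ω), (∀ w, IsState k f (T s '' Ω) w ↔ w = us) ∧
      ∀ᵐ x ∂(volume.restrict Ω), fn η x = fn us (T s x)) ∧
    ⟪coefOp 1 T Ω s ((η : L2Pair N) - targetPair ηt ηd T s),
      (η : L2Pair N) - targetPair ηt ηd T s⟫_ℝ = shapeJ k f ηt ηd (T s '' Ω) := by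
  have hn := hF.nearId hs
  set us : H10 (T s '' Ω) := ⟨hF.pushforward hs η, hF.pushforward_mem hΩ hs η.2⟩
  have hpull : hF.pullback hs (us : L2Pair N) = η := hF.pullback_pushforward hs η
  have hst : ∀ w, IsState k f (T s '' Ω) w ↔ w = us := fun w => by
    rw [hF.isState_image_iff k hf hΩ hs w,
      hη ⟨hF.pullback hs w, hF.pullback_mem hΩ hs w.2⟩]
    constructor
    · intro h
      have h' : hF.pullback hs (w : L2Pair N) = η := congrArg Subtype.val h
      refine Subtype.ext ?_
      rw [← hF.pushforward_pullback hs (w : L2Pair N), h']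
    · rintro rfl
      exact Subtype.ext hpull
  refine ⟨⟨us, hst, ae_restrict_of_ae ?_⟩, ?_⟩
  · have h := coeFn_compOp_fst hn.antilipschitz hn.contDiff.continuous (us : L2Pair N)
    have e : compOp (T s) hn.antilipschitz hn.contDiff.continuous (us : L2Pair N) = η := hpull
    rw [e] at h
    exact h
  · have hex : ∃ u : H10 (T s '' Ω), IsState k f (T s '' Ω) u := ⟨us, (hst us).mpr rfl⟩
    have hch : hex.choose = us := (hst _).mp hex.choose_spec
    rw [shapeJ, dif_pos hex, hch, hF.cost_image_eq hd ht hΩ hs us, hpull]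

end ShortFlow

end PerturbedDomains

/-! ### Rellich's theorem and the Fredholm alternative -/

section Fredholm

open scoped ENNReal NNReal

variable {N : ℕ} {Ω : Set (Eucl N)}

instance fact_two_ne_top : Fact ((2 : ℝ≥0∞) ≠ ⊤) := ⟨by simp⟩

instance : SecondCountableTopology (L2Pair N) :=
  have : SecondCountableTopology (Lp ℝ 2 (volume : Measure (Eucl N))) := inferInstance
  have : SecondCountableTopology (Lp (Eucl N) 2 (volume : Measure (Eucl N))) := inferInstance
  (L2Pair.equiv N).toHomeomorph.isInducing.secondCountableTopology

instance : SecondCountableTopology (H10 Ω) :=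
  inferInstanceAs (SecondCountableTopology (H10 Ω : Set (L2Pair N)))

instance : CompleteSpace (H10 Ω) := isClosed_H10.completeSpace_coe

/-- Sequential Banach–Alaoglu in the dual, which needs separability, brought back by the Riesz
isomorphism. -/
lemma exists_weak_limit {E : Type*} [NormedAddCommGroup E] [InnerProductSpace ℝ E]
    [CompleteSpace E] [TopologicalSpace.SeparableSpace E] {u : ℕ → E} {C : ℝ}
    (hu : ∀ n, ‖u n‖ ≤ C) : ∃ (x : E) (φ : ℕ → ℕ), StrictMono φ ∧
      ∀ v, Tendsto (fun n => ⟪u (φ n), v⟫_ℝ) atTop (𝓝 ⟪x, v⟫_ℝ) := by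
  set y : ℕ → WeakDual ℝ E := fun n =>
    StrongDual.toWeakDual (InnerProductSpace.toDual ℝ E (u n)) with hy
  have hmem : ∀ n, y n ∈ WeakDual.toStrongDual ⁻¹' Metric.closedBall (0 : StrongDual ℝ E) C :=
    fun n => by
      rw [mem_preimage, mem_closedBall_zero_iff]
      change ‖InnerProductSpace.toDual ℝ E (u n)‖ ≤ C
      rw [LinearIsometryEquiv.norm_map]
      exact hu n
  obtain ⟨a, -, φ, hφ, ha⟩ := WeakDual.isSeqCompact_closedBall ℝ E 0 C hmem
  refine ⟨(InnerProductSpace.toDual ℝ E).symm (WeakDual.toStrongDual a), φ, hφ, fun v => ?_⟩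
  rw [InnerProductSpace.toDual_symm_apply]
  exact ((WeakDual.eval_continuous v).tendsto a).comp ha

lemma nearId_translate (t : Eucl N) : NearId fun x : Eucl N => x - t where
  contDiff := contDiff_id.sub contDiff_const
  lip x y := by
    have : x - t - x - (y - t - y) = 0 := by abel
    rw [this, norm_zero]; positivity

/-- Translations are maps close to the identity, so the difference-quotient estimate applies to
them. The rate is uniform on bounded sets of `H¹₀(Ω)`, which is the compactness mechanism in
Rellich's theorem. -/
lemma eLpNorm_mollify_sub_le_gradient (ρ : ContDiffBump (0 : Eucl N)) {w : L2Pair N}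
    (hw : w ∈ H10 Ω) : eLpNorm (fun x => mollify ρ w.fst x - (w.fst : Eucl N → ℝ) x) 2 volume
      ≤ ENNReal.ofReal (ρ.rOut * 2 ^ N * ‖w‖) := by
  refine eLpNorm_mollify_sub_le ρ (Lp.memLp w.fst) fun t ht => ?_
  have hn := nearId_translate t
  have h := norm_compLp_sub_le hn ρ.rOut_pos.le (fun x => by simpa using ht.le) hw
  have h2 : ‖compLp (fun x => x - t) hn.antilipschitz hn.contDiff.continuous w.fst - w.fst‖
      ≤ ρ.rOut * 2 ^ N * ‖w‖ := by
    refine h.trans ?_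
    have := ρ.rOut_pos
    gcongr
    exact WithLp.norm_snd_le _ _
  have e : (fun x => (w.fst : Eucl N → ℝ) (x - t) - (w.fst : Eucl N → ℝ) x) =ᵐ[volume]
      (compLp (fun x => x - t) hn.antilipschitz hn.contDiff.continuous w.fst - w.fst :
        Lp ℝ 2 (volume : Measure (Eucl N))) := by
    filter_upwards [Lp.coeFn_sub (compLp (fun x => x - t) hn.antilipschitz
      hn.contDiff.continuous w.fst) w.fst, coeFn_compLp hn.antilipschitz hn.contDiff.continuous w.fst] with x h1 h3
    rw [h1, Pi.sub_apply, h3]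
  rw [eLpNorm_congr_ae e]
  rw [Lp.norm_def] at h2
  exact (ENNReal.le_ofReal_iff_toReal_le (Lp.memLp _).2.ne
    (by have := ρ.rOut_pos; positivity)).mpr h2

lemma memLp_bump_sub (ρ : ContDiffBump (0 : Eucl N)) (x : Eucl N) :
    MemLp (fun t => ρ.normed volume (x - t)) 2 volume ∧
      eLpNorm (fun t => ρ.normed volume (x - t)) 2 volume
        = eLpNorm (ρ.normed volume) 2 volume := by
  have h : MemLp (ρ.normed volume) 2 volume :=
    memLp_of_contDiff_one (ρ.contDiff_normed (μ := volume) (n := 1)) ρ.hasCompactSupport_normed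
  have hm : MeasurePreserving (fun t : Eucl N => x - t) volume volume :=
    Measure.measurePreserving_sub_left volume x
  have e : (fun t => ρ.normed volume (x - t)) = ρ.normed volume ∘ fun t => x - t := rfl
  rw [e]
  exact ⟨h.comp_measurePreserving hm, eLpNorm_comp_measurePreserving h.1 hm⟩

/-- The representer of the functional `w ↦ (ρ * w)(x)`. -/
def bumpPair (ρ : ContDiffBump (0 : Eucl N)) (x : Eucl N) : L2Pair N :=
  pairD (fun t => ρ.normed volume (x - t)) 0

lemma inner_bumpPair (ρ : ContDiffBump (0 : Eucl N)) (x : Eucl N) (w : L2Pair N) :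
    ⟪w, bumpPair ρ x⟫_ℝ = mollify ρ w.fst x := by
  rw [bumpPair, inner_pairD w (memLp_bump_sub ρ x).1 MemLp.zero, mollify_apply']
  simp [mul_comm]

lemma norm_bumpPair (ρ : ContDiffBump (0 : Eucl N)) (x : Eucl N) :
    ‖bumpPair ρ x‖ = (eLpNorm (ρ.normed volume) 2 (volume : Measure (Eucl N))).toReal := by
  have hm := memLp_bump_sub ρ x
  have h0 : MemLp (0 : Eucl N → Eucl N) 2 volume := MemLp.zero
  have e1 : bumpPair ρ x = WithLp.toLp 2 (hm.1.toLp _, 0) := by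
    rw [bumpPair, pairD, toLpD_eq hm.1, toLpD_eq h0, MemLp.toLp_zero]
  refine Eq.trans ?_ ((Lp.norm_toLp _ hm.1).trans (congrArg ENNReal.toReal hm.2))
  rw [e1, WithLp.prod_norm_eq_of_L2]
  simp only [WithLp.toLp_fst, WithLp.toLp_snd, norm_zero]
  rw [zero_pow two_ne_zero, add_zero, Real.sqrt_sq (norm_nonneg _)]

/-- **Rellich's theorem**: a bounded weakly null sequence in `H¹₀(Ω)`, `Ω` bounded, tends to zero
in `L²`. -/
lemma tendsto_norm_fst_of_weakly_null (hΩ : IsOpen Ω) (hb : Bornology.IsBounded Ω)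
    {w : ℕ → L2Pair N} (hw : ∀ n, w n ∈ H10 Ω) {C : ℝ} (hC : ∀ n, ‖w n‖ ≤ C)
    (h0 : ∀ z : L2Pair N, Tendsto (fun n => ⟪w n, z⟫_ℝ) atTop (𝓝 0)) :
    Tendsto (fun n => ‖(w n).fst‖) atTop (𝓝 0) := by
  have hC0 : 0 ≤ C := (norm_nonneg _).trans (hC 0)
  have hfin : IsFiniteMeasure (volume.restrict Ω) :=
    ⟨by rw [Measure.restrict_apply_univ]; exact hb.measure_lt_top⟩
  -- For a fixed mollifier, weak convergence gives pointwise convergence and a uniform bound, so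
  -- dominated convergence applies on `Ω`, which has finite measure.
  have hmol : ∀ ρ : ContDiffBump (0 : Eucl N), Tendsto (fun n =>
      eLpNorm (mollify ρ (w n).fst) 2 (volume.restrict Ω)) atTop (𝓝 0) := fun ρ => by
    set b := (eLpNorm (ρ.normed volume) 2 (volume : Measure (Eucl N))).toReal
    have hcont : ∀ n, Continuous (mollify ρ (w n).fst) := fun n =>
      (contDiff_mollify ρ ((Lp.memLp (w n).fst).locallyIntegrable one_le_two)).continuous
    have hbd : ∀ n x, ‖mollify ρ (w n).fst x‖ ≤ C * b := fun n x => by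
      rw [← inner_bumpPair]
      refine (norm_inner_le_norm _ _).trans ?_
      rw [norm_bumpPair]
      gcongr
      exact hC n
    have hlim : Tendsto (fun n => ∫⁻ x in Ω, ‖mollify ρ (w n).fst x‖ₑ ^ (2 : ℝ)) atTop
        (𝓝 (∫⁻ _ in Ω, 0)) := by
      refine tendsto_lintegral_of_dominated_convergence (fun _ => ENNReal.ofReal (C * b) ^ (2 : ℝ))
        (fun n => ((hcont n).enorm.measurable.pow_const _)) (fun n => ae_of_all _ fun x => ?_) ?_
        (ae_of_all _ fun x => ?_)
      · dsimp only
        rw [← ofReal_norm]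
        gcongr
        exact hbd n x
      · rw [lintegral_const]
        exact ENNReal.mul_ne_top (by simp) (measure_ne_top _ _)
      · have h1 := h0 (bumpPair ρ x)
        simp only [inner_bumpPair] at h1
        have h2 := (continuous_enorm.tendsto (0 : ℝ)).comp h1
        rw [enorm_zero] at h2
        have h3 := ((ENNReal.continuous_rpow_const (y := 2)).tendsto 0).comp h2
        rwa [ENNReal.zero_rpow_of_pos two_pos] at h3
    rw [lintegral_zero] at hlim
    have h3 := ((ENNReal.continuous_rpow_const (y := 1 / 2)).tendsto 0).comp hlim
    rw [ENNReal.zero_rpow_of_pos (by norm_num)] at h3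
    refine h3.congr fun n => ?_
    rw [eLpNorm_eq_lintegral_rpow_enorm_toReal two_ne_zero ENNReal.ofNat_ne_top]
    simp
  have hnorm : ∀ n, ENNReal.ofReal ‖(w n).fst‖ = eLpNorm (w n).fst 2 (volume.restrict Ω) :=
    fun n => by
      have e : (Ω.indicator ((w n).fst : Eucl N → ℝ)) =ᵐ[volume] ((w n).fst : Eucl N → ℝ) := by
        filter_upwards [ae_eq_zero_of_mem_H10 hΩ (hw n)] with x hx
        by_cases hxΩ : x ∈ Ω
        · rw [indicator_of_mem hxΩ]
        · rw [indicator_of_notMem hxΩ, (hx hxΩ).1]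
      rw [← eLpNorm_indicator_eq_eLpNorm_restrict hΩ.measurableSet, eLpNorm_congr_ae e,
        Lp.norm_def, ENNReal.ofReal_toReal (Lp.memLp _).2.ne]
  suffices h : Tendsto (fun n => ENNReal.ofReal ‖(w n).fst‖) atTop (𝓝 0) by
    have h2 := (ENNReal.tendsto_toReal ENNReal.zero_ne_top).comp h
    simpa [Function.comp_def] using h2
  rw [ENNReal.tendsto_nhds_zero]
  intro ε hε
  -- The radius is chosen before `n`: the mollification error is at most `r 2^N C` for all members
  -- of the sequence.
  obtain ⟨r, hr0, hr⟩ : ∃ r : ℝ, 0 < r ∧ ENNReal.ofReal (r * 2 ^ N * C) ≤ ε / 2 := by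
    have h1 : Tendsto (fun r : ℝ => ENNReal.ofReal (r * 2 ^ N * C)) (𝓝[>] 0) (𝓝 0) := by
      have h2 : Continuous fun r : ℝ => ENNReal.ofReal (r * 2 ^ N * C) :=
        ENNReal.continuous_ofReal.comp (by fun_prop)
      have h3 := (h2.tendsto 0).mono_left (nhdsWithin_le_nhds (s := Ioi 0))
      simpa using h3
    have h2 := ENNReal.tendsto_nhds_zero.mp h1 (ε / 2) (ENNReal.half_pos hε.ne')
    obtain ⟨r, hr, hr'⟩ := (h2.and self_mem_nhdsWithin).exists
    exact ⟨r, hr', hr⟩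
  set ρ : ContDiffBump (0 : Eucl N) := ⟨r / 2, r, half_pos hr0, half_lt_self hr0⟩ with hρ
  filter_upwards [ENNReal.tendsto_nhds_zero.mp (hmol ρ) (ε / 2) (ENNReal.half_pos hε.ne')] with n hn
  rw [hnorm n]
  have hcont : Continuous (mollify ρ (w n).fst) :=
    (contDiff_mollify ρ ((Lp.memLp (w n).fst).locallyIntegrable one_le_two)).continuous
  have e : ((w n).fst : Eucl N → ℝ) = fun x => mollify ρ (w n).fst x
      - (mollify ρ (w n).fst x - (w n).fst x) := by
    ext x; ring
  rw [e]
  refine (eLpNorm_sub_le hcont.aestronglyMeasurable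
    (hcont.aestronglyMeasurable.sub (Lp.memLp (w n).fst).1.restrict) one_le_two).trans ?_
  rw [← ENNReal.add_halves ε]
  refine add_le_add hn ((eLpNorm_mono_measure _ Measure.restrict_le_self).trans
    ((eLpNorm_mollify_sub_le_gradient ρ (hw n)).trans (le_trans ?_ hr)))
  refine ENNReal.ofReal_le_ofReal ?_
  have : ρ.rOut = r := rfl
  rw [this]
  gcongr
  exact hC n

/-- The Fredholm alternative for a symmetric operator satisfying a Gårding inequality. -/
lemma isUnit_of_garding {E F : Type*} [NormedAddCommGroup E] [InnerProductSpace ℝ E]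
    [CompleteSpace E] [TopologicalSpace.SeparableSpace E] [NormedAddCommGroup F] {A : E →L[ℝ] E}
    (hsymm : ∀ u v, ⟪A u, v⟫_ℝ = ⟪u, A v⟫_ℝ) (hinj : ∀ u, A u = 0 → u = 0) {ι : E → F} {C : ℝ}
    (hgarding : ∀ u, ‖u‖ ^ 2 ≤ ⟪A u, u⟫_ℝ + C * ‖ι u‖ ^ 2)
    (hι : ∀ u : ℕ → E, (∀ n, ‖u n‖ ≤ 1) → (∀ z, Tendsto (fun n => ⟪u n, z⟫_ℝ) atTop (𝓝 0)) →
      Tendsto (fun n => ‖ι (u n)‖) atTop (𝓝 0)) : IsUnit A := by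
  -- Otherwise there are unit vectors `v n` with `A (v n) → 0`. By symmetry a weak limit is in the
  -- kernel, hence zero; then `ι` tends to zero along a subsequence, and the Gårding inequality
  -- gives `1 ≤ 0` in the limit.
  obtain ⟨K, hK⟩ : ∃ K : ℝ≥0, ∀ u, ‖u‖ ≤ K * ‖A u‖ := by
    by_contra! hcon
    choose u hu using fun n : ℕ => hcon (n + 1)
    have hu0 : ∀ n, 0 < ‖u n‖ := fun n => lt_of_le_of_lt (by positivity) (hu n)
    set v : ℕ → E := fun n => ‖u n‖⁻¹ • u n with hv
    have hv1 : ∀ n, ‖v n‖ = 1 := fun n => by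
      rw [hv, norm_smul, norm_inv, norm_norm, inv_mul_cancel₀ (hu0 n).ne']
    have hAv : Tendsto (fun n => A (v n)) atTop (𝓝 0) := by
      refine squeeze_zero_norm (fun n => ?_) tendsto_one_div_add_atTop_nhds_zero_nat
      have h1 := hu n
      push_cast at h1
      rw [hv, map_smul, norm_smul, norm_inv, norm_norm, inv_mul_le_iff₀ (hu0 n),
        mul_one_div, le_div_iff₀ (by positivity), mul_comm]
      exact h1.le
    obtain ⟨x, φ, hφ, hx⟩ := exists_weak_limit (fun n => (hv1 n).le)
    have hx0 : x = 0 := by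
      refine hinj x (ext_inner_right ℝ fun z => ?_)
      rw [inner_zero_left, hsymm]
      refine tendsto_nhds_unique (hx (A z)) ?_
      have h2 := Tendsto.inner (𝕜 := ℝ) (hAv.comp hφ.tendsto_atTop) (tendsto_const_nhds (x := z))
      rw [inner_zero_left] at h2
      exact h2.congr fun n => hsymm _ _
    have h3 := hι (fun n => v (φ n)) (fun n => (hv1 _).le) fun z => by simpa [hx0] using hx z
    have h4 : Tendsto (fun n => ‖A (v (φ n))‖ + C * ‖ι (v (φ n))‖ ^ 2) atTop (𝓝 0) := by
      have h5 := (hAv.comp hφ.tendsto_atTop).norm.add ((h3.pow 2).const_mul C)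
      simpa using h5
    refine absurd (ge_of_tendsto' h4 fun n => ?_) (not_le.mpr one_pos)
    have h6 := hgarding (v (φ n))
    have h7 := real_inner_le_norm (A (v (φ n))) (v (φ n))
    rw [hv1, mul_one] at h7
    rw [hv1] at h6
    linarith
  rw [ContinuousLinearMap.isUnit_iff_bijective]
  refine ⟨(injective_iff_map_eq_zero A).mpr hinj, ?_⟩
  have hclosed : IsClosed (A.range : Set E) := by
    have h := (A.antilipschitz_of_bound hK).isClosed_range A.uniformContinuous
    rwa [LinearMap.coe_range]
  -- The range is closed by the lower bound, and by symmetry its orthogonal complement is in the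
  -- kernel, which is trivial.
  have htop : A.range = ⊤ := by
    rw [← hclosed.submodule_topologicalClosure_eq, Submodule.topologicalClosure_eq_top_iff,
      Submodule.eq_bot_iff]
    intro y hy
    refine hinj y (ext_inner_left ℝ fun z => ?_)
    rw [← hsymm, inner_zero_right]
    exact (Submodule.mem_orthogonal _ _).mp hy _ ⟨z, rfl⟩
  exact LinearMap.range_eq_top.mp htop

namespace ShortFlow

variable {τ M : ℝ} {V T : ℝ → Eucl N → Eucl N} (hF : ShortFlow τ M V T)
include hF

/-- At `s = 0` all coefficients are trivial and elements of `H¹₀(Ω)` vanish outside `Ω`, so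
integrals over `Ω` are inner products over `ℝ^N`. With `c = -k²` the Gårding inequality becomes an
equality with constant `1 + k²`. -/
lemma inner_coefOp_zero (c : ℝ) (hΩ : IsOpen Ω) (w z : H10 Ω) :
    ⟪coefOp c T Ω 0 (w : L2Pair N), (z : L2Pair N)⟫_ℝ
      = ⟪(w : L2Pair N), (z : L2Pair N)⟫_ℝ
        + (c - 1) * ⟪(w : L2Pair N).fst, (z : L2Pair N).fst⟫_ℝ := by
  obtain ⟨-, -, -, h⟩ := hF.inner_coefOp c hΩ.measurableSet hF.zero_mem
    (ae_eq_refl (w : L2Pair N).fst) (ae_eq_refl (w : L2Pair N).snd)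
    (ae_eq_refl (z : L2Pair N).fst) (ae_eq_refl (z : L2Pair N).snd)
  have hi1 := L2.integrable_inner (𝕜 := ℝ) (w : L2Pair N).fst (z : L2Pair N).fst
  have hi1' : Integrable (fun x => ((w : L2Pair N).fst : Eucl N → ℝ) x
      * ((z : L2Pair N).fst : Eucl N → ℝ) x) := by
    refine hi1.congr (ae_of_all _ fun x => ?_)
    simp [mul_comm]
  have hi12 : Integrable (fun x => ((w : L2Pair N).fst : Eucl N → ℝ) x
      * ((z : L2Pair N).fst : Eucl N → ℝ) x + (c - 1)
      * ⟪((w : L2Pair N).fst : Eucl N → ℝ) x, ((z : L2Pair N).fst : Eucl N → ℝ) x⟫_ℝ) :=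
    hi1'.add (hi1.const_mul _)
  have hi2 := L2.integrable_inner (𝕜 := ℝ) (w : L2Pair N).snd (z : L2Pair N).snd
  rw [h, inner_L2Pair, L2.inner_def, setIntegral_eq_integral_of_ae_compl_eq_zero]
  · simp only [hF.jac_zero, hF.matB_zero, mul_one, one_apply_eq_self]
    rw [add_right_comm, ← integral_const_mul, ← integral_add hi1' (hi1.const_mul _),
      ← integral_add hi12 hi2]
    refine integral_congr_ae (ae_of_all _ fun x => ?_)
    simp
    ring
  · filter_upwards [ae_eq_zero_of_mem_H10 hΩ z.2] with x hx hxΩ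
    simp [(hx hxΩ).1, (hx hxΩ).2]

lemma isUnit_formOp_coefOp {k : ℝ} (hΩ : IsOpen Ω) (hb : Bornology.IsBounded Ω)
    (hk : NotDirichletEigenvalue k Ω) : IsUnit (formOp (H10 Ω) (coefOp (-k ^ 2) T Ω 0)) := by
  have hzero : MemH1 (0 : Eucl N → ℝ) := MemH1.of_mem_H10 (w := 0) (H10 Ω).zero_mem (Lp.coeFn_zero _ _ _)
  refine isUnit_of_garding (ι := fun u : H10 Ω => (u : L2Pair N).fst) (C := 1 + k ^ 2)
    (fun u v => ?_) (fun u hu => hk u ?_) (fun u => ?_) fun u hu hu0 => ?_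
  · rw [inner_formOp, hF.coefOp_symm _ hΩ.measurableSet hF.zero_mem, real_inner_comm,
      ← inner_formOp, real_inner_comm]
  -- A kernel element solves the state equation with zero source, which the assumption on `k²`
  -- excludes unless it is zero.
  · rw [hF.isState_iff k hzero hΩ.measurableSet]
    intro v
    rw [← inner_formOp, hu, inner_zero_left, (hF.inner_sourcePair hzero.1 hΩ.measurableSet
      hF.zero_mem (ae_eq_refl _)).2]
    simp
  · rw [inner_formOp, hF.inner_coefOp_zero _ hΩ, real_inner_self_eq_norm_sq,
      real_inner_self_eq_norm_sq]
    apply le_of_eq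
    simp only [Submodule.coe_norm]
    ring
  · refine tendsto_norm_fst_of_weakly_null hΩ hb (fun n => (u n).2) (C := 1) hu fun z => ?_
    -- Testing against `z` in the ambient space is testing against its projection onto `H¹₀(Ω)`.
    refine (hu0 (ContinuousLinearMap.adjoint (H10 Ω).subtypeL z)).congr fun n => ?_
    rw [real_inner_comm, inner_adjoint_subtypeL, real_inner_comm]

end ShortFlow

end Fredholm

/-! ### The shape derivative -/

section ShapeDerivative

variable {N : ℕ} {Ω : Set (Eucl N)}

theorem ShortFlow.exists_shape_derivative {τ M k : ℝ} {f ηt ηd : Eucl N → ℝ}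
    {V T : ℝ → Eucl N → Eucl N} (hF : ShortFlow τ M V T) (hΩ : IsOpen Ω)
    (hb : Bornology.IsBounded Ω) (hk : NotDirichletEigenvalue k Ω) (hf : MemH1 f) (hd : MemH1 ηd)
    (ht : MemH2 ηt) :
    ∃ τ' ∈ Ioc 0 τ, ∃ (η : ℝ → H10 Ω) (p : H10 Ω),
      MemH1 (fun z => ⟪weakGrad ηt z, V 0 z⟫_ℝ) ∧
      (∀ s ∈ Icc 0 τ', MemH1 (fun z => ηt (T s z))) ∧
      (∀ u : H10 Ω, IsState k f Ω u ↔ u = η 0) ∧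
      (∀ q : H10 Ω, IsAdjoint k ηt ηd Ω (η 0) q ↔ q = p) ∧
      (∀ s ∈ Icc 0 τ', ∃ us : H10 (T s '' Ω),
        (∀ w : H10 (T s '' Ω), IsState k f (T s '' Ω) w ↔ w = us) ∧
        ∀ᵐ x ∂(volume.restrict Ω), fn (η s) x = fn us (T s x)) ∧
      AffineInY (lagrangian k f ηt ηd T Ω) τ' ∧
      H0 (lagrangian k f ηt ηd T Ω) τ' ∧
      H1 (lagrangian k f ηt ηd T Ω) τ' η p ∧
      (∀ s ∈ Icc 0 τ', ∃ y : H10 Ω,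
        averagedAdjointStates (lagrangian k f ηt ηd T Ω) s (η 0) (η s) = {y}) ∧
      HasDs (lagrangian k f ηt ηd T Ω) (η 0) p (shapeDerivative k f ηt ηd (V 0) Ω (η 0) p) ∧
      HasRemainderLimit (lagrangian k f ηt ηd T Ω) η p 0 ∧
      (∀ s ∈ Icc 0 τ',
        minimax (lagrangian k f ηt ηd T Ω) s = (shapeJ k f ηt ηd (T s '' Ω) : EReal)) ∧
      Tendsto (fun s => (shapeJ k f ηt ηd (T s '' Ω) - shapeJ k f ηt ηd Ω) / s) (𝓝[>] 0)
        (𝓝 (shapeDerivative k f ηt ηd (V 0) Ω (η 0) p)) := by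
  have hm := hΩ.measurableSet
  obtain ⟨τ', hτ', η, p, hstate, hadj, haff, h0, h1, havg, hds, hrem, hmin⟩ :=
    quadLagrangian_minimax_hypotheses (K := H10 Ω) (G := lagrangian k f ηt ηd T Ω)
      (N := coefOp 1 T Ω) (M := coefOp (-k ^ 2) T Ω) (D := targetPair ηt ηd T)
      (F := sourcePair f T Ω) hF.pos
      (fun s hs φ ψ => hF.lagrangian_eq k hf hd ht.1 hm hs φ ψ)
      (fun s hs => hF.coefOp_symm _ hm hs) (fun s hs => hF.coefOp_symm _ hm hs)
      (hF.hasDerivWithinAt_coefOp 1 hm) (hF.hasDerivWithinAt_coefOp (-k ^ 2) hm)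
      (hF.hasDerivWithinAt_targetPair hd ht) (hF.hasDerivWithinAt_sourcePair hf hm)
      (hF.isUnit_formOp_coefOp hΩ hb hk)
  have hsub : ∀ s ∈ Icc 0 τ', s ∈ Icc 0 τ := fun s hs => ⟨hs.1, hs.2.trans hτ'.2⟩
  have h00 : (0 : ℝ) ∈ Icc 0 τ' := ⟨le_rfl, hτ'.1.le⟩
  have himg := fun s hs => hF.exists_state_image k hf hd ht.1 hΩ (hsub s hs) (hstate s hs)
  have hJ : ∀ s ∈ Icc 0 τ',
      minimax (lagrangian k f ηt ηd T Ω) s = (shapeJ k f ηt ηd (T s '' Ω) : EReal) :=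
    fun s hs => by rw [hmin s hs, (himg s hs).2]
  rw [hF.shapeDerivative_eq k hf hd ht hm] at hds
  have hT0 : T 0 '' Ω = Ω := by simp [hF.initial]
  refine ⟨τ', hτ', η, p, (hF.hasDerivWithinAt_weakGrad_comp ht).1,
    fun s hs => hF.memH1_comp ht.1 (hsub s hs),
    fun u => (hF.isState_iff k hf hm u).trans (hstate 0 h00 u),
    fun q => (hF.isAdjoint_iff k hd ht.1 hm _ q).trans (hadj q), fun s hs => (himg s hs).1,
    haff, h0, h1, havg, hds, hrem, hJ, ?_⟩
  -- The abstract theorem with `R = 0`; it remains to replace the minimax by the shape functional,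
  -- using `T_0(Ω) = Ω`.
  have hder := hasDerivWithinAt_minimax hτ'.1 haff h0 h1 hds hrem
  rw [add_zero, ← hasDerivWithinAt_Ioi_iff_Ici,
    hasDerivWithinAt_iff_tendsto_slope' self_notMem_Ioi] at hder
  refine hder.congr' ?_
  filter_upwards [Ioc_mem_nhdsGT hτ'.1] with s hs
  rw [slope_def_field, hJ s ⟨hs.1.le, hs.2⟩, hJ 0 h00, hT0, sub_zero, EReal.toReal_coe,
    EReal.toReal_coe]

end ShapeDerivative

end MinimaxShape

end

theorem theorem2p3 :
    -- the abstract theorem on the derivative of a minimax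
    (∀ (X : Type u) (Y : Type v) [AddCommGroup X] [Module ℝ X] [AddCommGroup Y] [Module ℝ Y]
      (τ : ℝ) (G : ℝ → X → Y → ℝ) (x : ℝ → X) (p : Y) (d R : ℝ),
      0 < τ → AffineInY G τ →
      H0 G τ → H1 G τ x p → HasDs G (x 0) p d → HasRemainderLimit G x p R →
      HasDerivWithinAt (fun s => (minimax G s).toReal) (d + R) (Ici 0) 0) ∧
    -- the shape derivative for the Helmholtz problem
    (∀ (N : ℕ) (Ω : Set (Eucl N)) (k τ : ℝ) (f ηt ηd : Eucl N → ℝ) (V T : ℝ → Eucl N → Eucl N),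
      2 ≤ N → IsOpen Ω → Bornology.IsBounded Ω → NotDirichletEigenvalue k Ω →
      MemH1 f → MemH1 ηd → MemH2 ηt →
      0 < τ → IsVelocity τ V → IsFlow τ V T →
      ∃ τ' ∈ Ioc 0 τ, ∃ (η : ℝ → H10 Ω) (p : H10 Ω),
        -- the objects entering the formulas are well defined
        MemH1 (fun z => ⟪weakGrad ηt z, V 0 z⟫_ℝ) ∧
        (∀ s ∈ Icc 0 τ', MemH1 (fun z => ηt (T s z))) ∧
        -- the state and adjoint problems at `s = 0`
        (∀ u : H10 Ω, IsState k f Ω u ↔ u = η 0) ∧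
        (∀ q : H10 Ω, IsAdjoint k ηt ηd Ω (η 0) q ↔ q = p) ∧
        -- the state problem in the perturbed domain `T_s(Ω)`, and `ηˢ = η_s ∘ T_s`
        (∀ s ∈ Icc 0 τ', ∃ us : H10 (T s '' Ω),
          (∀ w : H10 (T s '' Ω), IsState k f (T s '' Ω) w ↔ w = us) ∧
          ∀ᵐ x ∂(volume.restrict Ω), fn (η s) x = fn us (T s x)) ∧
        -- the Lagrangian satisfies the hypotheses of the abstract theorem, with `R = 0`
        AffineInY (lagrangian k f ηt ηd T Ω) τ' ∧
        H0 (lagrangian k f ηt ηd T Ω) τ' ∧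
        H1 (lagrangian k f ηt ηd T Ω) τ' η p ∧
        (∀ s ∈ Icc 0 τ', ∃ y : H10 Ω,
          averagedAdjointStates (lagrangian k f ηt ηd T Ω) s (η 0) (η s) = {y}) ∧
        HasDs (lagrangian k f ηt ηd T Ω) (η 0) p (shapeDerivative k f ηt ηd (V 0) Ω (η 0) p) ∧
        HasRemainderLimit (lagrangian k f ηt ηd T Ω) η p 0 ∧
        -- the minimax is the shape functional, whose derivative is the explicit expression
        (∀ s ∈ Icc 0 τ',
          minimax (lagrangian k f ηt ηd T Ω) s = (shapeJ k f ηt ηd (T s '' Ω) : EReal)) ∧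
        Tendsto (fun s => (shapeJ k f ηt ηd (T s '' Ω) - shapeJ k f ηt ηd Ω) / s) (𝓝[>] 0)
          (𝓝 (shapeDerivative k f ηt ηd (V 0) Ω (η 0) p))) := by
  refine ⟨fun X Y _ _ _ _ τ G x p d R hτ ha h0 h1 h2 h3 =>
    hasDerivWithinAt_minimax hτ ha h0 h1 h2 h3, ?_⟩
  intro N Ω k τ f ηt ηd V T _ hΩ hb hk hf hd ht hτ hV hT
  obtain ⟨τ₁, hτ₁, M, hF⟩ := exists_shortFlow hτ hV hT
  obtain ⟨τ', hτ', h⟩ := hF.exists_shape_derivative hΩ hb hk hf hd ht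
  exact ⟨τ', ⟨hτ'.1, hτ'.2.trans hτ₁.2⟩, h⟩
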